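/- Let $I\subseteq\mathbb{R}$ be a non-empty open interval and let $p_1,p_2,q_1,q_2,r_1,r_2$ be real, smooth, nowhere vanishing functions of $t\in I$. Consider the variable-coefficient Davey–Stewartson system $$i\psi_t+p_1(t)\psi_{xx}+p_2(t)\psi_{yy}=q_1(t)|\psi|^2\psi+q_2(t)\psi w,\qquad w_{xx}+r_1(t)w_{yy}=r_2(t)(|\psi|^2)_{yy},$$ with $\psi=u+iv$ complex and $w$ real, written as a real system for $(u,v,w)$. A Lie point symmetry is a smooth vector field on $I\times\mathbb{R}^2\times\mathbb{R}^3$ (coordinates $t,x,y,u,v,w$) whose second prolongation annihilates the system on its solution surface in the second jet space. The following are equivalent. 1. The system admits the centerless Virasoro algebra as a symmetry algebra, in the sense that there is an injective linear map $\tau\mapsto X(\tau)$ from $C^\infty(I)$ to the Lie point symmetries with $[X(\tau_1),X(\tau_2)]=X(\tau_1\dot\tau_2-\tau_2\dot\tau_1)$. 2. There are linearly independent Lie point symmetries $L_n$, $n\in\mathbb{Z}$, with $[L_m,L_n]=(m-n)L_{m+n}$. 3. Every $\tau\in C^\infty(I)$ is the $\partial_t$-component of some Lie point symmetry. 4. On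 $I$: $p_2=-p_1r_1$, and each of $\dot r_1/(q_1r_1)$, $p_1p_2/q_1^2$, $q_1q_2r_2/p_2^2$ is constant. 5. (Table 1) There are constants $k_0,k_1,r_{10},r_{20}$ and an antiderivative $Q=\int q_1\,dt$ on $I$ with $$p_1=k_1q_1e^{k_0Q},\quad p_2=-r_{10}k_1q_1e^{-k_0Q},\quad r_1=r_{10}e^{-2k_0Q},\quad r_2=r_{20}\frac{q_1}{q_2}e^{-2k_0Q}.$$ 6. (Table 2) There are constants $k_0,k_1,r_{10},r_{20}$ and an antiderivative $P=\int p_1\,dt$ on $I$ such that $D=k_0P+k_1$ has no zero on $I$ and $$q_1=\frac{p_1}{D},\quad r_1=\frac{r_{10}}{D^2},\quad p_2=-r_{10}\frac{p_1}{D^2},\quad r_2=\frac{r_{20}}{D^3}\frac{p_1}{q_2}.$$ In that case, with $k_0,k_1,r_{10},Q$ as in 5, the full symmetry algebra is the Kac–Moody–Virasoro algebra $\{X(\tau)\}\ltimes\{Y(g),Z(h),W(m)\}$: every Lie point symmetry can be written as $X(\tau)+Y(g)+Z(h)+W(m)$ with unique $\tau,g,h,m\in C^\infty(I)$, and conversely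 all these fields are Lie point symmetries, where $$\begin{aligned}X(\tau)&=\tau\Big[\partial_t+\tfrac12\Big(\tfrac{\dot q_1}{q_1}+k_0q_1\Big)x\,\partial_x+\tfrac12\Big(\tfrac{\dot q_1}{q_1}-k_0q_1\Big)y\,\partial_y-\tfrac{\dot q_1}{2q_1}(u\,\partial_u+v\,\partial_v)-\tfrac{\dot q_2}{q_2}w\,\partial_w\Big]\\&\quad+\tfrac{\dot\tau}{2}\big[x\,\partial_x+y\,\partial_y-u\,\partial_u-v\,\partial_v-2w\,\partial_w\big]+\Phi\,(v\,\partial_u-u\,\partial_v)+\tfrac1{q_2}\Phi_t\,\partial_w,\\ \Phi&=-\tfrac{x^2}{8p_1}\tfrac{d}{dt}\Big[\dot\tau+\Big(\tfrac{\dot q_1}{q_1}+k_0q_1\Big)\tau\Big]-\tfrac{y^2}{8p_2}\tfrac{d}{dt}\Big[\dot\tau+\Big(\tfrac{\dot q_1}{q_1}-k_0q_1\Big)\tau\Big],\\ Y(g)&=g\,\partial_x-\tfrac{x\dot g}{2p_1}(v\,\partial_u-u\,\partial_v)-\tfrac{x}{2q_2}\tfrac{d}{dt}\Big[\tfrac{\dot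 g}{p_1}\Big]\partial_w,\\ Z(h)&=h\,\partial_y-\tfrac{y\dot h}{2p_2}(v\,\partial_u-u\,\partial_v)-\tfrac{y}{2q_2}\tfrac{d}{dt}\Big[\tfrac{\dot h}{p_2}\Big]\partial_w,\\ W(m)&=m\,(v\,\partial_u-u\,\partial_v)+\tfrac{\dot m}{q_2}\partial_w,\end{aligned}$$ and the commutation relations are $$\begin{aligned}&[X(\tau_1),X(\tau_2)]=X(\tau_1\dot\tau_2-\tau_2\dot\tau_1),\qquad [X(\tau),W(m)]=W(\tau\dot m),\\&[X(\tau),Y(g)]=Y\big(\tau\dot g-\tfrac12g\dot\tau-\tfrac12g\tau(k_0q_1+\tfrac{\dot q_1}{q_1})\big),\\&[X(\tau),Z(h)]=Z\big(\tau\dot h-\tfrac12h\dot\tau+\tfrac12h\tau(k_0q_1-\tfrac{\dot q_1}{q_1})\big),\\&[Y(g_1),Y(g_2)]=W\Big(-\tfrac{e^{-k_0Q}}{2k_1q_1}(g_1\dot g_2-g_2\dot g_1)\Big),\qquad[Z(h_1),Z(h_2)]=W\Big(\tfrac{e^{k_0Q}}{2k_1r_{10}q_1}(h_1\dot h_2-h_2\dot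 h_1)\Big),\\&[Y(g),Z(h)]=[Y(g),W(m)]=[Z(h),W(m)]=[W(m_1),W(m_2)]=0.\end{aligned}$$ -/

import Mathlib

open scoped ContDiff

namespace VCDS

/-- Triples of reals. As independent variables the entries are `(t, x, y)`, as dependent
variables they are `(u, v, w)`, where `ψ = u + i v`. -/
abbrev R3 := Fin 3 → ℝ

/-- The space of independent and dependent variables: `((t, x, y), (u, v, w))`. -/
abbrev J0 := R3 × R3

/-- The first jet space. A point is `(z, f, D)`, where `D i` holds the derivatives of
`(u, v, w)` with respect to the `i`-th independent variable. -/
abbrev J1 := R3 × R3 × (Fin 3 → R3)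

/-- The second jet space. A point is `(z, f, D, H)`, where `H i k` holds the second derivatives
of `(u, v, w)` with respect to the `i`-th and the `k`-th independent variable. Genuine jets are
those with `H` symmetric, see `IsJet`. -/
abbrev J2 := R3 × R3 × (Fin 3 → R3) × (Fin 3 → Fin 3 → R3)

/-- The mixed second derivatives agree. -/
def IsJet (j : J2) : Prop := ∀ i k, j.2.2.2 i k = j.2.2.2 k i

/-- Projection of second jets to first jets. -/
def toJ1 (j : J2) : J1 := (j.1, j.2.1, j.2.2.1)

/-- The domain `t ∈ I` in the space of independent and dependent variables. -/
def dom (I : Set ℝ) : Set J0 := {z | z.1 0 ∈ I}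

/-- The six time-dependent coefficients of the system. -/
structure Coeffs where
  p1 : ℝ → ℝ
  p2 : ℝ → ℝ
  q1 : ℝ → ℝ
  q2 : ℝ → ℝ
  r1 : ℝ → ℝ
  r2 : ℝ → ℝ

/-- A function of `t` is smooth on `I`. -/
def Smooth (I : Set ℝ) (f : ℝ → ℝ) : Prop := ContDiffOn ℝ ∞ f I

/-- A function of `t` is smooth and nowhere zero on `I`. -/
def SmoothNZ (I : Set ℝ) (f : ℝ → ℝ) : Prop := Smooth I f ∧ ∀ t ∈ I, f t ≠ 0

/-- All six coefficients are smooth and nowhere zero on `I`. -/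
structure Coeffs.Admissible (c : Coeffs) (I : Set ℝ) : Prop where
  p1 : SmoothNZ I c.p1
  p2 : SmoothNZ I c.p2
  q1 : SmoothNZ I c.q1
  q2 : SmoothNZ I c.q2
  r1 : SmoothNZ I c.r1
  r2 : SmoothNZ I c.r2

/-- The variable coefficient Davey-Stewartson system
`i ψ_t + p₁ ψ_xx + p₂ ψ_yy = q₁ |ψ|² ψ + q₂ ψ w`, `w_xx + r₁ w_yy = r₂ (|ψ|²)_yy`
with `ψ = u + i v`, as three real functions on the second jet space (imaginary part of the first
equation, its real part, and the second equation); the system is `system c = 0`. -/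
def system (c : Coeffs) (j : J2) : R3 :=
  let t := j.1 0
  let u := j.2.1 0
  let v := j.2.1 1
  let w := j.2.1 2
  let D := j.2.2.1
  let H := j.2.2.2
  ![D 0 0 + c.p1 t * H 1 1 1 + c.p2 t * H 2 2 1
      - (c.q1 t * v * (u ^ 2 + v ^ 2) + c.q2 t * v * w),
    -(D 0 1) + c.p1 t * H 1 1 0 + c.p2 t * H 2 2 0
      - (c.q1 t * u * (u ^ 2 + v ^ 2) + c.q2 t * u * w),
    H 1 1 2 + c.r1 t * H 2 2 2
      - c.r2 t * (2 * (D 2 0 ^ 2 + u * H 2 2 0 + D 2 1 ^ 2 + v * H 2 2 1))]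

/-- A vector field `τ ∂_t + ξ ∂_x + η ∂_y + φ₁ ∂_u + φ₂ ∂_v + φ₃ ∂_w`, given by its components
`((τ, ξ, η), (φ₁, φ₂, φ₃))`. -/
abbrev VF := J0 → J0

/-- Total derivative, with respect to the `i`-th independent variable, of a function of the
independent and dependent variables. -/
noncomputable def totalD0 {E : Type} [NormedAddCommGroup E] [NormedSpace ℝ E]
    (F : J0 → E) (i : Fin 3) (j : J1) : E :=
  fderiv ℝ F (j.1, j.2.1) (Pi.single i 1, j.2.2 i)

/-- Total derivative, with respect to the `i`-th independent variable, of a function on the first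
jet space. -/
noncomputable def totalD1 {E : Type} [NormedAddCommGroup E] [NormedSpace ℝ E]
    (F : J1 → E) (i : Fin 3) (j : J2) : E :=
  fderiv ℝ F (toJ1 j) (Pi.single i 1, j.2.2.1 i, j.2.2.2 i)

/-- First order prolongation coefficients `φ^i = D_i φ - ∑ₗ (D_i ξˡ) f_l`, for the three dependent
variables at once. -/
noncomputable def prol1 (V : VF) (i : Fin 3) (j : J1) : R3 :=
  totalD0 (fun z => (V z).2) i j - ∑ l, totalD0 (fun z => (V z).1 l) i j • j.2.2 l

/-- Second order prolongation coefficients `φ^{ik} = D_k φ^i - ∑ₗ (D_k ξˡ) f_{il}`. -/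
noncomputable def prol2 (V : VF) (i k : Fin 3) (j : J2) : R3 :=
  totalD1 (prol1 V i) k j - ∑ l, totalD0 (fun z => (V z).1 l) k (toJ1 j) • j.2.2.2 i l

/-- The second prolongation of a vector field, as a vector field on the second jet space. -/
noncomputable def prolong (V : VF) (j : J2) : J2 :=
  ((V (j.1, j.2.1)).1, (V (j.1, j.2.1)).2,
    fun i => prol1 V i (toJ1 j), fun i k => prol2 V i k j)

/-- `V` is an infinitesimal Lie point symmetry of the system for `t ∈ I`: it is smooth, and its
second prolongation annihilates the system on the solution surface in the second jet space. -/
def IsSymmetry (I : Set ℝ) (c : Coeffs) (V : VF) : Prop :=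
  ContDiffOn ℝ ∞ V (dom I) ∧
  ∀ j : J2, IsJet j → j.1 0 ∈ I → system c j = 0 →
    fderiv ℝ (system c) j (prolong V j) = 0

/-- Two vector fields agree for `t ∈ I`. -/
def EqVF (I : Set ℝ) (V W : VF) : Prop := Set.EqOn V W (dom I)

/-- The Lie bracket (commutator) of vector fields. -/
noncomputable def bracket (V W : VF) : VF := VectorField.lieBracket ℝ V W

/-- The symmetry algebra contains a copy of the centerless Virasoro (Witt) algebra: there are
linearly independent symmetries `L n`, `n ∈ ℤ`, with `[L m, L n] = (m - n) L (m + n)`. -/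
def AdmitsWitt (I : Set ℝ) (c : Coeffs) : Prop :=
  ∃ L : ℤ → VF, (∀ n, IsSymmetry I c (L n)) ∧
    LinearIndependent ℝ (fun n => (dom I).domRestrict (L n)) ∧
    ∀ m n, EqVF I (bracket (L m) (L n)) (((m - n : ℤ) : ℝ) • L (m + n))

/-- The symmetry algebra contains a copy of the Lie algebra of all smooth vector fields
`τ(t) ∂_t` on `I`, the centerless Virasoro algebra with arbitrary functions `τ`: there is an
injective linear map `X` from smooth functions on `I` to symmetries with
`[X τ₁, X τ₂] = X (τ₁ τ₂' - τ₂ τ₁')`. -/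
def AdmitsVirasoro (I : Set ℝ) (c : Coeffs) : Prop :=
  ∃ X : (ℝ → ℝ) → VF, (∀ τ, Smooth I τ → IsSymmetry I c (X τ)) ∧
    (∀ (a b : ℝ) (τ₁ τ₂ : ℝ → ℝ), Smooth I τ₁ → Smooth I τ₂ →
      EqVF I (X (a • τ₁ + b • τ₂)) (a • X τ₁ + b • X τ₂)) ∧
    (∀ τ, Smooth I τ → (EqVF I (X τ) 0 ↔ Set.EqOn τ 0 I)) ∧
    ∀ τ₁ τ₂, Smooth I τ₁ → Smooth I τ₂ →
      EqVF I (bracket (X τ₁) (X τ₂)) (X (τ₁ * deriv τ₂ - τ₂ * deriv τ₁))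

/-- The time component `τ` of symmetries is free: every smooth function of `t` on `I` is the
`∂_t`-component of some symmetry. -/
def TimeComponentFree (I : Set ℝ) (c : Coeffs) : Prop :=
  ∀ τ, Smooth I τ → ∃ V, IsSymmetry I c V ∧ ∀ z ∈ dom I, (V z).1 0 = τ (z.1 0)

/-- The four relations between the coefficients. -/
def Relations (I : Set ℝ) (c : Coeffs) : Prop :=
  (∀ t ∈ I, c.p2 t = -(c.p1 t * c.r1 t)) ∧
  (∃ k : ℝ, ∀ t ∈ I, deriv c.r1 t / (c.q1 t * c.r1 t) = k) ∧
  (∃ k : ℝ, ∀ t ∈ I, c.p1 t * c.p2 t / c.q1 t ^ 2 = k) ∧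
  (∃ k : ℝ, ∀ t ∈ I, c.q1 t * c.q2 t * c.r2 t / c.p2 t ^ 2 = k)

/-- `F` is an indefinite integral of `f` on `I`. -/
def IsAntideriv (I : Set ℝ) (F f : ℝ → ℝ) : Prop := ∀ t ∈ I, HasDerivAt F (f t) t

/-- The coefficients in terms of the free functions `q₁` and `q₂`, with constants
`k₀, k₁, r₁₀, r₂₀` and `Q = ∫ q₁ dt`. -/
structure Table1 (I : Set ℝ) (c : Coeffs) (k0 k1 r10 r20 : ℝ) (Q : ℝ → ℝ) : Prop where
  antideriv : IsAntideriv I Q c.q1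
  p1 : ∀ t ∈ I, c.p1 t = k1 * c.q1 t * Real.exp (k0 * Q t)
  p2 : ∀ t ∈ I, c.p2 t = -(r10 * k1 * c.q1 t * Real.exp (-(k0 * Q t)))
  r1 : ∀ t ∈ I, c.r1 t = r10 * Real.exp (-(2 * k0 * Q t))
  r2 : ∀ t ∈ I, c.r2 t = r20 * (c.q1 t / c.q2 t) * Real.exp (-(2 * k0 * Q t))

/-- The coefficients in terms of the free functions `p₁` and `q₂`, with constants
`k₀, k₁, r₁₀, r₂₀` and `P = ∫ p₁ dt`. -/
structure Table2 (I : Set ℝ) (c : Coeffs) (k0 k1 r10 r20 : ℝ) (P : ℝ → ℝ) : Prop where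
  antideriv : IsAntideriv I P c.p1
  denom_ne : ∀ t ∈ I, k0 * P t + k1 ≠ 0
  q1 : ∀ t ∈ I, c.q1 t = c.p1 t / (k0 * P t + k1)
  r1 : ∀ t ∈ I, c.r1 t = r10 / (k0 * P t + k1) ^ 2
  p2 : ∀ t ∈ I, c.p2 t = -(r10 * (c.p1 t / (k0 * P t + k1) ^ 2))
  r2 : ∀ t ∈ I, c.r2 t = r20 / (k0 * P t + k1) ^ 3 * (c.p1 t / c.q2 t)

/-- The function `Φ(t, x, y)` belonging to `τ`. -/
noncomputable def Phi (c : Coeffs) (k0 : ℝ) (τ : ℝ → ℝ) (t x y : ℝ) : ℝ :=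
  -(x ^ 2 / (8 * c.p1 t)) *
      deriv (fun s => deriv τ s + (deriv c.q1 s / c.q1 s + k0 * c.q1 s) * τ s) t
    - y ^ 2 / (8 * c.p2 t) *
      deriv (fun s => deriv τ s + (deriv c.q1 s / c.q1 s - k0 * c.q1 s) * τ s) t

/-- The generators `X(τ)`. -/
noncomputable def genX (c : Coeffs) (k0 : ℝ) (τ : ℝ → ℝ) : VF := fun z =>
  let t := z.1 0
  let x := z.1 1
  let y := z.1 2
  let u := z.2 0
  let v := z.2 1
  let w := z.2 2
  let a := deriv c.q1 t / c.q1 t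
  (![τ t,
     τ t * (1 / 2 * (a + k0 * c.q1 t) * x) + deriv τ t / 2 * x,
     τ t * (1 / 2 * (a - k0 * c.q1 t) * y) + deriv τ t / 2 * y],
   ![-(τ t * (a / 2 * u)) - deriv τ t / 2 * u + Phi c k0 τ t x y * v,
     -(τ t * (a / 2 * v)) - deriv τ t / 2 * v - Phi c k0 τ t x y * u,
     -(τ t * (deriv c.q2 t / c.q2 t * w)) - deriv τ t * w
       + 1 / c.q2 t * deriv (fun s => Phi c k0 τ s x y) t])

/-- The generators `Y(g)`. -/
noncomputable def genY (c : Coeffs) (g : ℝ → ℝ) : VF := fun z =>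
  let t := z.1 0
  let x := z.1 1
  let u := z.2 0
  let v := z.2 1
  (![0, g t, 0],
   ![-(x * deriv g t / (2 * c.p1 t)) * v,
     x * deriv g t / (2 * c.p1 t) * u,
     -(x / (2 * c.q2 t) * deriv (fun s => deriv g s / c.p1 s) t)])

/-- The generators `Z(h)`. -/
noncomputable def genZ (c : Coeffs) (h : ℝ → ℝ) : VF := fun z =>
  let t := z.1 0
  let y := z.1 2
  let u := z.2 0
  let v := z.2 1
  (![0, 0, h t],
   ![-(y * deriv h t / (2 * c.p2 t)) * v,
     y * deriv h t / (2 * c.p2 t) * u,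
     -(y / (2 * c.q2 t) * deriv (fun s => deriv h s / c.p2 s) t)])

/-- The generators `W(m)`. -/
noncomputable def genW (c : Coeffs) (m : ℝ → ℝ) : VF := fun z =>
  let t := z.1 0
  (0, ![m t * z.2 1, -(m t * z.2 0), deriv m t / c.q2 t])

/-- The symmetry algebra is the Kac-Moody-Virasoro algebra `{X(τ)} ⋉ {Y(g), Z(h), W(m)}`: these
generators are symmetries, every symmetry is `X(τ) + Y(g) + Z(h) + W(m)` for smooth functions
`τ, g, h, m` on `I` that are unique, and the commutation relations hold. -/
structure IsKMV (I : Set ℝ) (c : Coeffs) (k0 k1 r10 : ℝ) (Q : ℝ → ℝ) : Prop where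
  symX : ∀ τ, Smooth I τ → IsSymmetry I c (genX c k0 τ)
  symY : ∀ g, Smooth I g → IsSymmetry I c (genY c g)
  symZ : ∀ h, Smooth I h → IsSymmetry I c (genZ c h)
  symW : ∀ m, Smooth I m → IsSymmetry I c (genW c m)
  full : ∀ V, IsSymmetry I c V → ∃ τ g h m, Smooth I τ ∧ Smooth I g ∧ Smooth I h ∧ Smooth I m ∧
    EqVF I V (genX c k0 τ + genY c g + genZ c h + genW c m)
  unique : ∀ τ g h m τ' g' h' m', Smooth I τ → Smooth I g → Smooth I h → Smooth I m →
    Smooth I τ' → Smooth I g' → Smooth I h' → Smooth I m' →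
    EqVF I (genX c k0 τ + genY c g + genZ c h + genW c m)
      (genX c k0 τ' + genY c g' + genZ c h' + genW c m') →
    Set.EqOn τ τ' I ∧ Set.EqOn g g' I ∧ Set.EqOn h h' I ∧ Set.EqOn m m' I
  commXX : ∀ τ₁ τ₂, Smooth I τ₁ → Smooth I τ₂ →
    EqVF I (bracket (genX c k0 τ₁) (genX c k0 τ₂))
      (genX c k0 (fun t => τ₁ t * deriv τ₂ t - τ₂ t * deriv τ₁ t))
  commXW : ∀ τ m, Smooth I τ → Smooth I m →
    EqVF I (bracket (genX c k0 τ) (genW c m)) (genW c (fun t => τ t * deriv m t))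
  commXY : ∀ τ g, Smooth I τ → Smooth I g →
    EqVF I (bracket (genX c k0 τ) (genY c g))
      (genY c (fun t => τ t * deriv g t - 1 / 2 * g t * deriv τ t
        - 1 / 2 * g t * τ t * (k0 * c.q1 t + deriv c.q1 t / c.q1 t)))
  commXZ : ∀ τ h, Smooth I τ → Smooth I h →
    EqVF I (bracket (genX c k0 τ) (genZ c h))
      (genZ c (fun t => τ t * deriv h t - 1 / 2 * h t * deriv τ t
        + 1 / 2 * h t * τ t * (k0 * c.q1 t - deriv c.q1 t / c.q1 t)))
  commYY : ∀ g₁ g₂, Smooth I g₁ → Smooth I g₂ →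
    EqVF I (bracket (genY c g₁) (genY c g₂))
      (genW c (fun t => -(Real.exp (-(k0 * Q t)) / (2 * k1 * c.q1 t))
        * (g₁ t * deriv g₂ t - g₂ t * deriv g₁ t)))
  commZZ : ∀ h₁ h₂, Smooth I h₁ → Smooth I h₂ →
    EqVF I (bracket (genZ c h₁) (genZ c h₂))
      (genW c (fun t => Real.exp (k0 * Q t) / (2 * k1 * r10 * c.q1 t)
        * (h₁ t * deriv h₂ t - h₂ t * deriv h₁ t)))
  commYZ : ∀ g h, Smooth I g → Smooth I h → EqVF I (bracket (genY c g) (genZ c h)) 0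
  commYW : ∀ g m, Smooth I g → Smooth I m → EqVF I (bracket (genY c g) (genW c m)) 0
  commZW : ∀ h m, Smooth I h → Smooth I m → EqVF I (bracket (genZ c h) (genW c m)) 0
  commWW : ∀ m₁ m₂, Smooth I m₁ → Smooth I m₂ → EqVF I (bracket (genW c m₁) (genW c m₂)) 0

end VCDS

/-! ### Derivatives over the open time interval. -/

namespace VCDS

/-! The symmetry condition must hold at every jet on the solution surface. Jet coordinates that are
absent from the system, or that can be compensated by `f_t` or `w_xx`, are free there, so comparing
the condition at a few chosen jets isolates each determining equation. Solving these equations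
(`IsSymmetry.eq_symField`) shows that every symmetry is one of the fields `symField c τ g h m`. The
functions `g`, `h`, `m` are unconstrained, and `τ` has to satisfy the four linear differential
equations of `TimeCond` (`symField_isSymmetry_iff`). The candidates are closed under commutators by
explicit formulas (`bracket_symField`), and taking the time component sends commutators to
commutators of vector fields on the line.

The question is thus when `TimeCond` has many solutions. Written in `τ`, the `shift` condition has
order three and no `τ''` term, `phase` has order one, `space` and `source` have order zero. Suppose
that a family `T n` of solutions satisfies the Witt relations. By `WittTimes.dichotomy` it vanishes
identically, or `T (-1)` and `T 1` have no common zero. In the second case `T (k + 1)` is `T k`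
times a fixed local coordinate for small `k`, so a third order operator of this shape annihilating
all `T n` has leading coefficient zero, and an operator of order at most one annihilating them is
zero. All coefficients of the four equations therefore vanish, which is `RateRelations`. The first
case is impossible for independent fields: without time component the commutators have no
translation part, and without translation part they vanish, while every Witt generator is a multiple
of a commutator.

Conversely `RateRelations` makes `TimeCond` hold for every smooth `τ`. Integrating these logarithmic
relations gives constants, the constants give Table 1, and replacing `∫ q₁` by `∫ p₁` gives Table 2.
Under Table 1 the displayed generators are the candidates with three of the four functions zero, so
the full algebra and all its commutators are special cases of the general formulas. The Virasoro
statement and the free time component both lead back to the relations through the functions `exp (-n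
t)`. -/

theorem isOpen_dom {I : Set ℝ} (hI : IsOpen I) : IsOpen (dom I) :=
  hI.preimage (by fun_prop : Continuous fun z : J0 => z.1 0)

theorem dom_mem_nhds {I : Set ℝ} (hI : IsOpen I) {p : J0} (hp : p ∈ dom I) : dom I ∈ nhds p :=
  (isOpen_dom hI).mem_nhds hp

theorem Smooth.hasDerivAt {I : Set ℝ} (hI : IsOpen I) {f : ℝ → ℝ} (hf : Smooth I f) {t : ℝ}
    (ht : t ∈ I) : HasDerivAt f (deriv f t) t :=
  ((hf.differentiableOn (by simp)).differentiableAt (hI.mem_nhds ht)).hasDerivAt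

theorem Smooth.deriv {I : Set ℝ} (hI : IsOpen I) {f : ℝ → ℝ} (hf : Smooth I f) :
    Smooth I (deriv f) :=
  ContDiffOn.deriv_of_isOpen hf hI (by simp)

/-- A derivative along a line determines the value of the Fréchet derivative. -/
theorem fderiv_eq_of_line {E F : Type*} [NormedAddCommGroup E] [NormedSpace ℝ E]
    [NormedAddCommGroup F] [NormedSpace ℝ F] {f : E → F} {p d : E} {v : F}
    (hf : DifferentiableAt ℝ f p) (h : HasDerivAt (fun s : ℝ => f (p + s • d)) v 0) :
    fderiv ℝ f p d = v := by
  have h1 : HasLineDerivAt ℝ f (fderiv ℝ f p d) p d := hf.hasFDerivAt.hasLineDerivAt d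
  exact h1.unique h

theorem hasDerivAt_coord (a b s : ℝ) : HasDerivAt (fun s : ℝ => a + s * b) b s := by
  simpa using ((hasDerivAt_id s).mul_const b).const_add a

theorem Smooth.hasDerivAt_line {I : Set ℝ} (hI : IsOpen I) {f : ℝ → ℝ} (hf : Smooth I f) {t : ℝ}
    (ht : t ∈ I) (b : ℝ) : HasDerivAt (fun s : ℝ => f (t + s * b)) (_root_.deriv f t * b) 0 := by
  have h1 : HasDerivAt f (_root_.deriv f t) (t + 0 * b) := by simpa using hf.hasDerivAt hI ht
  exact h1.comp (0 : ℝ) (hasDerivAt_coord t b 0)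

/-! ### The linearised system and the second prolongation in coordinates. -/

/-- The derivative of the system in the direction `k`. -/
theorem fderiv_system {I : Set ℝ} (hI : IsOpen I) {c : Coeffs} (hc : c.Admissible I) (j k : J2)
    (hj : j.1 0 ∈ I) : fderiv ℝ (system c) j k =
    ![k.2.2.1 0 0 + (deriv c.p1 (j.1 0) * k.1 0 * j.2.2.2 1 1 1 + c.p1 (j.1 0) * k.2.2.2 1 1 1)
        + (deriv c.p2 (j.1 0) * k.1 0 * j.2.2.2 2 2 1 + c.p2 (j.1 0) * k.2.2.2 2 2 1)
        - ((deriv c.q1 (j.1 0) * k.1 0 * j.2.1 1 + c.q1 (j.1 0) * k.2.1 1)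
              * (j.2.1 0 ^ 2 + j.2.1 1 ^ 2)
            + c.q1 (j.1 0) * j.2.1 1 * (2 * j.2.1 0 * k.2.1 0 + 2 * j.2.1 1 * k.2.1 1)
          + ((deriv c.q2 (j.1 0) * k.1 0 * j.2.1 1 + c.q2 (j.1 0) * k.2.1 1) * j.2.1 2
            + c.q2 (j.1 0) * j.2.1 1 * k.2.1 2)),
      -k.2.2.1 0 1 + (deriv c.p1 (j.1 0) * k.1 0 * j.2.2.2 1 1 0 + c.p1 (j.1 0) * k.2.2.2 1 1 0)
        + (deriv c.p2 (j.1 0) * k.1 0 * j.2.2.2 2 2 0 + c.p2 (j.1 0) * k.2.2.2 2 2 0)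
        - ((deriv c.q1 (j.1 0) * k.1 0 * j.2.1 0 + c.q1 (j.1 0) * k.2.1 0)
              * (j.2.1 0 ^ 2 + j.2.1 1 ^ 2)
            + c.q1 (j.1 0) * j.2.1 0 * (2 * j.2.1 0 * k.2.1 0 + 2 * j.2.1 1 * k.2.1 1)
          + ((deriv c.q2 (j.1 0) * k.1 0 * j.2.1 0 + c.q2 (j.1 0) * k.2.1 0) * j.2.1 2
            + c.q2 (j.1 0) * j.2.1 0 * k.2.1 2)),
      k.2.2.2 1 1 2 + (deriv c.r1 (j.1 0) * k.1 0 * j.2.2.2 2 2 2 + c.r1 (j.1 0) * k.2.2.2 2 2 2)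
        - (deriv c.r2 (j.1 0) * k.1 0 * (2 * (j.2.2.1 2 0 ^ 2 + j.2.1 0 * j.2.2.2 2 2 0
              + j.2.2.1 2 1 ^ 2 + j.2.1 1 * j.2.2.2 2 2 1))
          + c.r2 (j.1 0) * (2 * (2 * j.2.2.1 2 0 * k.2.2.1 2 0
              + (k.2.1 0 * j.2.2.2 2 2 0 + j.2.1 0 * k.2.2.2 2 2 0)
              + 2 * j.2.2.1 2 1 * k.2.2.1 2 1
              + (k.2.1 1 * j.2.2.2 2 2 1 + j.2.1 1 * k.2.2.2 2 2 1))))] := by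
  have D : ∀ {f : ℝ → ℝ}, SmoothNZ I f → DifferentiableAt ℝ (fun j : J2 => f (j.1 0)) j := by
    intro f hf
    exact (hf.1.hasDerivAt hI hj).differentiableAt.comp j
      (by fun_prop : DifferentiableAt ℝ (fun j : J2 => j.1 0) j)
  have d1 := D hc.p1
  have d2 := D hc.p2
  have d3 := D hc.q1
  have d4 := D hc.q2
  have d5 := D hc.r1
  have d6 := D hc.r2
  have T : ∀ {f : ℝ → ℝ}, SmoothNZ I f →
      HasDerivAt (fun s : ℝ => f (j.1 0 + s * k.1 0)) (deriv f (j.1 0) * k.1 0) 0 :=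
    fun hf => hf.1.hasDerivAt_line hI hj _
  have e1 := T hc.p1
  have e2 := T hc.p2
  have e3 := T hc.q1
  have e4 := T hc.q2
  have e5 := T hc.r1
  have e6 := T hc.r2
  have u := fun i : Fin 3 => hasDerivAt_coord (j.2.1 i) (k.2.1 i) 0
  have v := fun i l : Fin 3 => hasDerivAt_coord (j.2.2.1 i l) (k.2.2.1 i l) 0
  have w := fun i l m : Fin 3 => hasDerivAt_coord (j.2.2.2 i l m) (k.2.2.2 i l m) 0
  apply fderiv_eq_of_line
  · rw [differentiableAt_pi]
    intro i
    fin_cases i <;> simp only [system] <;> simp <;> fun_prop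
  · rw [hasDerivAt_pi]
    intro i
    fin_cases i
    · simp only [system]
      simp
      refine ((((v 0 0).add (e1.mul (w 1 1 1))).add (e2.mul (w 2 2 1))).sub
        (((e3.mul (u 1)).mul (((u 0).pow 2).add ((u 1).pow 2))).add
          ((e4.mul (u 1)).mul (u 2)))).congr_deriv ?_
      simp
    · simp only [system]
      simp [-neg_add_rev]
      refine ((((v 0 1).neg.add (e1.mul (w 1 1 0))).add (e2.mul (w 2 2 0))).sub
        (((e3.mul (u 0)).mul (((u 0).pow 2).add ((u 1).pow 2))).add
          ((e4.mul (u 0)).mul (u 2)))).congr_deriv ?_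
      simp
    · simp only [system]
      simp
      refine (((w 1 1 2).add (e5.mul (w 2 2 2))).sub
        (e6.mul ((((((v 2 0).pow 2).add ((u 0).mul (w 2 2 0))).add ((v 2 1).pow 2)).add
          ((u 1).mul (w 2 2 1))).const_mul 2))).congr_deriv ?_
      simp

/-- The base point of a second jet. -/
def J2.base (j : J2) : J0 := (j.1, j.2.1)

/-- The total derivative direction `(e_i, f_i)` at a second jet. -/
def J2.dir (j : J2) (i : Fin 3) : J0 := (Pi.single i 1, j.2.2.1 i)

/-- Total derivatives of the components are components of one Fréchet derivative along `(e_i, f_i)`;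
from here on only `fderiv ℝ V` and its derivative have to be controlled. -/
theorem prol1_eq {V : VF} {q : J1} (hV : DifferentiableAt ℝ V (q.1, q.2.1)) (i : Fin 3) :
    prol1 V i q = (fderiv ℝ V (q.1, q.2.1) (Pi.single i 1, q.2.2 i)).2
      - ∑ l, (fderiv ℝ V (q.1, q.2.1) (Pi.single i 1, q.2.2 i)).1 l • q.2.2 l := by
  have h2 : fderiv ℝ (fun z => (V z).2) (q.1, q.2.1)
      = (ContinuousLinearMap.snd ℝ R3 R3).comp (fderiv ℝ V (q.1, q.2.1)) :=
    hV.hasFDerivAt.snd.fderiv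
  have h1 : ∀ l, fderiv ℝ (fun z => (V z).1 l) (q.1, q.2.1)
      = ((ContinuousLinearMap.proj l).comp (ContinuousLinearMap.fst ℝ R3 R3)).comp
        (fderiv ℝ V (q.1, q.2.1)) := fun l =>
    (((ContinuousLinearMap.proj (R := ℝ) (φ := fun _ : Fin 3 => ℝ) l).comp
      (ContinuousLinearMap.fst ℝ R3 R3)).hasFDerivAt.comp _ hV.hasFDerivAt).fderiv
  simp [prol1, totalD0, h1, h2]

/-- The chain and product rules applied to `prol1_eq`: the base point moves along `dir k`, which
produces the second derivative, and the direction `dir i` moves along the fibre by `H k i`. -/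
theorem prol2_eq {I : Set ℝ} (hI : IsOpen I) {V : VF} (hV : ContDiffOn ℝ ∞ V (dom I)) {j : J2}
    (hj : j.1 0 ∈ I) (i k : Fin 3) :
    prol2 V i k j = (fderiv ℝ (fderiv ℝ V) j.base (j.dir k) (j.dir i)).2
      + (fderiv ℝ V j.base (0, j.2.2.2 k i)).2
      - ∑ l, ((fderiv ℝ (fderiv ℝ V) j.base (j.dir k) (j.dir i)).1 l
        + (fderiv ℝ V j.base (0, j.2.2.2 k i)).1 l) • j.2.2.1 l
      - ∑ l, (fderiv ℝ V j.base (j.dir i)).1 l • j.2.2.2 k l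
      - ∑ l, (fderiv ℝ V j.base (j.dir k)).1 l • j.2.2.2 i l := by
  have hp : j.base ∈ dom I := hj
  have hd : ∀ q ∈ dom I, DifferentiableAt ℝ V q := fun q hq =>
    (hV.differentiableOn (by simp)).differentiableAt (dom_mem_nhds hI hq)
  have hL : DifferentiableAt ℝ (fderiv ℝ V) j.base :=
    ((hV.fderiv_of_isOpen (isOpen_dom hI) (m := ∞) (by simp)).differentiableOn
      (by simp)).differentiableAt (dom_mem_nhds hI hp)
  -- The formula for `prol1` is about to be differentiated, so it is needed on a neighbourhood and
  -- not only at the jet.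
  have hloc : prol1 V i =ᶠ[nhds (toJ1 j)] fun q =>
      (fderiv ℝ V (q.1, q.2.1) (Pi.single i 1, q.2.2 i)).2
      - ∑ l, (fderiv ℝ V (q.1, q.2.1) (Pi.single i 1, q.2.2 i)).1 l • q.2.2 l := by
    have hc : Continuous fun q : J1 => ((q.1, q.2.1) : J0) := by fun_prop
    filter_upwards [hc.continuousAt.preimage_mem_nhds (dom_mem_nhds hI hp)] with q hq
    exact prol1_eq (hd _ hq) i
  set B := fderiv ℝ (fderiv ℝ V) j.base with hB
  have hbase : HasFDerivAt (fun q : J1 => ((q.1, q.2.1) : J0))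
      ((ContinuousLinearMap.fst ℝ R3 (R3 × (Fin 3 → R3))).prod
        ((ContinuousLinearMap.fst ℝ R3 (Fin 3 → R3)).comp
          (ContinuousLinearMap.snd ℝ R3 (R3 × (Fin 3 → R3))))) (toJ1 j) :=
    hasFDerivAt_fst.prodMk hasFDerivAt_snd.fst
  have hco : ∀ l : Fin 3, HasFDerivAt (fun q : J1 => q.2.2 l)
      ((ContinuousLinearMap.proj (R := ℝ) (φ := fun _ : Fin 3 => R3) l).comp
        ((ContinuousLinearMap.snd ℝ R3 (Fin 3 → R3)).comp
          (ContinuousLinearMap.snd ℝ R3 (R3 × (Fin 3 → R3))))) (toJ1 j) :=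
    fun l => ((ContinuousLinearMap.proj (R := ℝ) (φ := fun _ : Fin 3 => R3) l).comp
        ((ContinuousLinearMap.snd ℝ R3 (Fin 3 → R3)).comp
          (ContinuousLinearMap.snd ℝ R3 (R3 × (Fin 3 → R3))))).hasFDerivAt
  have hdir : HasFDerivAt (fun q : J1 => ((Pi.single i 1, q.2.2 i) : J0)) _ (toJ1 j) :=
    (hasFDerivAt_const (Pi.single i (1 : ℝ) : R3) (toJ1 j)).prodMk (hco i)
  have hBq : HasFDerivAt (fun q : J1 => fderiv ℝ V (q.1, q.2.1)) _ (toJ1 j) :=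
    hL.hasFDerivAt.comp (toJ1 j) hbase
  have hW := hBq.clm_apply hdir
  have hW1 : ∀ l : Fin 3, HasFDerivAt (fun q : J1 =>
      (fderiv ℝ V (q.1, q.2.1) (Pi.single i 1, q.2.2 i)).1 l) _ (toJ1 j) := fun l =>
    ((ContinuousLinearMap.proj (R := ℝ) (φ := fun _ : Fin 3 => ℝ) l).comp
      (ContinuousLinearMap.fst ℝ R3 R3)).hasFDerivAt.comp _ hW
  have hT := hW.snd.sub (HasFDerivAt.fun_sum (u := Finset.univ)
    fun l _ => (hW1 l).smul (hco l))
  have hfd := (hloc.fderiv_eq.trans hT.fderiv)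
  have h1 : ∀ l, fderiv ℝ (fun z => (V z).1 l) j.base
      = ((ContinuousLinearMap.proj l).comp (ContinuousLinearMap.fst ℝ R3 R3)).comp
        (fderiv ℝ V j.base) := fun l =>
    (((ContinuousLinearMap.proj (R := ℝ) (φ := fun _ : Fin 3 => ℝ) l).comp
      (ContinuousLinearMap.fst ℝ R3 R3)).hasFDerivAt.comp _ (hd _ hp).hasFDerivAt).fderiv
  have hs : (fderiv ℝ V j.base (0, j.2.2.2 k i)) = fderiv ℝ V j.base (0, j.2.2.2 k i) := rfl
  unfold prol2 totalD1 totalD0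
  rw [hfd]
  change _ - ∑ l, (fderiv ℝ (fun z => (V z).1 l) j.base) (j.dir k) • _ = _
  simp only [h1]
  simp [J2.dir, J2.base, toJ1, Fin.sum_univ_three, hB]
  module

/-- First order prolongation coefficient in coordinates. -/
noncomputable def prolA (V : VF) (j : J2) (i a : Fin 3) : ℝ :=
  (fderiv ℝ V j.base (j.dir i)).2 a - ∑ l, (fderiv ℝ V j.base (j.dir i)).1 l * j.2.2.1 l a

/-- Diagonal second order prolongation coefficient in coordinates. -/
noncomputable def prolB (V : VF) (j : J2) (i a : Fin 3) : ℝ :=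
  (fderiv ℝ (fderiv ℝ V) j.base (j.dir i) (j.dir i)).2 a
    + (fderiv ℝ V j.base (0, j.2.2.2 i i)).2 a
    - ∑ l, ((fderiv ℝ (fderiv ℝ V) j.base (j.dir i) (j.dir i)).1 l
        + (fderiv ℝ V j.base (0, j.2.2.2 i i)).1 l) * j.2.2.1 l a
    - 2 * ∑ l, (fderiv ℝ V j.base (j.dir i)).1 l * j.2.2.2 i l a

theorem prol1_apply {I : Set ℝ} (hI : IsOpen I) {V : VF} (hV : ContDiffOn ℝ ∞ V (dom I)) {j : J2}
    (hj : j.1 0 ∈ I) (i a : Fin 3) : prol1 V i (toJ1 j) a = prolA V j i a := by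
  rw [prol1_eq (((hV.differentiableOn (by simp)).differentiableAt
    (dom_mem_nhds hI (show j.base ∈ dom I from hj))))]
  simp [prolA, toJ1, J2.base, J2.dir]

theorem prol2_apply {I : Set ℝ} (hI : IsOpen I) {V : VF} (hV : ContDiffOn ℝ ∞ V (dom I)) {j : J2}
    (hj : j.1 0 ∈ I) (i a : Fin 3) : prol2 V i i j a = prolB V j i a := by
  rw [prol2_eq hI hV hj]
  simp [prolB, Fin.sum_univ_three]
  ring

/-- The prolonged action on the system, in coordinates. -/
theorem fderiv_system_prolong {I : Set ℝ} (hI : IsOpen I) {c : Coeffs} (hc : c.Admissible I)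
    {V : VF} (hV : ContDiffOn ℝ ∞ V (dom I)) {j : J2} (hj : j.1 0 ∈ I) :
    fderiv ℝ (system c) j (prolong V j) =
    ![prolA V j 0 0
        + (deriv c.p1 (j.1 0) * (V j.base).1 0 * j.2.2.2 1 1 1 + c.p1 (j.1 0) * prolB V j 1 1)
        + (deriv c.p2 (j.1 0) * (V j.base).1 0 * j.2.2.2 2 2 1 + c.p2 (j.1 0) * prolB V j 2 1)
        - ((deriv c.q1 (j.1 0) * (V j.base).1 0 * j.2.1 1 + c.q1 (j.1 0) * (V j.base).2 1)
              * (j.2.1 0 ^ 2 + j.2.1 1 ^ 2)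
            + c.q1 (j.1 0) * j.2.1 1 *
              (2 * j.2.1 0 * (V j.base).2 0 + 2 * j.2.1 1 * (V j.base).2 1)
          + ((deriv c.q2 (j.1 0) * (V j.base).1 0 * j.2.1 1 + c.q2 (j.1 0) * (V j.base).2 1)
              * j.2.1 2 + c.q2 (j.1 0) * j.2.1 1 * (V j.base).2 2)),
      -prolA V j 0 1
        + (deriv c.p1 (j.1 0) * (V j.base).1 0 * j.2.2.2 1 1 0 + c.p1 (j.1 0) * prolB V j 1 0)
        + (deriv c.p2 (j.1 0) * (V j.base).1 0 * j.2.2.2 2 2 0 + c.p2 (j.1 0) * prolB V j 2 0)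
        - ((deriv c.q1 (j.1 0) * (V j.base).1 0 * j.2.1 0 + c.q1 (j.1 0) * (V j.base).2 0)
              * (j.2.1 0 ^ 2 + j.2.1 1 ^ 2)
            + c.q1 (j.1 0) * j.2.1 0 *
              (2 * j.2.1 0 * (V j.base).2 0 + 2 * j.2.1 1 * (V j.base).2 1)
          + ((deriv c.q2 (j.1 0) * (V j.base).1 0 * j.2.1 0 + c.q2 (j.1 0) * (V j.base).2 0)
              * j.2.1 2 + c.q2 (j.1 0) * j.2.1 0 * (V j.base).2 2)),
      prolB V j 1 2
        + (deriv c.r1 (j.1 0) * (V j.base).1 0 * j.2.2.2 2 2 2 + c.r1 (j.1 0) * prolB V j 2 2)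
        - (deriv c.r2 (j.1 0) * (V j.base).1 0 * (2 * (j.2.2.1 2 0 ^ 2 + j.2.1 0 * j.2.2.2 2 2 0
              + j.2.2.1 2 1 ^ 2 + j.2.1 1 * j.2.2.2 2 2 1))
          + c.r2 (j.1 0) * (2 * (2 * j.2.2.1 2 0 * prolA V j 2 0
              + ((V j.base).2 0 * j.2.2.2 2 2 0 + j.2.1 0 * prolB V j 2 0)
              + 2 * j.2.2.1 2 1 * prolA V j 2 1
              + ((V j.base).2 1 * j.2.2.2 2 2 1 + j.2.1 1 * prolB V j 2 1))))] := by
  rw [fderiv_system hI hc _ _ hj]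
  simp only [prolong, prol1_apply hI hV hj, prol2_apply hI hV hj]
  rfl

/-- The second jet with the given coordinates. -/
def mkJet (p : J0) (ft fx fy Htx Hty Hxx Hxy Hyy : R3) : J2 :=
  (p.1, p.2, ![ft, fx, fy], ![![0, Htx, Hty], ![Htx, Hxx, Hxy], ![Hty, Hxy, Hyy]])

theorem isJet_mkJet (p : J0) (ft fx fy Htx Hty Hxx Hxy Hyy : R3) :
    IsJet (mkJet p ft fx fy Htx Hty Hxx Hxy Hyy) := by
  intro i k
  fin_cases i <;> fin_cases k <;> rfl

/-- The symmetry conditions in a general jet, in terms of the first derivative `L` and the second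
derivative `B` of the vector field. -/
theorem IsSymmetry.conditions {I : Set ℝ} (hI : IsOpen I) {c : Coeffs} (hc : c.Admissible I)
    {V : VF} (hV : IsSymmetry I c V) {p : J0} (hp : p ∈ dom I)
    (ft fx fy Htx Hty Hxx Hxy Hyy : R3)
    (h0 : ft 0 + c.p1 (p.1 0) * Hxx 1 + c.p2 (p.1 0) * Hyy 1
      - (c.q1 (p.1 0) * p.2 1 * (p.2 0 ^ 2 + p.2 1 ^ 2) + c.q2 (p.1 0) * p.2 1 * p.2 2) = 0)
    (h1 : -(ft 1) + c.p1 (p.1 0) * Hxx 0 + c.p2 (p.1 0) * Hyy 0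
      - (c.q1 (p.1 0) * p.2 0 * (p.2 0 ^ 2 + p.2 1 ^ 2) + c.q2 (p.1 0) * p.2 0 * p.2 2) = 0)
    (h2 : Hxx 2 + c.r1 (p.1 0) * Hyy 2
      - c.r2 (p.1 0) * (2 * (fy 0 ^ 2 + p.2 0 * Hyy 0 + fy 1 ^ 2 + p.2 1 * Hyy 1)) = 0)
    (L : J0 →L[ℝ] J0) (hL : L = fderiv ℝ V p)
    (B : J0 →L[ℝ] J0 →L[ℝ] J0) (hB : B = fderiv ℝ (fderiv ℝ V) p)
    (T X Y : J0) (hT : T = L (Pi.single 0 1, ft)) (hX : X = L (Pi.single 1 1, fx))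
    (hY : Y = L (Pi.single 2 1, fy))
    (X2 Y2 : J0)
    (hX2 : X2 = B (Pi.single 1 1, fx) (Pi.single 1 1, fx) + L (0, Hxx))
    (hY2 : Y2 = B (Pi.single 2 1, fy) (Pi.single 2 1, fy) + L (0, Hyy))
    (A0 A1 : ℝ) (hA0 : A0 = T.2 0 - (T.1 0 * ft 0 + T.1 1 * fx 0 + T.1 2 * fy 0))
    (hA1 : A1 = T.2 1 - (T.1 0 * ft 1 + T.1 1 * fx 1 + T.1 2 * fy 1))
    (Bx By : Fin 3 → ℝ)
    (hBx : ∀ a, Bx a = X2.2 a - (X2.1 0 * ft a + X2.1 1 * fx a + X2.1 2 * fy a)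
      - 2 * (X.1 0 * Htx a + X.1 1 * Hxx a + X.1 2 * Hxy a))
    (hBy : ∀ a, By a = Y2.2 a - (Y2.1 0 * ft a + Y2.1 1 * fx a + Y2.1 2 * fy a)
      - 2 * (Y.1 0 * Hty a + Y.1 1 * Hxy a + Y.1 2 * Hyy a)) :
    (A0 + (deriv c.p1 (p.1 0) * (V p).1 0 * Hxx 1 + c.p1 (p.1 0) * Bx 1)
        + (deriv c.p2 (p.1 0) * (V p).1 0 * Hyy 1 + c.p2 (p.1 0) * By 1)
        - ((deriv c.q1 (p.1 0) * (V p).1 0 * p.2 1 + c.q1 (p.1 0) * (V p).2 1)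
              * (p.2 0 ^ 2 + p.2 1 ^ 2)
            + c.q1 (p.1 0) * p.2 1 * (2 * p.2 0 * (V p).2 0 + 2 * p.2 1 * (V p).2 1)
          + ((deriv c.q2 (p.1 0) * (V p).1 0 * p.2 1 + c.q2 (p.1 0) * (V p).2 1) * p.2 2
            + c.q2 (p.1 0) * p.2 1 * (V p).2 2)) = 0) ∧
    (-A1 + (deriv c.p1 (p.1 0) * (V p).1 0 * Hxx 0 + c.p1 (p.1 0) * Bx 0)
        + (deriv c.p2 (p.1 0) * (V p).1 0 * Hyy 0 + c.p2 (p.1 0) * By 0)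
        - ((deriv c.q1 (p.1 0) * (V p).1 0 * p.2 0 + c.q1 (p.1 0) * (V p).2 0)
              * (p.2 0 ^ 2 + p.2 1 ^ 2)
            + c.q1 (p.1 0) * p.2 0 * (2 * p.2 0 * (V p).2 0 + 2 * p.2 1 * (V p).2 1)
          + ((deriv c.q2 (p.1 0) * (V p).1 0 * p.2 0 + c.q2 (p.1 0) * (V p).2 0) * p.2 2
            + c.q2 (p.1 0) * p.2 0 * (V p).2 2)) = 0) ∧
    (Bx 2 + (deriv c.r1 (p.1 0) * (V p).1 0 * Hyy 2 + c.r1 (p.1 0) * By 2)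
        - (deriv c.r2 (p.1 0) * (V p).1 0 * (2 * (fy 0 ^ 2 + p.2 0 * Hyy 0
              + fy 1 ^ 2 + p.2 1 * Hyy 1))
          + c.r2 (p.1 0) * (2 * (2 * fy 0 * (Y.2 0 - (Y.1 0 * ft 0 + Y.1 1 * fx 0 + Y.1 2 * fy 0))
              + ((V p).2 0 * Hyy 0 + p.2 0 * By 0)
              + 2 * fy 1 * (Y.2 1 - (Y.1 0 * ft 1 + Y.1 1 * fx 1 + Y.1 2 * fy 1))
              + ((V p).2 1 * Hyy 1 + p.2 1 * By 1)))) = 0) := by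
  have hj : (mkJet p ft fx fy Htx Hty Hxx Hxy Hyy).1 0 ∈ I := hp
  have hs : system c (mkJet p ft fx fy Htx Hty Hxx Hxy Hyy) = 0 := by
    funext i
    fin_cases i
    · exact h0
    · exact h1
    · exact h2
  have h := hV.2 _ (isJet_mkJet p ft fx fy Htx Hty Hxx Hxy Hyy) hj hs
  rw [fderiv_system_prolong hI hc hV.1 hj] at h
  have e0 := congrFun h 0
  have e1 := congrFun h 1
  have e2 := congrFun h 2
  subst hL hB hT hX hY hX2 hY2 hA0 hA1
  simp only [hBx, hBy]
  simp only [prolA, prolB, mkJet, J2.base, J2.dir, Fin.sum_univ_three, Matrix.cons_val_zero,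
    Matrix.cons_val_one, Matrix.cons_val, Pi.zero_apply] at e0 e1 e2
  refine ⟨?_, ?_, ?_⟩
  · rw [← e0]
    simp only [Prod.fst_add, Prod.snd_add, Pi.add_apply]
  · rw [← e1]
    simp only [Prod.fst_add, Prod.snd_add, Pi.add_apply]
  · rw [← e2]
    simp only [Prod.fst_add, Prod.snd_add, Pi.add_apply]

/-- Coordinate expansion of a linear map on the space of variables. -/
theorem clm_expand (L : J0 →L[ℝ] J0) (e f : R3) :
    L (e, f) = L (e, 0) + f 0 • L (0, Pi.single 0 1) + f 1 • L (0, Pi.single 1 1)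
      + f 2 • L (0, Pi.single 2 1) := by
  rw [← map_smul, ← map_smul, ← map_smul, ← map_add, ← map_add, ← map_add]
  congr 1
  ext i
  · simp
  · fin_cases i <;> simp

/-! ### Determining equations from the second derivatives in the jet. -/

section
variable {I : Set ℝ} {c : Coeffs} {V : VF} {p : J0}

/-- The mixed derivatives `v_tx` and `v_ty` do not occur in the system, so they are free; in the
prolonged first equation they have the coefficients `-2 p₁ D_x τ` and `-2 p₂ D_y τ`. -/
theorem IsSymmetry.time_indep (hI : IsOpen I) (hc : c.Admissible I)
    (hV : IsSymmetry I c V) (hp : p ∈ dom I) (f : R3) :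
    (fderiv ℝ V p (Pi.single 1 1, f)).1 0 = 0 ∧ (fderiv ℝ V p (Pi.single 2 1, f)).1 0 = 0 := by
  have hp1 : c.p1 (p.1 0) ≠ 0 := hc.p1.2 _ hp
  have hp2 : c.p2 (p.1 0) ≠ 0 := hc.p2.2 _ hp
  -- With the factor `N` of the right-hand side `N ψ`, the choice `u_t = N v`, `v_t = -N u` solves
  -- the first two equations whenever the pure second space derivatives of `u`, `v` vanish. A
  -- suitable `w_xx` then solves the third.
  set N := c.q1 (p.1 0) * (p.2 0 ^ 2 + p.2 1 ^ 2) + c.q2 (p.1 0) * p.2 2 with hN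
  constructor
  · have key := fun s : ℝ => (hV.conditions hI hc hp ![N * p.2 1, -(N * p.2 0), 0] f 0 ![0, s, 0]
      0 0 0 0 (by simp [hN]; ring) (by simp [hN]; ring) (by simp) _ rfl _ rfl _ _ _ rfl rfl rfl
      _ _ rfl rfl _ _ rfl rfl _ _ (fun _ => rfl) (fun _ => rfl)).1
    have k0 := key 0
    have k1 := key 1
    simp only [Matrix.cons_val_zero, Matrix.cons_val_one, Pi.zero_apply] at k0 k1
    have : c.p1 (p.1 0) * (fderiv ℝ V p (Pi.single 1 1, f)).1 0 = 0 := by linarith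
    exact (mul_eq_zero.1 this).resolve_left hp1
  · have key := fun s : ℝ => (hV.conditions hI hc hp ![N * p.2 1, -(N * p.2 0), 0] 0 f 0
      ![0, s, 0] ![0, 0, c.r2 (p.1 0) * (2 * (f 0 ^ 2 + f 1 ^ 2))] 0 0
      (by simp [hN]; ring) (by simp [hN]; ring) (by simp) _ rfl _ rfl _ _ _ rfl rfl rfl
      _ _ rfl rfl _ _ rfl rfl _ _ (fun _ => rfl) (fun _ => rfl)).1
    have k0 := key 0
    have k1 := key 1
    simp only [Matrix.cons_val_zero, Matrix.cons_val_one, Pi.zero_apply] at k0 k1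
    have : c.p2 (p.1 0) * (fderiv ℝ V p (Pi.single 2 1, f)).1 0 = 0 := by linarith
    exact (mul_eq_zero.1 this).resolve_left hp2

/-- Same method with the free derivatives `v_xy` and `u_xy`: the first equation couples `D_x η` and
`D_y ξ`, while in the third `u_xy` enters only through the source term `u u_yy`, hence the factor
`u`. -/
theorem IsSymmetry.mixed (hI : IsOpen I) (hc : c.Admissible I)
    (hV : IsSymmetry I c V) (hp : p ∈ dom I) (f f' : R3) :
    c.p1 (p.1 0) * (fderiv ℝ V p (Pi.single 1 1, f)).1 2
      + c.p2 (p.1 0) * (fderiv ℝ V p (Pi.single 2 1, f')).1 1 = 0 ∧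
    p.2 0 * (fderiv ℝ V p (Pi.single 2 1, f')).1 1 = 0 := by
  have hr2 : c.r2 (p.1 0) ≠ 0 := hc.r2.2 _ hp
  set N := c.q1 (p.1 0) * (p.2 0 ^ 2 + p.2 1 ^ 2) + c.q2 (p.1 0) * p.2 2 with hN
  have key := fun s s' : ℝ => (hV.conditions hI hc hp ![N * p.2 1, -(N * p.2 0), 0] f f' 0 0
      ![0, 0, c.r2 (p.1 0) * (2 * (f' 0 ^ 2 + f' 1 ^ 2))] ![s', s, 0] 0
      (by simp [hN]; ring) (by simp [hN]; ring) (by simp) _ rfl _ rfl _ _ _ rfl rfl rfl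
      _ _ rfl rfl _ _ rfl rfl _ _ (fun _ => rfl) (fun _ => rfl))
  have k0 := key 0 0
  have k1 := (key 1 0).1
  have k2 := (key 0 1).2.2
  simp only [Matrix.cons_val_zero, Matrix.cons_val_one, Matrix.cons_val, Pi.zero_apply]
    at k0 k1 k2
  constructor
  · linarith [k0.1]
  · have : c.r2 (p.1 0) * (p.2 0 * (fderiv ℝ V p (Pi.single 2 1, f')).1 1) = 0 := by
      linarith [k0.2.2]
    exact (mul_eq_zero.1 this).resolve_left hr2

/-- A continuous function vanishing where `u ≠ 0` vanishes. -/
theorem eq_zero_of_forall_ne {F : J0 → ℝ} (hI : IsOpen I) (hF : ContinuousOn F (dom I))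
    (h : ∀ q ∈ dom I, q.2 0 ≠ 0 → F q = 0) (hp : p ∈ dom I) : F p = 0 := by
  by_cases h0 : p.2 0 = 0
  · have hc : ContinuousAt (fun s : ℝ => F (p.1, p.2 + s • Pi.single 0 1)) 0 := by
      have h1 : ContinuousAt F (p.1, p.2 + (0 : ℝ) • Pi.single 0 1) := by
        simpa using hF.continuousAt (dom_mem_nhds hI hp)
      exact ContinuousAt.comp (f := fun s : ℝ => ((p.1, p.2 + s • Pi.single 0 1) : J0)) h1
        (by fun_prop)
    have hz : (fun s : ℝ => F (p.1, p.2 + s • Pi.single 0 1)) =ᶠ[nhdsWithin 0 {0}ᶜ] fun _ => 0 := by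
      filter_upwards [self_mem_nhdsWithin] with s hs
      exact h _ hp (by simpa [h0] using hs)
    have := tendsto_nhds_unique ((hc.tendsto.mono_left nhdsWithin_le_nhds).congr' hz)
      tendsto_const_nhds
    simpa using this
  · exact h p hp h0

theorem continuousOn_fderiv_apply (hI : IsOpen I) (hV : ContDiffOn ℝ ∞ V (dom I)) (d : J0) :
    ContinuousOn (fun q => fderiv ℝ V q d) (dom I) :=
  (hV.continuousOn_fderiv_of_isOpen (isOpen_dom hI) (by simp)).clm_apply continuousOn_const

/-- The factor `u` in `mixed` is removed by continuity, since the points with `u ≠ 0` are dense. -/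
theorem IsSymmetry.space_indep (hI : IsOpen I) (hc : c.Admissible I)
    (hV : IsSymmetry I c V) (hp : p ∈ dom I) (f : R3) :
    (fderiv ℝ V p (Pi.single 2 1, f)).1 1 = 0 ∧ (fderiv ℝ V p (Pi.single 1 1, f)).1 2 = 0 := by
  have h1 : (fderiv ℝ V p (Pi.single 2 1, f)).1 1 = 0 := by
    refine eq_zero_of_forall_ne (F := fun q => (fderiv ℝ V q (Pi.single 2 1, f)).1 1) hI ?_ ?_ hp
    · have := continuousOn_fderiv_apply hI hV.1 (Pi.single 2 1, f)
      fun_prop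
    · intro q hq h0
      exact (mul_eq_zero.1 (hV.mixed hI hc hq 0 f).2).resolve_left h0
  refine ⟨h1, ?_⟩
  have := (hV.mixed hI hc hp f f).1
  rw [h1] at this
  simpa [hc.p1.2 _ hp] using this

/-- The preceding total derivatives vanish for every value of the first derivatives `f`, so the part
linear in `f` vanishes by itself. The `y`-direction serves for `ξ`, the `x`-direction for `τ` and
`η`. -/
theorem IsSymmetry.fibre_indep (hI : IsOpen I) (hc : c.Admissible I)
    (hV : IsSymmetry I c V) (hp : p ∈ dom I) (f : R3) : (fderiv ℝ V p (0, f)).1 = 0 := by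
  have e1 : fderiv ℝ V p (0, f) = fderiv ℝ V p (Pi.single 1 1, f)
      - fderiv ℝ V p (Pi.single 1 1, 0) := by rw [← map_sub]; simp
  have e2 : fderiv ℝ V p (0, f) = fderiv ℝ V p (Pi.single 2 1, f)
      - fderiv ℝ V p (Pi.single 2 1, 0) := by rw [← map_sub]; simp
  ext i
  fin_cases i
  · simp [e1, hV.time_indep hI hc hp]
  · simp [e2, hV.space_indep hI hc hp]
  · simp [e1, hV.space_indep hI hc hp]

theorem differentiableAt_fderiv (hI : IsOpen I) (hV : ContDiffOn ℝ ∞ V (dom I)) (hp : p ∈ dom I) :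
    DifferentiableAt ℝ (fderiv ℝ V) p :=
  ((hV.fderiv_of_isOpen (isOpen_dom hI) (m := ∞) (by simp)).differentiableOn
    (by simp)).differentiableAt (dom_mem_nhds hI hp)

/-- The second derivative as a derivative of first derivatives along a line. -/
theorem hasDerivAt_fderiv_line (hI : IsOpen I) (hV : ContDiffOn ℝ ∞ V (dom I)) (hp : p ∈ dom I)
    (d d' : J0) : HasDerivAt (fun s : ℝ => fderiv ℝ V (p + s • d) d')
      (fderiv ℝ (fderiv ℝ V) p d d') 0 := by
  have h1 : HasLineDerivAt ℝ (fderiv ℝ V) (fderiv ℝ (fderiv ℝ V) p d) p d :=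
    (differentiableAt_fderiv hI hV hp).hasFDerivAt.hasLineDerivAt d
  exact by simpa using HasDerivAt.clm_apply h1 (hasDerivAt_const (0 : ℝ) d')

/-- Linear relations between first derivatives can be differentiated. -/
theorem second_fderiv_eq_zero (hI : IsOpen I) (hV : ContDiffOn ℝ ∞ V (dom I)) (hp : p ∈ dom I)
    (d d' : J0) (l : J0 →L[ℝ] ℝ) (hl : ∀ q ∈ dom I, l (fderiv ℝ V q d') = 0) :
    l (fderiv ℝ (fderiv ℝ V) p d d') = 0 := by
  have h1 : HasFDerivAt (fun q => l (fderiv ℝ V q d')) _ p :=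
    l.hasFDerivAt.comp p ((differentiableAt_fderiv hI hV hp).hasFDerivAt.clm_apply
      (hasFDerivAt_const d' p))
  have h2 : (fun q => l (fderiv ℝ V q d')) =ᶠ[nhds p] fun _ => 0 := by
    filter_upwards [dom_mem_nhds hI hp] with q hq using hl q hq
  have h3 := congrArg (fun m => m d) (h1.unique ((hasFDerivAt_const (0 : ℝ) p).congr_of_eventuallyEq h2))
  simpa using h3

/-- The `i`-th component with respect to the independent variables. -/
def indepCoord (i : Fin 3) : J0 →L[ℝ] ℝ :=
  (ContinuousLinearMap.proj (R := ℝ) (φ := fun _ : Fin 3 => ℝ) i).comp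
    (ContinuousLinearMap.fst ℝ R3 R3)

/-- The `i`-th component with respect to the dependent variables. -/
def depCoord (i : Fin 3) : J0 →L[ℝ] ℝ :=
  (ContinuousLinearMap.proj (R := ℝ) (φ := fun _ : Fin 3 => ℝ) i).comp
    (ContinuousLinearMap.snd ℝ R3 R3)

theorem IsSymmetry.second_time (hI : IsOpen I) (hc : c.Admissible I)
    (hV : IsSymmetry I c V) (hp : p ∈ dom I) (d : J0) (f : R3) :
    (fderiv ℝ (fderiv ℝ V) p d (Pi.single 1 1, f)).1 0 = 0 ∧
    (fderiv ℝ (fderiv ℝ V) p d (Pi.single 1 1, f)).1 2 = 0 ∧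
    (fderiv ℝ (fderiv ℝ V) p d (Pi.single 2 1, f)).1 0 = 0 ∧
    (fderiv ℝ (fderiv ℝ V) p d (Pi.single 2 1, f)).1 1 = 0 :=
  ⟨second_fderiv_eq_zero hI hV.1 hp d _ (indepCoord 0) fun _ hq =>
      (hV.time_indep hI hc hq f).1,
    second_fderiv_eq_zero hI hV.1 hp d _ (indepCoord 2) fun _ hq =>
      (hV.space_indep hI hc hq f).2,
    second_fderiv_eq_zero hI hV.1 hp d _ (indepCoord 0) fun _ hq =>
      (hV.time_indep hI hc hq f).2,
    second_fderiv_eq_zero hI hV.1 hp d _ (indepCoord 1) fun _ hq =>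
      (hV.space_indep hI hc hq f).1⟩

/-- The determining equations which come from the second derivatives in the jet. -/
theorem IsSymmetry.second_order (hI : IsOpen I) (hc : c.Admissible I)
    (hV : IsSymmetry I c V) (hp : p ∈ dom I)
    (L : J0 →L[ℝ] J0) (hL : L = fderiv ℝ V p) :
    (L (0, Pi.single 2 1)).2 0 = 0 ∧ (L (0, Pi.single 2 1)).2 1 = 0 ∧
    (L (0, Pi.single 0 1)).2 2 = 0 ∧ (L (0, Pi.single 1 1)).2 2 = 0 ∧
    (L (0, Pi.single 1 1)).2 1 = (L (0, Pi.single 0 1)).2 0 ∧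
    (L (0, Pi.single 0 1)).2 1 = -(L (0, Pi.single 1 1)).2 0 ∧
    2 * (L (Pi.single 1 1, 0)).1 1 = (L (Pi.single 0 1, 0)).1 0
      + (V p).1 0 * (deriv c.p1 (p.1 0) / c.p1 (p.1 0)) ∧
    2 * (L (Pi.single 2 1, 0)).1 2 = (L (Pi.single 0 1, 0)).1 0
      + (V p).1 0 * (deriv c.p2 (p.1 0) / c.p2 (p.1 0)) ∧
    (p.2 0 = 0 → p.2 1 = 0 → (V p).2 0 = 0 ∧ (V p).2 1 = 0) := by
  have hp1 : c.p1 (p.1 0) ≠ 0 := hc.p1.2 _ hp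
  have hp2 : c.p2 (p.1 0) ≠ 0 := hc.p2.2 _ hp
  have hr2 : c.r2 (p.1 0) ≠ 0 := hc.r2.2 _ hp
  set N := c.q1 (p.1 0) * (p.2 0 ^ 2 + p.2 1 ^ 2) + c.q2 (p.1 0) * p.2 2 with hN
  have hF := fun f => hV.fibre_indep hI hc hp f
  rw [← hL] at hF
  have hF0 : ∀ f i, (L (0, f)).1 i = 0 := fun f i => by rw [hF]; rfl
  -- Free parameters: `w_t`, `u_xx = a`, `v_xx = b`, `u_yy = a'`, `v_yy = b'`. The system is solved
  -- for `u_t`, `v_t` and `w_xx`. Subtracting the condition with all parameters zero leaves the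
  -- coefficient of one parameter.
  have key := fun wt a b a' b' => (hV.conditions hI hc hp
      ![N * p.2 1 - c.p1 (p.1 0) * b - c.p2 (p.1 0) * b',
        -(N * p.2 0) + c.p1 (p.1 0) * a + c.p2 (p.1 0) * a', wt] 0 0 0 0
      ![a, b, 2 * c.r2 (p.1 0) * (p.2 0 * a' + p.2 1 * b')] 0 ![a', b', 0]
      (by simp [hN]; ring) (by simp [hN]; ring) (by simp; ring) _ hL _ rfl _ _ _ rfl rfl rfl
      _ _ rfl rfl _ _ rfl rfl _ _ (fun _ => rfl) (fun _ => rfl))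
  have hz : L (0, 0) = 0 := map_zero L
  obtain ⟨b1, b2, -, -⟩ := hV.second_time hI hc hp (Pi.single 1 1, 0) 0
  obtain ⟨-, -, b3, b4⟩ := hV.second_time hI hc hp (Pi.single 2 1, 0) 0
  have k0 := key 0 0 0 0 0
  have k1 := key 1 0 0 0 0
  have ka := key 0 1 0 0 0
  have kb := key 0 0 1 0 0
  have ka' := key 0 0 0 1 0
  have kb' := key 0 0 0 0 1
  clear key
  simp only [clm_expand L _ ![_, _, _], Prod.fst_add, Prod.snd_add, Pi.add_apply, Prod.smul_fst,
    Prod.smul_snd, Pi.smul_apply, smul_eq_mul, hF0, hz, b1, b2, b3, b4,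
    mul_zero, zero_mul, mul_one, one_mul, add_zero, zero_add, sub_zero,
    Matrix.cons_val_zero, Matrix.cons_val_one, Matrix.cons_val, Pi.zero_apply]
    at k0 k1 ka kb ka' kb'
  have w0 : (L (0, Pi.single 2 1)).2 0 = 0 := by linear_combination k1.1 - k0.1
  have w1 : (L (0, Pi.single 2 1)).2 1 = 0 := by linear_combination k0.2.1 - k1.2.1
  have u2 : (L (0, Pi.single 0 1)).2 2 = 0 := by linear_combination ka.2.2 - k0.2.2
  have v2 : (L (0, Pi.single 1 1)).2 2 = 0 := by linear_combination kb.2.2 - k0.2.2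
  simp only [w0, w1, u2, v2, mul_zero, add_zero] at ka kb ka' kb'
  have e1 : c.p1 (p.1 0) * ((L (0, Pi.single 1 1)).2 1 - (L (0, Pi.single 0 1)).2 0) = 0 := by
    linear_combination (1 / 2) * (kb.1 - k0.1 - ka.2.1 + k0.2.1)
  have e2 : c.p1 (p.1 0) * ((L (0, Pi.single 0 1)).2 1 + (L (0, Pi.single 1 1)).2 0) = 0 := by
    linear_combination kb.2.1 - k0.2.1
  have e1' := sub_eq_zero.1 ((mul_eq_zero.1 e1).resolve_left hp1)
  have e2' := eq_neg_of_add_eq_zero_left ((mul_eq_zero.1 e2).resolve_left hp1)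
  refine ⟨w0, w1, u2, v2, e1', e2', ?_, ?_, ?_⟩
  · field_simp
    linear_combination -(1 / 2) * (kb.1 - k0.1 + ka.2.1 - k0.2.1)
  · have := kb'.1
    rw [e1'] at this
    field_simp
    linear_combination k0.1 - this
  -- At `ψ = 0` the source term is varied only by `φ₁ u_yy + φ₂ v_yy`; as `u_yy` and `v_yy` are
  -- free, `φ₁` and `φ₂` vanish there.
  · intro hu hv
    have d0 := k0.2.2
    have d1 := ka'.2.2
    have d2 := kb'.2.2
    rw [hu, hv] at d0 d1 d2
    constructor
    · have : c.r2 (p.1 0) * (V p).2 0 = 0 := by linear_combination (1 / 2) * (d0 - d1)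
      exact (mul_eq_zero.1 this).resolve_left hr2
    · have : c.r2 (p.1 0) * (V p).2 1 = 0 := by linear_combination (1 / 2) * (d0 - d2)
      exact (mul_eq_zero.1 this).resolve_left hr2

end

/-! ### Smooth functions of time, and the base components of a symmetry. -/

theorem Smooth.add {I : Set ℝ} {f g : ℝ → ℝ} (hf : Smooth I f) (hg : Smooth I g) :
    Smooth I (fun t => f t + g t) := ContDiffOn.add hf hg

theorem Smooth.sub {I : Set ℝ} {f g : ℝ → ℝ} (hf : Smooth I f) (hg : Smooth I g) :
    Smooth I (fun t => f t - g t) := ContDiffOn.sub hf hg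

theorem Smooth.mul {I : Set ℝ} {f g : ℝ → ℝ} (hf : Smooth I f) (hg : Smooth I g) :
    Smooth I (fun t => f t * g t) := ContDiffOn.mul hf hg

theorem Smooth.neg {I : Set ℝ} {f : ℝ → ℝ} (hf : Smooth I f) :
    Smooth I (fun t => -f t) := ContDiffOn.neg hf

theorem Smooth.const {I : Set ℝ} (a : ℝ) : Smooth I (fun _ => a) := contDiffOn_const

theorem Smooth.div {I : Set ℝ} {f g : ℝ → ℝ} (hf : Smooth I f) (hg : SmoothNZ I g) :
    Smooth I (fun t => f t / g t) := ContDiffOn.div hf hg.1 hg.2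

theorem SmoothNZ.const_mul {I : Set ℝ} {f : ℝ → ℝ} (hf : SmoothNZ I f) {a : ℝ} (ha : a ≠ 0) :
    SmoothNZ I (fun t => a * f t) :=
  ⟨(Smooth.const a).mul hf.1, fun t ht => mul_ne_zero ha (hf.2 t ht)⟩

/-- The scaling rate `(τ' + τ f' / f) / 2` which the time component `τ` induces through the
coefficient `f`. -/
noncomputable def scaleRate (f τ : ℝ → ℝ) (t : ℝ) : ℝ :=
  (deriv τ t + τ t * (deriv f t / f t)) / 2

theorem Smooth.scaleRate {I : Set ℝ} (hI : IsOpen I) {f τ : ℝ → ℝ} (hf : SmoothNZ I f)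
    (hτ : Smooth I τ) : Smooth I (scaleRate f τ) :=
  ((hτ.deriv hI).add (hτ.mul ((hf.1.deriv hI).div hf))).div ⟨Smooth.const 2, fun _ _ => by simp⟩

/-- The point over `t` with all other variables zero. -/
def axis (t : ℝ) : J0 := (Pi.single 0 t, 0)

section
variable {I : Set ℝ} {c : Coeffs} {V : VF} {p : J0}

theorem axis_mem {t : ℝ} (ht : t ∈ I) : axis t ∈ dom I := by simpa [axis, dom] using ht

theorem contDiff_axis : ContDiff ℝ ∞ axis := by
  have : axis = fun t : ℝ => ContinuousLinearMap.inl ℝ R3 R3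
      (ContinuousLinearMap.single ℝ (fun _ : Fin 3 => ℝ) 0 t) := by
    funext t; simp [axis]
  rw [this]
  exact (ContinuousLinearMap.contDiff _).comp (ContinuousLinearMap.contDiff _)

theorem smooth_axis {F : J0 → J0} (hF : ContDiffOn ℝ ∞ F (dom I)) (l : J0 →L[ℝ] ℝ) :
    Smooth I (fun t => l (F (axis t))) :=
  l.contDiff.comp_contDiffOn (hF.comp contDiff_axis.contDiffOn fun _ ht => axis_mem ht)

/-- A function without derivative in a direction tangent to the time slices is invariant under
translation in this direction. -/
theorem line_const {F : J0 → ℝ} {d : J0} (hd : d.1 0 = 0)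
    (h : ∀ q ∈ dom I, HasDerivAt (fun s : ℝ => F (q + s • d)) 0 0) (hp : p ∈ dom I) :
    F (p + d) = F p := by
  have key : ∀ s : ℝ, HasDerivAt (fun s : ℝ => F (p + s • d)) 0 s := by
    intro s
    have hq : p + s • d ∈ dom I := by
      have : (p + s • d).1 0 = p.1 0 := by simp [hd]
      simpa [dom, this] using hp
    have h2 : HasDerivAt (fun r : ℝ => r - s) 1 s := (hasDerivAt_id s).sub_const s
    have h3 := HasDerivAt.comp (h := fun r : ℝ => r - s) s (by simpa using h _ hq) h2
    refine (h3.congr_deriv (by simp)).congr_of_eventuallyEq (Filter.Eventually.of_forall ?_)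
    intro r
    simp [add_assoc, ← add_smul]
  have hc := is_const_of_deriv_eq_zero (fun s => (key s).differentiableAt)
    (fun s => (key s).deriv) 1 0
  simpa using hc

/-- A function without derivatives tangent to the time slices depends on time only. -/
theorem eq_axis {F : J0 → ℝ}
    (h : ∀ q ∈ dom I, ∀ d : J0, d.1 0 = 0 → HasDerivAt (fun s : ℝ => F (q + s • d)) 0 0)
    (hp : p ∈ dom I) : F p = F (axis (p.1 0)) := by
  have hd : (p - axis (p.1 0)).1 0 = 0 := by simp [axis]
  simpa using line_const hd (fun q hq => h q hq _ hd) (axis_mem hp)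

theorem line_mem (hI : IsOpen I) (hp : p ∈ dom I) (d : J0) :
    ∀ᶠ s : ℝ in nhds 0, p + s • d ∈ dom I := by
  have : ContinuousAt (fun s : ℝ => p + s • d) 0 := by fun_prop
  exact this.preimage_mem_nhds (by simpa using dom_mem_nhds hI hp)

theorem hasDerivAt_comp_line (hI : IsOpen I) (hV : ContDiffOn ℝ ∞ V (dom I)) (hp : p ∈ dom I)
    (d : J0) (l : J0 →L[ℝ] ℝ) :
    HasDerivAt (fun s : ℝ => l (V (p + s • d))) (l (fderiv ℝ V p d)) 0 := by
  have h1 : HasLineDerivAt ℝ V (fderiv ℝ V p d) p d :=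
    ((hV.differentiableOn (by simp)).differentiableAt
      (dom_mem_nhds hI hp)).hasFDerivAt.hasLineDerivAt d
  exact l.hasFDerivAt.comp_hasDerivAt (0 : ℝ) h1

theorem hasDerivAt_comp_fderiv_line (hI : IsOpen I) (hV : ContDiffOn ℝ ∞ V (dom I))
    (hp : p ∈ dom I) (d d' : J0) (l : J0 →L[ℝ] ℝ) :
    HasDerivAt (fun s : ℝ => l (fderiv ℝ V (p + s • d) d'))
      (l (fderiv ℝ (fderiv ℝ V) p d d')) 0 :=
  l.hasFDerivAt.comp_hasDerivAt (0 : ℝ) (hasDerivAt_fderiv_line hI hV hp d d')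

/-- First derivatives of a component known in closed form. -/
theorem comp_fderiv_eq (hI : IsOpen I) (hV : ContDiffOn ℝ ∞ V (dom I)) (hp : p ∈ dom I)
    {d : J0} {l : J0 →L[ℝ] ℝ} {E : J0 → ℝ} {v : ℝ} (hE : ∀ q ∈ dom I, l (V q) = E q)
    (h : HasDerivAt (fun s : ℝ => E (p + s • d)) v 0) : l (fderiv ℝ V p d) = v := by
  refine (hasDerivAt_comp_line hI hV hp d l).unique (h.congr_of_eventuallyEq ?_)
  filter_upwards [line_mem hI hp d] with s hs using hE _ hs

/-- Second derivatives from first derivatives known in closed form. -/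
theorem comp_second_fderiv_eq (hI : IsOpen I) (hV : ContDiffOn ℝ ∞ V (dom I)) (hp : p ∈ dom I)
    {d d' : J0} {l : J0 →L[ℝ] ℝ} {E : J0 → ℝ} {v : ℝ}
    (hE : ∀ q ∈ dom I, l (fderiv ℝ V q d') = E q)
    (h : HasDerivAt (fun s : ℝ => E (p + s • d)) v 0) :
    l (fderiv ℝ (fderiv ℝ V) p d d') = v := by
  refine (hasDerivAt_comp_fderiv_line hI hV hp d d' l).unique (h.congr_of_eventuallyEq ?_)
  filter_upwards [line_mem hI hp d] with s hs using hE _ hs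

theorem second_fderiv_symm (hI : IsOpen I) (hV : ContDiffOn ℝ ∞ V (dom I)) (hp : p ∈ dom I)
    (d d' : J0) : fderiv ℝ (fderiv ℝ V) p d d' = fderiv ℝ (fderiv ℝ V) p d' d :=
  ((hV.contDiffAt (dom_mem_nhds hI hp)).isSymmSndFDerivAt
    (by simpa using WithTop.coe_le_coe.2 (le_top : (2 : ℕ∞) ≤ ⊤))) d d'

theorem clm_fibre (L : J0 →L[ℝ] J0) {d : J0} (hd : d.1 0 = 0) :
    L d = d.1 1 • L (Pi.single 1 1, 0) + d.1 2 • L (Pi.single 2 1, 0) + L (0, d.2) := by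
  rw [← map_smul, ← map_smul, ← map_add, ← map_add]
  congr 1
  ext i
  · fin_cases i <;> simp [hd]
  · simp

/-- The components with respect to the independent variables. -/
theorem IsSymmetry.base_form (hI : IsOpen I) (hc : c.Admissible I) (hV : IsSymmetry I c V) :
    ∃ τ g h : ℝ → ℝ, Smooth I τ ∧ Smooth I g ∧ Smooth I h ∧ ∀ q ∈ dom I,
      (V q).1 0 = τ (q.1 0) ∧
      (V q).1 1 = scaleRate c.p1 τ (q.1 0) * q.1 1 + g (q.1 0) ∧
      (V q).1 2 = scaleRate c.p2 τ (q.1 0) * q.1 2 + h (q.1 0) := by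
  set τ : ℝ → ℝ := fun t => indepCoord 0 (V (axis t)) with hτ
  have sτ : Smooth I τ := smooth_axis hV.1 _
  have hf : ∀ q ∈ dom I, ∀ (f : R3) (i : Fin 3), (fderiv ℝ V q (0, f)).1 i = 0 := by
    intro q hq f i
    rw [hV.fibre_indep hI hc hq f]
    rfl
  have e0 : ∀ q ∈ dom I, (V q).1 0 = τ (q.1 0) := by
    intro q hq
    refine eq_axis (F := fun q => indepCoord 0 (V q)) (fun q hq d hd => ?_) hq
    refine (hasDerivAt_comp_line hI hV.1 hq d (indepCoord 0)).congr_deriv ?_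
    rw [clm_fibre _ hd]
    simp [indepCoord, hf q hq, hV.time_indep hI hc hq]
  have et : ∀ q ∈ dom I, (fderiv ℝ V q (Pi.single 0 1, 0)).1 0 = deriv τ (q.1 0) := by
    intro q hq
    refine comp_fderiv_eq hI hV.1 hq (l := indepCoord 0) e0 ?_
    simpa using sτ.hasDerivAt_line hI hq 1
  refine ⟨τ, fun t => indepCoord 1 (V (axis t)), fun t => indepCoord 2 (V (axis t)), sτ,
    smooth_axis hV.1 _, smooth_axis hV.1 _, fun q hq => ⟨e0 q hq, ?_, ?_⟩⟩
  -- By `second_order`, `∂_x ξ` is the scale rate of `p₁`. After subtraction of this linear term no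
  -- derivative within a time slice is left, so the remainder is its value on the axis.
  · have := eq_axis (I := I) (F := fun q => indepCoord 1 (V q) - scaleRate c.p1 τ (q.1 0) * q.1 1)
      (fun q hq d hd => ?_) hq
    · simp only [axis, indepCoord] at this ⊢
      simp at this ⊢
      linarith
    · have h1 := (hasDerivAt_comp_line hI hV.1 hq d (indepCoord 1)).sub
        ((hasDerivAt_coord (q.1 1) (d.1 1) 0).const_mul (scaleRate c.p1 τ (q.1 0)))
      have h2 := (hV.second_order hI hc hq _ rfl).2.2.2.2.2.2.1
      rw [et q hq, e0 q hq] at h2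
      refine (h1.congr_deriv ?_).congr_of_eventuallyEq (Filter.Eventually.of_forall fun s => ?_)
      · rw [clm_fibre _ hd]
        simp [indepCoord, hf q hq, hV.space_indep hI hc hq, scaleRate]
        linear_combination (d.1 1 / 2) * h2
      · simp [hd]
  · have := eq_axis (I := I) (F := fun q => indepCoord 2 (V q) - scaleRate c.p2 τ (q.1 0) * q.1 2)
      (fun q hq d hd => ?_) hq
    · simp only [axis, indepCoord] at this ⊢
      simp at this ⊢
      linarith
    · have h1 := (hasDerivAt_comp_line hI hV.1 hq d (indepCoord 2)).sub
        ((hasDerivAt_coord (q.1 2) (d.1 2) 0).const_mul (scaleRate c.p2 τ (q.1 0)))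
      have h2 := (hV.second_order hI hc hq _ rfl).2.2.2.2.2.2.2.1
      rw [et q hq, e0 q hq] at h2
      refine (h1.congr_deriv ?_).congr_of_eventuallyEq (Filter.Eventually.of_forall fun s => ?_)
      · rw [clm_fibre _ hd]
        simp [indepCoord, hf q hq, hV.space_indep hI hc hq, scaleRate]
        linear_combination (d.1 2 / 2) * h2
      · simp [hd]

end

/-! ### Determining equations of first and zeroth order. -/

section
variable {I : Set ℝ} {c : Coeffs} {V : VF} {p : J0}

/-- Sorts by powers of the factor `s` put on the first derivatives of the jet; the two cross terms
merge because second derivatives are symmetric. -/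
theorem second_fderiv_expand (hI : IsOpen I) (hV : ContDiffOn ℝ ∞ V (dom I)) (hp : p ∈ dom I)
    (e f : R3) (s : ℝ) :
    fderiv ℝ (fderiv ℝ V) p (e, s • f) (e, s • f) = fderiv ℝ (fderiv ℝ V) p (e, 0) (e, 0)
      + (2 * s) • fderiv ℝ (fderiv ℝ V) p (e, 0) (0, f)
      + (s * s) • fderiv ℝ (fderiv ℝ V) p (0, f) (0, f) := by
  have h : ((e, s • f) : J0) = (e, 0) + s • (0, f) := by simp
  rw [h]
  simp only [map_add, map_smul, add_apply, smul_apply]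
  rw [second_fderiv_symm hI hV hp (0, f) (e, 0)]
  module

/-- The determining equations which come from the first derivatives in the jet. -/
theorem IsSymmetry.first_order (hI : IsOpen I) (hc : c.Admissible I) (hV : IsSymmetry I c V)
    (hp : p ∈ dom I) (L : J0 →L[ℝ] J0) (hL : L = fderiv ℝ V p)
    (B : J0 →L[ℝ] J0 →L[ℝ] J0) (hB : B = fderiv ℝ (fderiv ℝ V) p) (f : R3) :
    ((B (0, f) (0, f)).2 0 = 0 ∧ (B (0, f) (0, f)).2 1 = 0) ∧
    (2 * c.p1 (p.1 0) * (B (Pi.single 1 1, 0) (0, f)).2 1 = (L (Pi.single 0 1, 0)).1 1 * f 0 ∧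
    2 * c.p1 (p.1 0) * (B (Pi.single 1 1, 0) (0, f)).2 0 = -((L (Pi.single 0 1, 0)).1 1 * f 1)) ∧
    (2 * c.p2 (p.1 0) * (B (Pi.single 2 1, 0) (0, f)).2 1 = (L (Pi.single 0 1, 0)).1 2 * f 0 ∧
    2 * c.p2 (p.1 0) * (B (Pi.single 2 1, 0) (0, f)).2 0 = -((L (Pi.single 0 1, 0)).1 2 * f 1)) := by
  have hp1 : c.p1 (p.1 0) ≠ 0 := hc.p1.2 _ hp
  have hp2 : c.p2 (p.1 0) ≠ 0 := hc.p2.2 _ hp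
  set N := c.q1 (p.1 0) * (p.2 0 ^ 2 + p.2 1 ^ 2) + c.q2 (p.1 0) * p.2 2 with hN
  obtain ⟨w0, w1, -⟩ := hV.second_order hI hc hp L hL
  obtain ⟨τ, g, h, -, -, -, hbase⟩ := hV.base_form hI hc
  have hF0 : ∀ f i, (L (0, f)).1 i = 0 := fun f i => by
    rw [hL, hV.fibre_indep hI hc hp f]; rfl
  have hz : L (0, 0) = 0 := map_zero L
  -- `ξ` is affine in `x` with coefficients depending on time alone.
  have bx : ∀ s : ℝ, (B (Pi.single 1 1, s • f) (Pi.single 1 1, s • f)).1 1 = 0 := by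
    intro s
    have : ∀ q ∈ dom I, indepCoord 1 (fderiv ℝ V q (Pi.single 1 1, s • f))
        = scaleRate c.p1 τ (q.1 0) := by
      intro q hq
      refine comp_fderiv_eq hI hV.1 hq (l := indepCoord 1) (fun q hq => (hbase q hq).2.1) ?_
      simpa using ((hasDerivAt_coord (q.1 1) 1 0).const_mul (scaleRate c.p1 τ (q.1 0))).add_const
        (g (q.1 0))
    rw [hB]
    refine comp_second_fderiv_eq hI hV.1 hp (l := indepCoord 1) this ?_
    simpa using hasDerivAt_const (0 : ℝ) (scaleRate c.p1 τ (p.1 0))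
  have bY : ∀ s : ℝ, (B (Pi.single 2 1, s • f) (Pi.single 2 1, s • f)).1 2 = 0 := by
    intro s
    have : ∀ q ∈ dom I, indepCoord 2 (fderiv ℝ V q (Pi.single 2 1, s • f))
        = scaleRate c.p2 τ (q.1 0) := by
      intro q hq
      refine comp_fderiv_eq hI hV.1 hq (l := indepCoord 2) (fun q hq => (hbase q hq).2.2) ?_
      simpa using ((hasDerivAt_coord (q.1 2) 1 0).const_mul (scaleRate c.p2 τ (q.1 0))).add_const
        (h (q.1 0))
    rw [hB]
    refine comp_second_fderiv_eq hI hV.1 hp (l := indepCoord 2) this ?_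
    simpa using hasDerivAt_const (0 : ℝ) (scaleRate c.p2 τ (p.1 0))
  have key := fun s s' : ℝ => (hV.conditions hI hc hp
      ![N * p.2 1, -(N * p.2 0), 0] (s • f) (s' • f) 0 0
      ![0, 0, c.r2 (p.1 0) * (2 * ((s' * f 0) ^ 2 + (s' * f 1) ^ 2))] 0 0
      (by simp [hN]; ring) (by simp [hN]; ring) (by simp) _ hL _ hB _ _ _ rfl rfl rfl
      _ _ rfl rfl _ _ rfl rfl _ _ (fun _ => rfl) (fun _ => rfl))
  obtain ⟨b1, b2, b3, b4⟩ := And.intro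
    (fun s : ℝ => (hV.second_time hI hc hp (Pi.single 1 1, s • f) (s • f)).1) <| And.intro
    (fun s : ℝ => (hV.second_time hI hc hp (Pi.single 1 1, s • f) (s • f)).2.1) <| And.intro
    (fun s : ℝ => (hV.second_time hI hc hp (Pi.single 2 1, s • f) (s • f)).2.2.1)
    (fun s : ℝ => (hV.second_time hI hc hp (Pi.single 2 1, s • f) (s • f)).2.2.2)
  rw [← hB] at b1 b2 b3 b4
  have x0 := fun e s => second_fderiv_expand hI hV.1 hp e f s
  rw [← hB] at x0
  simp only [clm_expand L _ ![_, _, _], Prod.fst_add, Prod.snd_add, Pi.add_apply, Prod.smul_fst,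
    Prod.smul_snd, Pi.smul_apply, smul_eq_mul, hF0, hz, bx, bY, b1, b2, b3, b4, w0, w1,
    mul_zero, zero_mul, add_zero, zero_add, sub_zero,
    Matrix.cons_val_zero, Matrix.cons_val_one, Matrix.cons_val, Pi.zero_apply]
    at key
  simp only [x0, Prod.snd_add, Prod.smul_snd, Pi.add_apply, Pi.smul_apply, smul_eq_mul] at key
  -- Here `f_x = s f` and `f_y = s' f`. The values at `0, 1, -1` split the condition into its even
  -- part, the Hessian in the fibre, and its odd part, the mixed derivatives balanced by `ξ_t` or
  -- `η_t`.
  have k0 := key 0 0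
  have k1 := key 1 0
  have k2 := key (-1) 0
  have m1 := key 0 1
  have m2 := key 0 (-1)
  have q1 : c.p1 (p.1 0) * (B (0, f) (0, f)).2 1 = 0 := by
    linear_combination (1 / 2) * (k1.1 + k2.1 - 2 * k0.1)
  have q2 : c.p1 (p.1 0) * (B (0, f) (0, f)).2 0 = 0 := by
    linear_combination (1 / 2) * (k1.2.1 + k2.2.1 - 2 * k0.2.1)
  refine ⟨⟨(mul_eq_zero.1 q2).resolve_left hp1, (mul_eq_zero.1 q1).resolve_left hp1⟩,
    ⟨?_, ?_⟩, ?_, ?_⟩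
  · linear_combination (1 / 2) * (k1.1 - k2.1)
  · linear_combination (1 / 2) * (k1.2.1 - k2.2.1)
  · linear_combination (1 / 2) * (m1.1 - m2.1)
  · linear_combination (1 / 2) * (m1.2.1 - m2.2.1)

/-- The determining equation of order zero in a jet with `v = 0` and vanishing derivatives in
space. -/
theorem IsSymmetry.zeroth_order (hI : IsOpen I) (hc : c.Admissible I) (hV : IsSymmetry I c V)
    (hp : p ∈ dom I) (hv : p.2 1 = 0) (L : J0 →L[ℝ] J0) (hL : L = fderiv ℝ V p)
    (B : J0 →L[ℝ] J0 →L[ℝ] J0) (hB : B = fderiv ℝ (fderiv ℝ V) p) :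
    -((L (Pi.single 0 1, 0)).2 1 + ((L (Pi.single 0 1, 0)).1 0 - (L (0, Pi.single 1 1)).2 1)
        * (p.2 0 * (c.q1 (p.1 0) * p.2 0 ^ 2 + c.q2 (p.1 0) * p.2 2)))
      + c.p1 (p.1 0) * (B (Pi.single 1 1, 0) (Pi.single 1 1, 0)).2 0
      + c.p2 (p.1 0) * (B (Pi.single 2 1, 0) (Pi.single 2 1, 0)).2 0
      - ((deriv c.q1 (p.1 0) * (V p).1 0 * p.2 0 + 3 * c.q1 (p.1 0) * (V p).2 0) * p.2 0 ^ 2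
        + (deriv c.q2 (p.1 0) * (V p).1 0 * p.2 0 + c.q2 (p.1 0) * (V p).2 0) * p.2 2
        + c.q2 (p.1 0) * p.2 0 * (V p).2 2) = 0 := by
  set N := c.q1 (p.1 0) * (p.2 0 ^ 2 + p.2 1 ^ 2) + c.q2 (p.1 0) * p.2 2 with hN
  have hF0 : ∀ f i, (L (0, f)).1 i = 0 := fun f i => by
    rw [hL, hV.fibre_indep hI hc hp f]; rfl
  have hz : L (0, 0) = 0 := map_zero L
  have key := (hV.conditions hI hc hp ![N * p.2 1, -(N * p.2 0), 0] 0 0 0 0 0 0 0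
      (by simp [hN]; ring) (by simp [hN]; ring) (by simp) _ hL _ hB _ _ _ rfl rfl rfl
      _ _ rfl rfl _ _ rfl rfl _ _ (fun _ => rfl) (fun _ => rfl)).2.1
  obtain ⟨b1, b2, -, -⟩ := hV.second_time hI hc hp (Pi.single 1 1, 0) 0
  obtain ⟨-, -, b3, b4⟩ := hV.second_time hI hc hp (Pi.single 2 1, 0) 0
  rw [← hB] at b1 b2 b3 b4
  simp only [clm_expand L _ ![_, _, _], Prod.fst_add, Prod.snd_add, Pi.add_apply, Prod.smul_fst,
    Prod.smul_snd, Pi.smul_apply, smul_eq_mul, hF0, hz, b1, b2, b3, b4,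
    mul_zero, zero_mul, add_zero, zero_add, sub_zero, hN, hv,
    Matrix.cons_val_zero, Matrix.cons_val_one, Matrix.cons_val, Pi.zero_apply]
    at key
  linear_combination key

end

/-! ### Candidate fields, and the proof that every symmetry is a candidate. -/

/-- Coefficient functions of a vector field with components `τ`, `α x + g`, `β y + h`,
`σ u + Φ v`, `σ v - Φ u`, `κ w + S`, where the phase `Φ` and the shift `S` are polynomials in `x`,
`y` without a mixed term. -/
structure Fld where
  τ : ℝ → ℝ
  α : ℝ → ℝ
  g : ℝ → ℝ
  β : ℝ → ℝ
  h : ℝ → ℝ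
  σ : ℝ → ℝ
  κ : ℝ → ℝ
  fxx : ℝ → ℝ
  fyy : ℝ → ℝ
  fx : ℝ → ℝ
  fy : ℝ → ℝ
  f0 : ℝ → ℝ
  sxx : ℝ → ℝ
  syy : ℝ → ℝ
  sx : ℝ → ℝ
  sy : ℝ → ℝ
  s0 : ℝ → ℝ

/-- All coefficient functions are smooth. -/
structure Fld.IsSmooth (F : Fld) (I : Set ℝ) : Prop where
  τ : Smooth I F.τ
  α : Smooth I F.α
  g : Smooth I F.g
  β : Smooth I F.β
  h : Smooth I F.h
  σ : Smooth I F.σ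
  κ : Smooth I F.κ
  fxx : Smooth I F.fxx
  fyy : Smooth I F.fyy
  fx : Smooth I F.fx
  fy : Smooth I F.fy
  f0 : Smooth I F.f0
  sxx : Smooth I F.sxx
  syy : Smooth I F.syy
  sx : Smooth I F.sx
  sy : Smooth I F.sy
  s0 : Smooth I F.s0

/-- The vector field with the given coefficient functions. -/
def Fld.toVF (F : Fld) : VF := fun z =>
  (![F.τ (z.1 0), F.α (z.1 0) * z.1 1 + F.g (z.1 0), F.β (z.1 0) * z.1 2 + F.h (z.1 0)],
   ![F.σ (z.1 0) * z.2 0 + (F.fxx (z.1 0) * z.1 1 ^ 2 + F.fyy (z.1 0) * z.1 2 ^ 2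
        + F.fx (z.1 0) * z.1 1 + F.fy (z.1 0) * z.1 2 + F.f0 (z.1 0)) * z.2 1,
     F.σ (z.1 0) * z.2 1 - (F.fxx (z.1 0) * z.1 1 ^ 2 + F.fyy (z.1 0) * z.1 2 ^ 2
        + F.fx (z.1 0) * z.1 1 + F.fy (z.1 0) * z.1 2 + F.f0 (z.1 0)) * z.2 0,
     F.κ (z.1 0) * z.2 2 + (F.sxx (z.1 0) * z.1 1 ^ 2 + F.syy (z.1 0) * z.1 2 ^ 2
        + F.sx (z.1 0) * z.1 1 + F.sy (z.1 0) * z.1 2 + F.s0 (z.1 0))])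

/-- Coefficient of the square of a space variable in the phase of a candidate. -/
noncomputable def phaseQuad (f τ : ℝ → ℝ) (t : ℝ) : ℝ := -(deriv (scaleRate f τ) t / (4 * f t))

/-- Coefficient of a space variable in the phase of a candidate. -/
noncomputable def phaseLin (f g : ℝ → ℝ) (t : ℝ) : ℝ := -(deriv g t / (2 * f t))

/-- The candidates for symmetries, parametrised by four functions of time. -/
noncomputable def symField (c : Coeffs) (τ g h m : ℝ → ℝ) : Fld where
  τ := τ
  α := scaleRate c.p1 τ
  g := g
  β := scaleRate c.p2 τ
  h := h
  σ := fun t => -scaleRate c.q1 τ t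
  κ := fun t => -(2 * scaleRate c.q2 τ t)
  fxx := phaseQuad c.p1 τ
  fyy := phaseQuad c.p2 τ
  fx := phaseLin c.p1 g
  fy := phaseLin c.p2 h
  f0 := m
  sxx := fun t => deriv (phaseQuad c.p1 τ) t / c.q2 t
  syy := fun t => deriv (phaseQuad c.p2 τ) t / c.q2 t
  sx := fun t => deriv (phaseLin c.p1 g) t / c.q2 t
  sy := fun t => deriv (phaseLin c.p2 h) t / c.q2 t
  s0 := fun t => deriv m t / c.q2 t

theorem hasDerivAt_of_eq {f g : ℝ → ℝ} {v v' s : ℝ} (h : HasDerivAt f v s) (hv : v = v')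
    (hf : ∀ s, g s = f s) : HasDerivAt g v' s :=
  (h.congr_deriv hv).congr_of_eventuallyEq (Filter.Eventually.of_forall hf)

section
variable {I : Set ℝ} {c : Coeffs} {V : VF} {p : J0}

theorem symField_isSmooth (hI : IsOpen I) (hc : c.Admissible I) {τ g h m : ℝ → ℝ}
    (hτ : Smooth I τ) (hg : Smooth I g) (hh : Smooth I h) (hm : Smooth I m) :
    (symField c τ g h m).IsSmooth I := by
  have a1 := Smooth.scaleRate hI hc.p1 hτ
  have a2 := Smooth.scaleRate hI hc.p2 hτ
  have b1 := ((a1.deriv hI).div (hc.p1.const_mul (a := 4) (by norm_num))).neg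
  have b2 := ((a2.deriv hI).div (hc.p2.const_mul (a := 4) (by norm_num))).neg
  have b3 := ((hg.deriv hI).div (hc.p1.const_mul (a := 2) (by norm_num))).neg
  have b4 := ((hh.deriv hI).div (hc.p2.const_mul (a := 2) (by norm_num))).neg
  exact ⟨hτ, a1, hg, a2, hh, (Smooth.scaleRate hI hc.q1 hτ).neg,
    ((Smooth.const 2).mul (Smooth.scaleRate hI hc.q2 hτ)).neg, b1, b2, b3, b4, hm,
    (b1.deriv hI).div hc.q2, (b2.deriv hI).div hc.q2, (b3.deriv hI).div hc.q2,
    (b4.deriv hI).div hc.q2, (hm.deriv hI).div hc.q2⟩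

theorem mem_of_fst_eq {q : J0} (hp : p ∈ dom I) (h : q.1 0 = p.1 0) : q ∈ dom I := by
  simpa [dom, h] using hp

/-- Every symmetry is one of the candidates. -/
theorem IsSymmetry.eq_symField (hI : IsOpen I) (hc : c.Admissible I) (hV : IsSymmetry I c V) :
    ∃ τ g h m : ℝ → ℝ, Smooth I τ ∧ Smooth I g ∧ Smooth I h ∧ Smooth I m ∧
      EqVF I V (symField c τ g h m).toVF := by
  obtain ⟨τ, g, h, sτ, sg, sh, hbase⟩ := hV.base_form hI hc
  -- The phase is the coefficient of `v` in `φ₁`, and `m` is its value at `x = y = 0`.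
  set m : ℝ → ℝ := fun t => depCoord 0 (fderiv ℝ V (axis t) (0, Pi.single 1 1)) with hm
  have sL : ∀ d, ContDiffOn ℝ ∞ (fun q => fderiv ℝ V q d) (dom I) := fun d =>
    (hV.1.fderiv_of_isOpen (isOpen_dom hI) (m := ∞) (by simp)).clm_apply contDiffOn_const
  have sm : Smooth I m := smooth_axis (sL _) _
  set F := symField c τ g h m with hF
  have sF : F.IsSmooth I := symField_isSmooth hI hc sτ sg sh sm
  refine ⟨τ, g, h, m, sτ, sg, sh, sm, ?_⟩
  -- time derivatives of the components in the base
  have tt : ∀ q ∈ dom I, (fderiv ℝ V q (Pi.single 0 1, 0)).1 0 = deriv τ (q.1 0) := by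
    intro q hq
    refine comp_fderiv_eq hI hV.1 hq (l := indepCoord 0) (fun q hq => (hbase q hq).1) ?_
    simpa using sτ.hasDerivAt_line hI hq 1
  have xt : ∀ q ∈ dom I, (fderiv ℝ V q (Pi.single 0 1, 0)).1 1
      = deriv F.α (q.1 0) * q.1 1 + deriv g (q.1 0) := by
    intro q hq
    refine comp_fderiv_eq hI hV.1 hq (l := indepCoord 1) (fun q hq => (hbase q hq).2.1) ?_
    exact hasDerivAt_of_eq (((sF.α.hasDerivAt_line hI hq 1).mul_const (q.1 1)).add
      (sg.hasDerivAt_line hI hq 1)) (by simp) fun s => by simp [hF, symField]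
  have yt : ∀ q ∈ dom I, (fderiv ℝ V q (Pi.single 0 1, 0)).1 2
      = deriv F.β (q.1 0) * q.1 2 + deriv h (q.1 0) := by
    intro q hq
    refine comp_fderiv_eq hI hV.1 hq (l := indepCoord 2) (fun q hq => (hbase q hq).2.2) ?_
    exact hasDerivAt_of_eq (((sF.β.hasDerivAt_line hI hq 1).mul_const (q.1 2)).add
      (sh.hasDerivAt_line hI hq 1)) (by simp) fun s => by simp [hF, symField]
  -- the Hessian in the fibre directions vanishes
  have ff : ∀ q ∈ dom I, ∀ f f' : R3,
      (fderiv ℝ (fderiv ℝ V) q (0, f) (0, f')).2 0 = 0 := by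
    intro q hq f f'
    -- Polarisation: `first_order` gives only the diagonal values of the fibre Hessian.
    have h1 := (hV.first_order hI hc hq _ rfl _ rfl (f + f')).1.1
    have h2 := (hV.first_order hI hc hq _ rfl _ rfl f).1.1
    have h3 := (hV.first_order hI hc hq _ rfl _ rfl f').1.1
    have h4 : ((0, f + f') : J0) = (0, f) + (0, f') := by simp
    rw [h4] at h1
    simp only [map_add, add_apply, Prod.snd_add, Pi.add_apply, h2, h3] at h1
    rw [second_fderiv_symm hI hV.1 hq (0, f') (0, f)] at h1
    linarith
  -- the scaling of `u` and `v`
  set σ : ℝ → ℝ := fun t => depCoord 0 (fderiv ℝ V (axis t) (0, Pi.single 0 1)) with hσ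
  have sσ : Smooth I σ := smooth_axis (sL _) _
  have eu : ∀ q ∈ dom I, (fderiv ℝ V q (0, Pi.single 0 1)).2 0 = σ (q.1 0) := by
    intro q hq
    refine eq_axis (F := fun q => depCoord 0 (fderiv ℝ V q (0, Pi.single 0 1)))
      (fun q hq d hd => ?_) hq
    refine (hasDerivAt_comp_fderiv_line hI hV.1 hq d _ (depCoord 0)).congr_deriv ?_
    have h1 := (hV.first_order hI hc hq _ rfl _ rfl (Pi.single 0 1)).2.1.2
    have h2 := (hV.first_order hI hc hq _ rfl _ rfl (Pi.single 0 1)).2.2.2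
    simp [hc.p1.2 _ hq, hc.p2.2 _ hq] at h1 h2
    have h3 := clm_fibre ((fderiv ℝ (fderiv ℝ V) q).flip (0, Pi.single 0 1)) hd
    simp only [ContinuousLinearMap.flip_apply] at h3
    rw [h3]
    simp [depCoord, h1, h2, ff q hq]
  set Φ : J0 → ℝ := fun q => F.fxx (q.1 0) * q.1 1 ^ 2 + F.fyy (q.1 0) * q.1 2 ^ 2
        + F.fx (q.1 0) * q.1 1 + F.fy (q.1 0) * q.1 2 + F.f0 (q.1 0) with hΦ
  have ev : ∀ q ∈ dom I, (fderiv ℝ V q (0, Pi.single 1 1)).2 0 = Φ q := by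
    intro q hq
    -- By `first_order` the phase has `x`-derivative `-ξ_t / (2 p₁)` and `y`-derivative `-η_t / (2
    -- p₂)`, affine in `x` and `y` respectively. The subtracted polynomial is their integral, which
    -- explains the factors in `phaseQuad` and `phaseLin`.
    have := eq_axis (I := I) (F := fun q => depCoord 0 (fderiv ℝ V q (0, Pi.single 1 1))
      - (F.fxx (q.1 0) * q.1 1 ^ 2 + F.fyy (q.1 0) * q.1 2 ^ 2
        + F.fx (q.1 0) * q.1 1 + F.fy (q.1 0) * q.1 2)) (fun q hq d hd => ?_) hq
    · have e0 : (axis (q.1 0)).1 0 = q.1 0 := by simp [axis]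
      have e1 : (axis (q.1 0)).1 1 = 0 := by simp [axis]
      have e2 : (axis (q.1 0)).1 2 = 0 := by simp [axis]
      simp only [e0, e1, e2] at this
      have e3 : F.f0 (q.1 0) = depCoord 0 (fderiv ℝ V (axis (q.1 0)) (0, Pi.single 1 1)) := rfl
      simp only [hΦ, e3]
      change depCoord 0 _ = _
      linear_combination this
    · have hp1 := hc.p1.2 _ hq
      have hp2 := hc.p2.2 _ hq
      have x1 := hasDerivAt_coord (q.1 1) (d.1 1) 0
      have x2 := hasDerivAt_coord (q.1 2) (d.1 2) 0
      have h0 := (hasDerivAt_comp_fderiv_line hI hV.1 hq d (0, Pi.single 1 1) (depCoord 0)).sub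
        (((((x1.pow 2).const_mul (F.fxx (q.1 0))).add
          ((x2.pow 2).const_mul (F.fyy (q.1 0)))).add (x1.const_mul (F.fx (q.1 0)))).add
          (x2.const_mul (F.fy (q.1 0))))
      refine (h0.congr_deriv ?_).congr_of_eventuallyEq (Filter.Eventually.of_forall fun s => ?_)
      · have h1 := (hV.first_order hI hc hq _ rfl _ rfl (Pi.single 1 1)).2.1.2
        have h2 := (hV.first_order hI hc hq _ rfl _ rfl (Pi.single 1 1)).2.2.2
        rw [xt q hq] at h1
        rw [yt q hq] at h2
        have h3 := clm_fibre ((fderiv ℝ (fderiv ℝ V) q).flip (0, Pi.single 1 1)) hd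
        simp only [ContinuousLinearMap.flip_apply] at h3
        rw [h3]
        simp [depCoord, ff q hq] at h1 h2 ⊢
        simp only [hF, symField, phaseQuad, phaseLin] at h1 h2 ⊢
        field_simp
        linear_combination (4 * d.1 1 * c.p2 (q.1 0)) * h1 + (4 * d.1 2 * c.p1 (q.1 0)) * h2
      · simp [hd]
  -- the components `φ₁`, `φ₂`
  have hsec := fun q hq => hV.second_order hI hc (p := q) hq _ rfl
  have fibre : ∀ q ∈ dom I, ∀ f : R3, ∀ a : Fin 3, (fderiv ℝ V q (0, f)).2 a
      = f 0 * (fderiv ℝ V q (0, Pi.single 0 1)).2 a + f 1 * (fderiv ℝ V q (0, Pi.single 1 1)).2 a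
        + f 2 * (fderiv ℝ V q (0, Pi.single 2 1)).2 a := by
    intro q hq f a
    rw [clm_expand (fderiv ℝ V q) 0 f]
    have : ((0, 0) : J0) = 0 := rfl
    simp [this]
  have base0 : ∀ q : J0, q ∈ dom I → ((q.1, 0) : J0) ∈ dom I := fun q hq =>
    mem_of_fst_eq hq rfl
  have c0 : ∀ q ∈ dom I, (V q).2 0 = σ (q.1 0) * q.2 0 + Φ q * q.2 1 := by
    intro q hq
    -- Integration along the fibre from its origin, where `second_order` gives `φ₁ = 0`.
    have := line_const (I := I) (p := (q.1, 0)) (d := (0, q.2))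
      (F := fun q => depCoord 0 (V q) - (σ (q.1 0) * q.2 0 + Φ q * q.2 1)) (by simp)
      (fun r hr => ?_) (base0 q hq)
    · have h0 := ((hsec _ (base0 q hq)).2.2.2.2.2.2.2.2 rfl rfl).1
      simp [depCoord, h0] at this
      linear_combination this
    · have h1 := (hasDerivAt_comp_line hI hV.1 hr (0, q.2) (depCoord 0)).sub
        (((hasDerivAt_coord (r.2 0) (q.2 0) 0).const_mul (σ (r.1 0))).add
          ((hasDerivAt_coord (r.2 1) (q.2 1) 0).const_mul (Φ r)))
      refine (h1.congr_deriv ?_).congr_of_eventuallyEq (Filter.Eventually.of_forall fun s => ?_)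
      · change (fderiv ℝ V r (0, q.2)).2 0 - _ = 0
        rw [fibre r hr, eu r hr, ev r hr, (hsec r hr).1]
        ring
      · simp [hΦ]
  have c1 : ∀ q ∈ dom I, (V q).2 1 = σ (q.1 0) * q.2 1 - Φ q * q.2 0 := by
    intro q hq
    have := line_const (I := I) (p := (q.1, 0)) (d := (0, q.2))
      (F := fun q => depCoord 1 (V q) - (σ (q.1 0) * q.2 1 - Φ q * q.2 0)) (by simp)
      (fun r hr => ?_) (base0 q hq)
    · have h0 := ((hsec _ (base0 q hq)).2.2.2.2.2.2.2.2 rfl rfl).2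
      simp [depCoord, h0] at this
      linear_combination this
    · have h1 := (hasDerivAt_comp_line hI hV.1 hr (0, q.2) (depCoord 1)).sub
        (((hasDerivAt_coord (r.2 1) (q.2 1) 0).const_mul (σ (r.1 0))).sub
          ((hasDerivAt_coord (r.2 0) (q.2 0) 0).const_mul (Φ r)))
      refine (h1.congr_deriv ?_).congr_of_eventuallyEq (Filter.Eventually.of_forall fun s => ?_)
      · change (fderiv ℝ V r (0, q.2)).2 1 - _ = 0
        rw [fibre r hr, (hsec r hr).2.2.2.2.1, (hsec r hr).2.2.2.2.2.1, eu r hr, ev r hr,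
          (hsec r hr).2.1]
        ring
      · simp [hΦ]
  -- the component `φ₃`
  have c2 : ∀ q ∈ dom I, ∀ a : ℝ, (V q).2 2 = (V (q.1, ![a, 0, q.2 2])).2 2 := by
    intro q hq a
    -- `φ₃` does not depend on `u` and `v`, so its value may be compared with one at `u = a`, `v =
    -- 0`, where `zeroth_order` applies.
    have := line_const (I := I) (p := q) (d := (0, ![a - q.2 0, -q.2 1, 0]))
      (F := fun q => depCoord 2 (V q)) (by simp) (fun r hr => ?_) hq
    · rw [show q + (0, ![a - q.2 0, -q.2 1, 0]) = ((q.1, ![a, 0, q.2 2]) : J0) from ?_] at this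
      · exact this.symm
      · ext i
        · simp
        · fin_cases i <;> simp
    · refine (hasDerivAt_comp_line hI hV.1 hr _ (depCoord 2)).congr_deriv ?_
      change (fderiv ℝ V r (0, _)).2 2 = 0
      rw [fibre r hr, (hsec r hr).2.2.1, (hsec r hr).2.2.2.1]
      simp
  have dt : ∀ q ∈ dom I, q.2 1 = 0 → (fderiv ℝ V q (Pi.single 0 1, 0)).2 1
      = -((deriv F.fxx (q.1 0) * q.1 1 ^ 2 + deriv F.fyy (q.1 0) * q.1 2 ^ 2
        + deriv F.fx (q.1 0) * q.1 1 + deriv F.fy (q.1 0) * q.1 2 + deriv F.f0 (q.1 0))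
        * q.2 0) := by
    intro q hq hv
    refine comp_fderiv_eq hI hV.1 hq (l := depCoord 1) c1 ?_
    simp only [hΦ]
    exact hasDerivAt_of_eq (((sσ.hasDerivAt_line hI hq 1).mul_const (q.2 1)).sub
      ((((((sF.fxx.hasDerivAt_line hI hq 1).mul_const (q.1 1 ^ 2)).add
        ((sF.fyy.hasDerivAt_line hI hq 1).mul_const (q.1 2 ^ 2))).add
        ((sF.fx.hasDerivAt_line hI hq 1).mul_const (q.1 1))).add
        ((sF.fy.hasDerivAt_line hI hq 1).mul_const (q.1 2))).add
        (sF.f0.hasDerivAt_line hI hq 1) |>.mul_const (q.2 0))) (by simp [hv]) fun s => by simp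
  have dx : ∀ q ∈ dom I, (fderiv ℝ V q (Pi.single 1 1, 0)).2 0
      = (2 * F.fxx (q.1 0) * q.1 1 + F.fx (q.1 0)) * q.2 1 := by
    intro q hq
    refine comp_fderiv_eq hI hV.1 hq (l := depCoord 0) c0 ?_
    simp only [hΦ]
    have x1 := hasDerivAt_coord (q.1 1) 1 0
    have := ((((((x1.pow 2).const_mul (F.fxx (q.1 0))).add_const
      (F.fyy (q.1 0) * q.1 2 ^ 2)).add (x1.const_mul (F.fx (q.1 0)))).add_const
      (F.fy (q.1 0) * q.1 2 + F.f0 (q.1 0))).mul_const (q.2 1)).const_add (σ (q.1 0) * q.2 0)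
    refine (this.congr_deriv ?_).congr_of_eventuallyEq (Filter.Eventually.of_forall fun s => ?_)
    · simp [-mul_eq_mul_right_iff]
      ring
    · simp [-mul_eq_mul_right_iff]
      ring
  have dy : ∀ q ∈ dom I, (fderiv ℝ V q (Pi.single 2 1, 0)).2 0
      = (2 * F.fyy (q.1 0) * q.1 2 + F.fy (q.1 0)) * q.2 1 := by
    intro q hq
    refine comp_fderiv_eq hI hV.1 hq (l := depCoord 0) c0 ?_
    simp only [hΦ]
    have x1 := hasDerivAt_coord (q.1 2) 1 0
    have := ((((((x1.pow 2).const_mul (F.fyy (q.1 0))).add_const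
      (F.fxx (q.1 0) * q.1 1 ^ 2)).add (x1.const_mul (F.fy (q.1 0)))).add_const
      (F.fx (q.1 0) * q.1 1 + F.f0 (q.1 0))).mul_const (q.2 1)).const_add (σ (q.1 0) * q.2 0)
    refine (this.congr_deriv ?_).congr_of_eventuallyEq (Filter.Eventually.of_forall fun s => ?_)
    · simp [-mul_eq_mul_right_iff]
      ring
    · simp [-mul_eq_mul_right_iff]
      ring
  have dxx : ∀ q ∈ dom I, q.2 1 = 0 →
      (fderiv ℝ (fderiv ℝ V) q (Pi.single 1 1, 0) (Pi.single 1 1, 0)).2 0 = 0 := by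
    intro q hq hv
    refine comp_second_fderiv_eq hI hV.1 hq (l := depCoord 0) dx ?_
    simpa [hv] using hasDerivAt_const (0 : ℝ) (0 : ℝ)
  have dyy : ∀ q ∈ dom I, q.2 1 = 0 →
      (fderiv ℝ (fderiv ℝ V) q (Pi.single 2 1, 0) (Pi.single 2 1, 0)).2 0 = 0 := by
    intro q hq hv
    refine comp_second_fderiv_eq hI hV.1 hq (l := depCoord 0) dy ?_
    simpa [hv] using hasDerivAt_const (0 : ℝ) (0 : ℝ)
  -- The order zero equation at `u = a`, `v = 0`, divided by `a`, is affine in `a²`. The values `a =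
  -- 1` and `a = 2` separate the coefficient of `a²`, which determines `σ`, from the constant term,
  -- which determines `φ₃`.
  have zo : ∀ q ∈ dom I, ∀ a : ℝ, a ≠ 0 →
      (deriv F.fxx (q.1 0) * q.1 1 ^ 2 + deriv F.fyy (q.1 0) * q.1 2 ^ 2
        + deriv F.fx (q.1 0) * q.1 1 + deriv F.fy (q.1 0) * q.1 2 + deriv F.f0 (q.1 0))
      - (deriv τ (q.1 0) - σ (q.1 0)) * (c.q1 (q.1 0) * a ^ 2 + c.q2 (q.1 0) * q.2 2)
      - (deriv c.q1 (q.1 0) * τ (q.1 0) + 3 * c.q1 (q.1 0) * σ (q.1 0)) * a ^ 2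
      - (deriv c.q2 (q.1 0) * τ (q.1 0) + c.q2 (q.1 0) * σ (q.1 0)) * q.2 2
      - c.q2 (q.1 0) * (V q).2 2 = 0 := by
    intro q hq a ha
    have hr : ((q.1, ![a, 0, q.2 2]) : J0) ∈ dom I := mem_of_fst_eq hq rfl
    have hz := hV.zeroth_order hI hc hr rfl _ rfl _ rfl
    rw [dxx _ hr rfl, dyy _ hr rfl, dt _ hr rfl, tt _ hr, (hsec _ hr).2.2.2.2.1, eu _ hr,
      ← c2 q hq a, (hbase _ hr).1, c0 _ hr] at hz
    simp at hz
    refine (mul_eq_zero.1 (?_ : a * _ = 0)).resolve_left ha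
    linear_combination hz
  have eσ : ∀ q ∈ dom I, σ (q.1 0) = F.σ (q.1 0) := by
    intro q hq
    have hq1 := hc.q1.2 _ hq
    have h1 := zo q hq 1 one_ne_zero
    have h2 := zo q hq 2 two_ne_zero
    simp only [hF, symField, scaleRate]
    field_simp
    linear_combination (1 / 3) * (h1 - h2)
  intro q hq
  refine Prod.ext (funext fun i => ?_) (funext fun i => ?_)
  · fin_cases i
    · exact (hbase q hq).1
    · exact (hbase q hq).2.1
    · exact (hbase q hq).2.2
  · fin_cases i
    · change (V q).2 0 = F.σ (q.1 0) * q.2 0 + Φ q * q.2 1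
      rw [c0 q hq, eσ q hq]
    · change (V q).2 1 = F.σ (q.1 0) * q.2 1 - Φ q * q.2 0
      rw [c1 q hq, eσ q hq]
    · change (V q).2 2 = F.κ (q.1 0) * q.2 2 + (deriv F.fxx (q.1 0) / c.q2 (q.1 0) * q.1 1 ^ 2
        + deriv F.fyy (q.1 0) / c.q2 (q.1 0) * q.1 2 ^ 2
        + deriv F.fx (q.1 0) / c.q2 (q.1 0) * q.1 1 + deriv F.fy (q.1 0) / c.q2 (q.1 0) * q.1 2
        + deriv F.f0 (q.1 0) / c.q2 (q.1 0))
      have hq2 := hc.q2.2 _ hq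
      have h1 := zo q hq 1 one_ne_zero
      have h2 := zo q hq 2 two_ne_zero
      have hκ : F.κ (q.1 0) = -(deriv τ (q.1 0)
          + τ (q.1 0) * (deriv c.q2 (q.1 0) / c.q2 (q.1 0))) := by
        simp only [hF, symField, scaleRate]
        ring
      rw [hκ]
      field_simp
      linear_combination (1 / 3) * h2 - (4 / 3) * h1

end

/-! ### The prolonged action of a candidate. -/

/-- The derivative of the vector field `F` in the direction `d`. -/
noncomputable def Fld.lin (F : Fld) (z d : J0) : J0 :=
  (![deriv F.τ (z.1 0) * d.1 0,
     deriv F.α (z.1 0) * d.1 0 * z.1 1 + F.α (z.1 0) * d.1 1 + deriv F.g (z.1 0) * d.1 0,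
     deriv F.β (z.1 0) * d.1 0 * z.1 2 + F.β (z.1 0) * d.1 2 + deriv F.h (z.1 0) * d.1 0],
   ![deriv F.σ (z.1 0) * d.1 0 * z.2 0 + F.σ (z.1 0) * d.2 0
      + ((deriv F.fxx (z.1 0) * z.1 1 ^ 2 + deriv F.fyy (z.1 0) * z.1 2 ^ 2
        + deriv F.fx (z.1 0) * z.1 1 + deriv F.fy (z.1 0) * z.1 2 + deriv F.f0 (z.1 0)) * d.1 0
        + (2 * F.fxx (z.1 0) * z.1 1 + F.fx (z.1 0)) * d.1 1
        + (2 * F.fyy (z.1 0) * z.1 2 + F.fy (z.1 0)) * d.1 2) * z.2 1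
      + (F.fxx (z.1 0) * z.1 1 ^ 2 + F.fyy (z.1 0) * z.1 2 ^ 2
        + F.fx (z.1 0) * z.1 1 + F.fy (z.1 0) * z.1 2 + F.f0 (z.1 0)) * d.2 1,
     deriv F.σ (z.1 0) * d.1 0 * z.2 1 + F.σ (z.1 0) * d.2 1
      - ((deriv F.fxx (z.1 0) * z.1 1 ^ 2 + deriv F.fyy (z.1 0) * z.1 2 ^ 2
        + deriv F.fx (z.1 0) * z.1 1 + deriv F.fy (z.1 0) * z.1 2 + deriv F.f0 (z.1 0)) * d.1 0
        + (2 * F.fxx (z.1 0) * z.1 1 + F.fx (z.1 0)) * d.1 1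
        + (2 * F.fyy (z.1 0) * z.1 2 + F.fy (z.1 0)) * d.1 2) * z.2 0
      - (F.fxx (z.1 0) * z.1 1 ^ 2 + F.fyy (z.1 0) * z.1 2 ^ 2
        + F.fx (z.1 0) * z.1 1 + F.fy (z.1 0) * z.1 2 + F.f0 (z.1 0)) * d.2 0,
     deriv F.κ (z.1 0) * d.1 0 * z.2 2 + F.κ (z.1 0) * d.2 2
      + ((deriv F.sxx (z.1 0) * z.1 1 ^ 2 + deriv F.syy (z.1 0) * z.1 2 ^ 2
        + deriv F.sx (z.1 0) * z.1 1 + deriv F.sy (z.1 0) * z.1 2 + deriv F.s0 (z.1 0)) * d.1 0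
        + (2 * F.sxx (z.1 0) * z.1 1 + F.sx (z.1 0)) * d.1 1
        + (2 * F.syy (z.1 0) * z.1 2 + F.sy (z.1 0)) * d.1 2)])

section
variable {I : Set ℝ} {c : Coeffs} {V W : VF} {F : Fld} {p : J0}

theorem Fld.IsSmooth.contDiffOn (hF : F.IsSmooth I) : ContDiffOn ℝ ∞ F.toVF (dom I) := by
  have C : ∀ {f : ℝ → ℝ}, Smooth I f → ContDiffOn ℝ ∞ (fun z : J0 => f (z.1 0)) (dom I) := by
    intro f hf
    exact hf.comp (indepCoord 0).contDiff.contDiffOn fun z hz => hz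
  have c1 := C hF.τ
  have c2 := C hF.α
  have c3 := C hF.g
  have c4 := C hF.β
  have c5 := C hF.h
  have c6 := C hF.σ
  have c7 := C hF.κ
  have P : ∀ {a b e f g : ℝ → ℝ}, Smooth I a → Smooth I b → Smooth I e → Smooth I f → Smooth I g →
      ContDiffOn ℝ ∞ (fun z : J0 => a (z.1 0) * z.1 1 ^ 2 + b (z.1 0) * z.1 2 ^ 2
        + e (z.1 0) * z.1 1 + f (z.1 0) * z.1 2 + g (z.1 0)) (dom I) := by
    intro a b e f g ha hb he hf hg
    have x := (indepCoord 1).contDiff (n := ∞) |>.contDiffOn (s := dom I)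
    have y := (indepCoord 2).contDiff (n := ∞) |>.contDiffOn (s := dom I)
    exact (((((C ha).mul (x.pow 2)).add ((C hb).mul (y.pow 2))).add ((C he).mul x)).add
      ((C hf).mul y)).add (C hg)
  have d1 := P hF.fxx hF.fyy hF.fx hF.fy hF.f0
  have d2 := P hF.sxx hF.syy hF.sx hF.sy hF.s0
  have x1 := (indepCoord 1).contDiff (n := ∞) |>.contDiffOn (s := dom I)
  have x2 := (indepCoord 2).contDiff (n := ∞) |>.contDiffOn (s := dom I)
  have u0 := (depCoord 0).contDiff (n := ∞) |>.contDiffOn (s := dom I)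
  have u1 := (depCoord 1).contDiff (n := ∞) |>.contDiffOn (s := dom I)
  have u2 := (depCoord 2).contDiff (n := ∞) |>.contDiffOn (s := dom I)
  refine ContDiffOn.prodMk (contDiffOn_pi.2 fun i => ?_) (contDiffOn_pi.2 fun i => ?_)
  · fin_cases i
    · exact c1
    · exact (c2.mul x1).add c3
    · exact (c4.mul x2).add c5
  · fin_cases i
    · exact (c6.mul u0).add (d1.mul u1)
    · exact (c6.mul u1).sub (d1.mul u0)
    · exact (c7.mul u2).add d2

theorem hasDerivAt_quad (hI : IsOpen I) {t : ℝ} (ht : t ∈ I) {a b e f g : ℝ → ℝ} (ha : Smooth I a)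
    (hb : Smooth I b) (he : Smooth I e) (hf : Smooth I f) (hg : Smooth I g) (x y dt dx dy : ℝ) :
    HasDerivAt (fun s : ℝ => a (t + s * dt) * (x + s * dx) ^ 2 + b (t + s * dt) * (y + s * dy) ^ 2
        + e (t + s * dt) * (x + s * dx) + f (t + s * dt) * (y + s * dy) + g (t + s * dt))
      ((deriv a t * x ^ 2 + deriv b t * y ^ 2 + deriv e t * x + deriv f t * y + deriv g t) * dt
        + (2 * a t * x + e t) * dx + (2 * b t * y + f t) * dy) 0 := by
  have x1 := hasDerivAt_coord x dx 0
  have y1 := hasDerivAt_coord y dy 0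
  refine hasDerivAt_of_eq ((((((ha.hasDerivAt_line hI ht dt).mul (x1.pow 2)).add
    ((hb.hasDerivAt_line hI ht dt).mul (y1.pow 2))).add
    ((he.hasDerivAt_line hI ht dt).mul x1)).add ((hf.hasDerivAt_line hI ht dt).mul y1)).add
    (hg.hasDerivAt_line hI ht dt)) ?_ (fun s => rfl)
  simp
  ring

theorem Fld.IsSmooth.fderiv_toVF (hI : IsOpen I) (hF : F.IsSmooth I) (hp : p ∈ dom I) (d : J0) :
    fderiv ℝ F.toVF p d = F.lin p d := by
  have hC := hF.contDiffOn
  have t : ∀ {f : ℝ → ℝ}, Smooth I f →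
      HasDerivAt (fun s : ℝ => f (p.1 0 + s * d.1 0)) (deriv f (p.1 0) * d.1 0) 0 :=
    fun hf => hf.hasDerivAt_line hI hp _
  have x1 := hasDerivAt_coord (p.1 1) (d.1 1) 0
  have x2 := hasDerivAt_coord (p.1 2) (d.1 2) 0
  have u0 := hasDerivAt_coord (p.2 0) (d.2 0) 0
  have u1 := hasDerivAt_coord (p.2 1) (d.2 1) 0
  have u2 := hasDerivAt_coord (p.2 2) (d.2 2) 0
  have d1 := hasDerivAt_quad hI hp hF.fxx hF.fyy hF.fx hF.fy hF.f0 (p.1 1) (p.1 2) (d.1 0) (d.1 1)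
    (d.1 2)
  have d2 := hasDerivAt_quad hI hp hF.sxx hF.syy hF.sx hF.sy hF.s0 (p.1 1) (p.1 2) (d.1 0) (d.1 1)
    (d.1 2)
  refine Prod.ext (funext fun i => ?_) (funext fun i => ?_)
  · refine comp_fderiv_eq hI hC hp (l := indepCoord i) (E := fun q => (F.toVF q).1 i)
      (fun _ _ => rfl) ?_
    fin_cases i
    · exact t hF.τ
    · exact hasDerivAt_of_eq (((t hF.α).mul x1).add (t hF.g)) (by simp [Fld.lin]) fun s => rfl
    · exact hasDerivAt_of_eq (((t hF.β).mul x2).add (t hF.h)) (by simp [Fld.lin]) fun s => rfl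
  · refine comp_fderiv_eq hI hC hp (l := depCoord i) (E := fun q => (F.toVF q).2 i)
      (fun _ _ => rfl) ?_
    fin_cases i
    · refine hasDerivAt_of_eq (((t hF.σ).mul u0).add (d1.mul u1)) ?_ fun s => rfl
      simp [Fld.lin]
      ring
    · refine hasDerivAt_of_eq (((t hF.σ).mul u1).sub (d1.mul u0)) ?_ fun s => rfl
      simp [Fld.lin]
      ring
    · refine hasDerivAt_of_eq (((t hF.κ).mul u2).add d2) ?_ fun s => rfl
      simp [Fld.lin]

/-- Second derivatives in directions tangent to the time slices. -/
theorem Fld.IsSmooth.second_fderiv_toVF (hI : IsOpen I) (hF : F.IsSmooth I) (hp : p ∈ dom I)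
    {d : J0} (hd : d.1 0 = 0) : fderiv ℝ (fderiv ℝ F.toVF) p d d = (0,
      ![(2 * F.fxx (p.1 0) * d.1 1 ^ 2 + 2 * F.fyy (p.1 0) * d.1 2 ^ 2) * p.2 1
        + 2 * ((2 * F.fxx (p.1 0) * p.1 1 + F.fx (p.1 0)) * d.1 1
        + (2 * F.fyy (p.1 0) * p.1 2 + F.fy (p.1 0)) * d.1 2) * d.2 1,
        -((2 * F.fxx (p.1 0) * d.1 1 ^ 2 + 2 * F.fyy (p.1 0) * d.1 2 ^ 2) * p.2 0
        + 2 * ((2 * F.fxx (p.1 0) * p.1 1 + F.fx (p.1 0)) * d.1 1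
        + (2 * F.fyy (p.1 0) * p.1 2 + F.fy (p.1 0)) * d.1 2) * d.2 0),
        2 * F.sxx (p.1 0) * d.1 1 ^ 2 + 2 * F.syy (p.1 0) * d.1 2 ^ 2]) := by
  have hC := hF.contDiffOn
  have x1 := hasDerivAt_coord (p.1 1) (d.1 1) 0
  have x2 := hasDerivAt_coord (p.1 2) (d.1 2) 0
  have u0 := hasDerivAt_coord (p.2 0) (d.2 0) 0
  have u1 := hasDerivAt_coord (p.2 1) (d.2 1) 0
  have k0 := fun r : ℝ => hasDerivAt_const (0 : ℝ) r
  have d1 := ((x1.const_mul (2 * F.fxx (p.1 0))).add_const (F.fx (p.1 0)) |>.mul_const (d.1 1)).add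
    ((x2.const_mul (2 * F.fyy (p.1 0))).add_const (F.fy (p.1 0)) |>.mul_const (d.1 2))
  have d2 := ((x1.const_mul (2 * F.sxx (p.1 0))).add_const (F.sx (p.1 0)) |>.mul_const (d.1 1)).add
    ((x2.const_mul (2 * F.syy (p.1 0))).add_const (F.sy (p.1 0)) |>.mul_const (d.1 2))
  have d3 := ((((x1.pow 2).const_mul (F.fxx (p.1 0))).add ((x2.pow 2).const_mul (F.fyy (p.1 0)))).add
    (x1.const_mul (F.fx (p.1 0)))).add (x2.const_mul (F.fy (p.1 0))) |>.add_const (F.f0 (p.1 0))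
  refine Prod.ext (funext fun i => ?_) (funext fun i => ?_)
  · refine comp_second_fderiv_eq hI hC hp (l := indepCoord i) (E := fun q => (F.lin q d).1 i)
      (fun q hq => by rw [hF.fderiv_toVF hI hq]; rfl) ?_
    fin_cases i
    · exact hasDerivAt_of_eq (k0 0) (by simp) fun s => by simp [Fld.lin, hd]
    · exact hasDerivAt_of_eq (k0 (F.α (p.1 0) * d.1 1)) (by simp) fun s => by simp [Fld.lin, hd]
    · exact hasDerivAt_of_eq (k0 (F.β (p.1 0) * d.1 2)) (by simp) fun s => by simp [Fld.lin, hd]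
  · refine comp_second_fderiv_eq hI hC hp (l := depCoord i) (E := fun q => (F.lin q d).2 i)
      (fun q hq => by rw [hF.fderiv_toVF hI hq]; rfl) ?_
    fin_cases i
    · refine hasDerivAt_of_eq (((k0 (F.σ (p.1 0) * d.2 0)).add (d1.mul u1)).add
        (d3.mul_const (d.2 1))) ?_ fun s => by simp [Fld.lin, hd]
      simp
      ring
    · refine hasDerivAt_of_eq (((k0 (F.σ (p.1 0) * d.2 1)).sub (d1.mul u0)).sub
        (d3.mul_const (d.2 0))) ?_ fun s => by simp [Fld.lin, hd]
      simp
      ring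
    · refine hasDerivAt_of_eq ((k0 (F.κ (p.1 0) * d.2 2)).add d2) ?_ fun s => by simp [Fld.lin, hd]
      simp
      ring

/-- The prolonged action of a candidate on the system in a jet of a solution. -/
theorem fderiv_system_symField (hI : IsOpen I) (hc : c.Admissible I) {τ g h m : ℝ → ℝ}
    (hτ : Smooth I τ) (hg : Smooth I g) (hh : Smooth I h) (hm : Smooth I m)
    (hF : F = symField c τ g h m) {j : J2} (hj : j.1 0 ∈ I)
    (hs : system c j = 0) : fderiv ℝ (system c) j (prolong F.toVF j) =
    ![j.2.1 0 * (deriv F.σ (j.1 0) - 2 * (c.p1 (j.1 0) * F.fxx (j.1 0)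
        + c.p2 (j.1 0) * F.fyy (j.1 0))),
      -(j.2.1 1 * (deriv F.σ (j.1 0) - 2 * (c.p1 (j.1 0) * F.fxx (j.1 0)
        + c.p2 (j.1 0) * F.fyy (j.1 0)))),
      j.2.2.2 2 2 2 * (τ (j.1 0) * deriv c.r1 (j.1 0)
          + 2 * c.r1 (j.1 0) * (F.α (j.1 0) - F.β (j.1 0)))
        + 2 * (j.2.2.1 2 0 ^ 2 + j.2.1 0 * j.2.2.2 2 2 0 + j.2.2.1 2 1 ^ 2
            + j.2.1 1 * j.2.2.2 2 2 1)
          * (c.r2 (j.1 0) * (F.κ (j.1 0) - 2 * F.α (j.1 0) - 2 * F.σ (j.1 0) + 2 * F.β (j.1 0))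
            - τ (j.1 0) * deriv c.r2 (j.1 0))
        + 2 * (F.sxx (j.1 0) + c.r1 (j.1 0) * F.syy (j.1 0))] := by
  have sF : F.IsSmooth I := hF ▸ symField_isSmooth hI hc hτ hg hh hm
  have hp1 := hc.p1.2 _ hj
  have hp2 := hc.p2.2 _ hj
  have hq1 := hc.q1.2 _ hj
  have hq2 := hc.q2.2 _ hj
  have hb : j.base ∈ dom I := hj
  rw [fderiv_system_prolong hI hc sF.contDiffOn hj]
  -- The coefficient functions of a candidate solve the determining equations, here without
  -- denominators: `e1` to `e4` for the four coefficients of the Schrödinger equation, `a1` to `a4`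
  -- for the first derivatives in space, `b1` to `b5` for the time derivative of the phase against
  -- the shift of `w`.
  have e1 : deriv c.p1 (j.1 0) * F.τ (j.1 0)
      - c.p1 (j.1 0) * (2 * F.α (j.1 0) - deriv F.τ (j.1 0)) = 0 := by
    simp only [hF, symField, scaleRate]; field_simp; ring
  have e2 : deriv c.p2 (j.1 0) * F.τ (j.1 0)
      - c.p2 (j.1 0) * (2 * F.β (j.1 0) - deriv F.τ (j.1 0)) = 0 := by
    simp only [hF, symField, scaleRate]; field_simp; ring
  have e3 : deriv c.q1 (j.1 0) * F.τ (j.1 0)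
      + c.q1 (j.1 0) * (2 * F.σ (j.1 0) + deriv F.τ (j.1 0)) = 0 := by
    simp only [hF, symField, scaleRate]; field_simp; ring
  have e4 : deriv c.q2 (j.1 0) * F.τ (j.1 0)
      + c.q2 (j.1 0) * (F.κ (j.1 0) + deriv F.τ (j.1 0)) = 0 := by
    simp only [hF, symField, scaleRate]; field_simp; ring
  have a1 : deriv F.α (j.1 0) + 4 * c.p1 (j.1 0) * F.fxx (j.1 0) = 0 := by
    simp only [hF, symField, phaseQuad]; field_simp; ring
  have a2 : deriv F.β (j.1 0) + 4 * c.p2 (j.1 0) * F.fyy (j.1 0) = 0 := by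
    simp only [hF, symField, phaseQuad]; field_simp; ring
  have a3 : deriv F.g (j.1 0) + 2 * c.p1 (j.1 0) * F.fx (j.1 0) = 0 := by
    simp only [hF, symField, phaseLin]; field_simp; ring
  have a4 : deriv F.h (j.1 0) + 2 * c.p2 (j.1 0) * F.fy (j.1 0) = 0 := by
    simp only [hF, symField, phaseLin]; field_simp; ring
  have b1 : deriv F.fxx (j.1 0) - c.q2 (j.1 0) * F.sxx (j.1 0) = 0 := by
    simp only [hF, symField]; field_simp; ring
  have b2 : deriv F.fyy (j.1 0) - c.q2 (j.1 0) * F.syy (j.1 0) = 0 := by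
    simp only [hF, symField]; field_simp; ring
  have b3 : deriv F.fx (j.1 0) - c.q2 (j.1 0) * F.sx (j.1 0) = 0 := by
    simp only [hF, symField]; field_simp; ring
  have b4 : deriv F.fy (j.1 0) - c.q2 (j.1 0) * F.sy (j.1 0) = 0 := by
    simp only [hF, symField]; field_simp; ring
  have b5 : deriv F.f0 (j.1 0) - c.q2 (j.1 0) * F.s0 (j.1 0) = 0 := by
    simp only [hF, symField]; field_simp; ring
  have hτ0 : τ (j.1 0) = F.τ (j.1 0) := by rw [hF]; rfl
  have s0 := congrFun hs 0
  have s1 := congrFun hs 1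
  have s2 := congrFun hs 2
  simp [system] at s0 s1 s2
  have A : ∀ i a, prolA F.toVF j i a = (F.lin j.base (j.dir i)).2 a
      - ∑ l, (F.lin j.base (j.dir i)).1 l * j.2.2.1 l a := by
    intro i a
    rw [prolA, sF.fderiv_toVF hI hb]
  have B : ∀ i a, prolB F.toVF j i a = (fderiv ℝ (fderiv ℝ F.toVF) j.base (j.dir i) (j.dir i)).2 a
    + (F.lin j.base (0, j.2.2.2 i i)).2 a
    - ∑ l, ((fderiv ℝ (fderiv ℝ F.toVF) j.base (j.dir i) (j.dir i)).1 l
        + (F.lin j.base (0, j.2.2.2 i i)).1 l) * j.2.2.1 l a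
    - 2 * ∑ l, (F.lin j.base (j.dir i)).1 l * j.2.2.2 i l a := by
    intro i a
    rw [prolB, sF.fderiv_toVF hI hb, sF.fderiv_toVF hI hb]
  have d1 : (j.dir 1).1 0 = 0 := by simp [J2.dir]
  have d2 : (j.dir 2).1 0 = 0 := by simp [J2.dir]
  simp only [A, B]
  rw [sF.second_fderiv_toVF hI hb d1, sF.second_fderiv_toVF hI hb d2]
  clear A B
  simp [Fld.lin, Fld.toVF, J2.dir, J2.base, Fin.sum_univ_three]
  rw [hτ0]
  refine ⟨?_, ?_, ?_⟩
  -- On the Schrödinger equation the field acts by scaling with `σ - τ'` and rotating with the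
  -- phase; these are the multipliers of `s0` and `s1`, which vanish on the solution surface.
  · linear_combination j.2.2.2 1 1 1 * e1 + j.2.2.2 2 2 1 * e2
      - j.2.1 1 * (j.2.1 0 ^ 2 + j.2.1 1 ^ 2) * e3 - j.2.1 1 * j.2.1 2 * e4
      - j.1 1 * j.2.2.1 1 0 * a1 - j.1 2 * j.2.2.1 2 0 * a2 - j.2.2.1 1 0 * a3 - j.2.2.1 2 0 * a4
      + j.2.1 1 * (j.1 1 ^ 2 * b1 + j.1 2 ^ 2 * b2 + j.1 1 * b3 + j.1 2 * b4 + b5)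
      + (F.σ (j.1 0) - deriv F.τ (j.1 0)) * s0
      - (F.fxx (j.1 0) * j.1 1 ^ 2 + F.fyy (j.1 0) * j.1 2 ^ 2
        + F.fx (j.1 0) * j.1 1 + F.fy (j.1 0) * j.1 2 + F.f0 (j.1 0)) * s1
  · linear_combination j.2.2.2 1 1 0 * e1 + j.2.2.2 2 2 0 * e2
      - j.2.1 0 * (j.2.1 0 ^ 2 + j.2.1 1 ^ 2) * e3 - j.2.1 0 * j.2.1 2 * e4
      + j.1 1 * j.2.2.1 1 1 * a1 + j.1 2 * j.2.2.1 2 1 * a2 + j.2.2.1 1 1 * a3 + j.2.2.1 2 1 * a4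
      + j.2.1 0 * (j.1 1 ^ 2 * b1 + j.1 2 ^ 2 * b2 + j.1 1 * b3 + j.1 2 * b4 + b5)
      + (F.σ (j.1 0) - deriv F.τ (j.1 0)) * s1
      + (F.fxx (j.1 0) * j.1 1 ^ 2 + F.fyy (j.1 0) * j.1 2 ^ 2
        + F.fx (j.1 0) * j.1 1 + F.fy (j.1 0) * j.1 2 + F.f0 (j.1 0)) * s0
  · linear_combination (F.κ (j.1 0) - 2 * F.α (j.1 0)) * s2

end

/-! ### The conditions on the time component. -/

/-- The conditions on the time component `τ` of a symmetry. -/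
structure TimeCond (c : Coeffs) (τ : ℝ → ℝ) (t : ℝ) : Prop where
  phase : deriv (scaleRate c.p1 τ) t + deriv (scaleRate c.p2 τ) t = 2 * deriv (scaleRate c.q1 τ) t
  space : τ t * deriv c.r1 t + 2 * c.r1 t * (scaleRate c.p1 τ t - scaleRate c.p2 τ t) = 0
  source : τ t * deriv c.r2 t + 2 * c.r2 t * (scaleRate c.q2 τ t + scaleRate c.p1 τ t
    - scaleRate c.q1 τ t - scaleRate c.p2 τ t) = 0
  shift : deriv (fun s => deriv (scaleRate c.p1 τ) s / c.p1 s) t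
    + c.r1 t * deriv (fun s => deriv (scaleRate c.p2 τ) s / c.p2 s) t = 0

section
variable {I : Set ℝ} {c : Coeffs} {V W V' W' : VF} {F : Fld} {p : J0}

theorem EqVF.eventuallyEq (hI : IsOpen I) (h : EqVF I V W) (hp : p ∈ dom I) : V =ᶠ[nhds p] W := by
  filter_upwards [dom_mem_nhds hI hp] with q hq using h hq

/-- Being a symmetry depends on the vector field over `I` only. -/
theorem IsSymmetry.congr (hI : IsOpen I) (hc : c.Admissible I) (hV : IsSymmetry I c V)
    (h : EqVF I V W) : IsSymmetry I c W := by
  have hW : ContDiffOn ℝ ∞ W (dom I) := hV.1.congr fun q hq => (h hq).symm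
  refine ⟨hW, fun j hj ht hs => ?_⟩
  have hb : j.base ∈ dom I := ht
  have e := hV.2 j hj ht hs
  have h1 := h.eventuallyEq hI hb
  have h2 := h1.fderiv (𝕜 := ℝ)
  rw [fderiv_system_prolong hI hc hV.1 ht] at e
  rw [fderiv_system_prolong hI hc hW ht, ← e]
  simp only [prolA, prolB, h1.eq_of_nhds, h2.eq_of_nhds, h2.fderiv_eq]

theorem bracket_congr (hI : IsOpen I) (h : EqVF I V V') (h' : EqVF I W W') :
    EqVF I (bracket V W) (bracket V' W') := by
  intro q hq
  have h1 := h.eventuallyEq hI hq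
  have h2 := h'.eventuallyEq hI hq
  simp only [bracket, VectorField.lieBracket, h1.eq_of_nhds, h2.eq_of_nhds, h1.fderiv_eq,
    h2.fderiv_eq]

theorem deriv_phaseQuad_eq (f τ : ℝ → ℝ) (t : ℝ) :
    deriv (phaseQuad f τ) t = -(1 / 4) * deriv (fun s => deriv (scaleRate f τ) s / f s) t := by
  rw [← deriv_const_mul_field]
  congr 1
  funext s
  rw [phaseQuad, mul_comm 4 (f s), ← div_div]
  ring

/-- A candidate is a symmetry if and only if its time component satisfies the time conditions. -/
theorem symField_isSymmetry_iff (hI : IsOpen I) (hc : c.Admissible I) {τ g h m : ℝ → ℝ}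
    (hτ : Smooth I τ) (hg : Smooth I g) (hh : Smooth I h) (hm : Smooth I m) :
    IsSymmetry I c (symField c τ g h m).toVF ↔ ∀ t ∈ I, TimeCond c τ t := by
  have sF : (symField c τ g h m).IsSmooth I := symField_isSmooth hI hc hτ hg hh hm
  have key := fun (j : J2) (hj : j.1 0 ∈ I) (hs : system c j = 0) =>
    fderiv_system_symField (F := symField c τ g h m) hI hc hτ hg hh hm rfl hj hs
  have x1 : ∀ t ∈ I, deriv (symField c τ g h m).σ t - 2 * (c.p1 t * (symField c τ g h m).fxx t
      + c.p2 t * (symField c τ g h m).fyy t) = (1 / 2) * (deriv (scaleRate c.p1 τ) t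
      + deriv (scaleRate c.p2 τ) t - 2 * deriv (scaleRate c.q1 τ) t) := by
    intro t ht
    have hp1 := hc.p1.2 t ht
    have hp2 := hc.p2.2 t ht
    simp only [symField, phaseQuad, deriv.fun_neg]
    field_simp
    ring
  have x2 : ∀ t ∈ I, (symField c τ g h m).sxx t + c.r1 t * (symField c τ g h m).syy t
      = -(1 / (4 * c.q2 t)) * (deriv (fun s => deriv (scaleRate c.p1 τ) s / c.p1 s) t
        + c.r1 t * deriv (fun s => deriv (scaleRate c.p2 τ) s / c.p2 s) t) := by
    intro t ht
    have hq2 := hc.q2.2 t ht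
    simp only [symField, deriv_phaseQuad_eq]
    field_simp
    ring
  constructor
  · intro hV t ht
    have hq2 := hc.q2.2 t ht
    -- Solution jets in which only `u`, `w_yy`, `u_y` are prescribed; `v_t` and `w_xx` solve the
    -- system. The triples `(1,0,0)`, `(0,0,0)`, `(0,1,0)`, `(0,0,1)` give `phase`, `shift`, `space`
    -- and `source` in turn.
    let J : ℝ → ℝ → ℝ → J2 := fun u wyy uy =>
      mkJet (Pi.single 0 t, ![u, 0, 0]) ![0, -(c.q1 t * u ^ 3), 0] 0 ![uy, 0, 0] 0 0
          ![0, 0, -(c.r1 t * wyy) + 2 * c.r2 t * uy ^ 2] 0 ![0, 0, wyy]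
    have ht0 : ∀ u wyy uy, (J u wyy uy).1 0 = t := by simp [J, mkJet]
    have jet : ∀ u wyy uy : ℝ, system c (J u wyy uy) = 0 := by
      intro u wyy uy
      funext i
      fin_cases i <;> simp [J, system, mkJet] <;> ring
    have val := fun u wyy uy : ℝ =>
      (key (J u wyy uy) (by simpa [ht0] using ht) (jet u wyy uy)).symm.trans
        (hV.2 _ (isJet_mkJet _ _ _ _ _ _ _ _ _) (by simpa [ht0] using ht) (jet u wyy uy))
    have v1 := congrFun (val 1 0 0) 0
    have v2 := congrFun (val 0 0 0) 2
    have v3 := congrFun (val 0 1 0) 2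
    have v4 := congrFun (val 0 0 1) 2
    simp only [ht0, x1 t ht, x2 t ht] at v1 v2 v3 v4
    simp [J, mkJet] at v1 v2 v3 v4
    have w2 := v2.resolve_left hq2
    rw [w2] at v3 v4
    refine ⟨by linarith, ?_, ?_, w2⟩
    · simp only [symField] at v3
      linarith
    · simp only [symField] at v4
      linarith
  · intro hC
    refine ⟨sF.contDiffOn, fun j _ hj hs => ?_⟩
    have hC := hC _ hj
    rw [key j hj hs, x1 _ hj, x2 _ hj]
    have c1 := hC.phase
    have c2 := hC.space
    have c3 := hC.source
    have c4 := hC.shift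
    funext i
    fin_cases i
    · simp
      right
      linarith
    · simp
      right
      linarith
    · simp only [symField]
      simp
      rw [c4]
      linear_combination j.2.2.2 2 2 2 * c2 - 2 * (j.2.2.1 2 0 ^ 2 + j.2.1 0 * j.2.2.2 2 2 0
        + j.2.2.1 2 1 ^ 2 + j.2.1 1 * j.2.2.2 2 2 1) * c3

theorem IsSymmetry.exists_symField (hI : IsOpen I) (hc : c.Admissible I) (hV : IsSymmetry I c V) :
    ∃ τ g h m : ℝ → ℝ, Smooth I τ ∧ Smooth I g ∧ Smooth I h ∧ Smooth I m ∧
      EqVF I V (symField c τ g h m).toVF ∧ ∀ t ∈ I, TimeCond c τ t := by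
  obtain ⟨τ, g, h, m, hτ, hg, hh, hm, he⟩ := hV.eq_symField hI hc
  exact ⟨τ, g, h, m, hτ, hg, hh, hm, he,
    (symField_isSymmetry_iff hI hc hτ hg hh hm).1 (hV.congr hI hc he)⟩

end

/-! ### Commutators of candidates. -/

section
variable {I : Set ℝ} {c : Coeffs} {f g₁ g₂ h₁ h₂ m₁ m₂ τ₁ τ₂ : ℝ → ℝ} {t : ℝ}

/-- Lets identities known only on `I` be differentiated although `deriv` refers to functions on the
whole line; openness of `I` is what makes this legitimate. -/
theorem deriv_eq_of_eqOn (hI : IsOpen I) {f g : ℝ → ℝ} (h : ∀ t ∈ I, f t = g t) (ht : t ∈ I) :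
    deriv f t = deriv g t := by
  refine Filter.EventuallyEq.deriv_eq ?_
  filter_upwards [hI.mem_nhds ht] with s hs using h s hs

theorem Smooth.phaseQuad (hI : IsOpen I) (hf : SmoothNZ I f) (hτ : Smooth I τ₁) :
    Smooth I (phaseQuad f τ₁) :=
  (((Smooth.scaleRate hI hf hτ).deriv hI).div (hf.const_mul (a := 4) (by norm_num))).neg

theorem Smooth.phaseLin (hI : IsOpen I) (hf : SmoothNZ I f) (hg : Smooth I g₁) :
    Smooth I (phaseLin f g₁) :=
  ((hg.deriv hI).div (hf.const_mul (a := 2) (by norm_num))).neg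

/-- The commutator of the time components. -/
noncomputable def timeComm (τ₁ τ₂ : ℝ → ℝ) (t : ℝ) : ℝ := τ₁ t * deriv τ₂ t - τ₂ t * deriv τ₁ t

/-- The commutator of the translation components in a space variable. -/
noncomputable def spaceComm (f τ₁ τ₂ g₁ g₂ : ℝ → ℝ) (t : ℝ) : ℝ :=
  τ₁ t * deriv g₂ t - τ₂ t * deriv g₁ t + g₁ t * scaleRate f τ₂ t - g₂ t * scaleRate f τ₁ t

/-- The commutator of the phase components. -/
noncomputable def phaseComm (c : Coeffs) (τ₁ τ₂ g₁ g₂ h₁ h₂ m₁ m₂ : ℝ → ℝ) (t : ℝ) : ℝ :=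
  τ₁ t * deriv m₂ t - τ₂ t * deriv m₁ t + (g₁ t * phaseLin c.p1 g₂ t - g₂ t * phaseLin c.p1 g₁ t
    + h₁ t * phaseLin c.p2 h₂ t - h₂ t * phaseLin c.p2 h₁ t)

theorem Smooth.timeComm (hI : IsOpen I) (h₁ : Smooth I τ₁) (h₂ : Smooth I τ₂) :
    Smooth I (timeComm τ₁ τ₂) := (h₁.mul (h₂.deriv hI)).sub (h₂.mul (h₁.deriv hI))

theorem deriv_timeComm (hI : IsOpen I) (h₁ : Smooth I τ₁) (h₂ : Smooth I τ₂) (ht : t ∈ I) :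
    deriv (timeComm τ₁ τ₂) t = τ₁ t * deriv (deriv τ₂) t - τ₂ t * deriv (deriv τ₁) t := by
  have := ((h₁.hasDerivAt hI ht).mul ((h₂.deriv hI).hasDerivAt hI ht)).sub
    ((h₂.hasDerivAt hI ht).mul ((h₁.deriv hI).hasDerivAt hI ht))
  refine (this.congr_deriv ?_ : HasDerivAt (timeComm τ₁ τ₂) _ t).deriv
  ring

theorem deriv_scaleRate (hI : IsOpen I) (hf : SmoothNZ I f) (h₁ : Smooth I τ₁) (ht : t ∈ I) :
    deriv (scaleRate f τ₁) t = (deriv (deriv τ₁) t + deriv τ₁ t * (deriv f t / f t)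
      + τ₁ t * deriv (fun s => deriv f s / f s) t) / 2 := by
  have hl : Smooth I (fun s => deriv f s / f s) := (hf.1.deriv hI).div hf
  have := ((((h₁.deriv hI).hasDerivAt hI ht).add
    ((h₁.hasDerivAt hI ht).mul (hl.hasDerivAt hI ht))).div_const 2)
  refine (this.congr_deriv ?_ : HasDerivAt (scaleRate f τ₁) _ t).deriv
  ring

/-- The scale rate is half of `(f τ)' / f`, the divergence of `τ ∂_t` with weight `f`, and a
divergence is a cocycle for the commutator. -/
theorem scaleRate_timeComm (hI : IsOpen I) (hf : SmoothNZ I f) (h₁ : Smooth I τ₁)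
    (h₂ : Smooth I τ₂) (ht : t ∈ I) : scaleRate f (timeComm τ₁ τ₂) t
      = τ₁ t * deriv (scaleRate f τ₂) t - τ₂ t * deriv (scaleRate f τ₁) t := by
  rw [deriv_scaleRate hI hf h₁ ht, deriv_scaleRate hI hf h₂ ht]
  simp only [scaleRate]
  rw [deriv_timeComm hI h₁ h₂ ht]
  simp only [timeComm]
  ring

theorem deriv_phaseQuad (hI : IsOpen I) (hf : SmoothNZ I f) (h₁ : Smooth I τ₁) (ht : t ∈ I) :
    deriv (phaseQuad f τ₁) t = -(deriv (deriv (scaleRate f τ₁)) t / (4 * f t))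
      + deriv (scaleRate f τ₁) t * deriv f t / (4 * f t ^ 2) := by
  have hn := hf.2 t ht
  have := ((((Smooth.scaleRate hI hf h₁).deriv hI).hasDerivAt hI ht).div
    ((hf.1.hasDerivAt hI ht).const_mul 4) (by simpa using hn)).neg
  refine (this.congr_deriv ?_ : HasDerivAt (phaseQuad f τ₁) _ t).deriv
  field_simp
  ring

theorem deriv_phaseLin (hI : IsOpen I) (hf : SmoothNZ I f) (h₁ : Smooth I g₁) (ht : t ∈ I) :
    deriv (phaseLin f g₁) t = -(deriv (deriv g₁) t / (2 * f t))
      + deriv g₁ t * deriv f t / (2 * f t ^ 2) := by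
  have hn := hf.2 t ht
  have := (((h₁.deriv hI).hasDerivAt hI ht).div
    ((hf.1.hasDerivAt hI ht).const_mul 2) (by simpa using hn)).neg
  refine (this.congr_deriv ?_ : HasDerivAt (phaseLin f g₁) _ t).deriv
  field_simp
  ring

/-- Derivative of the cocycle identity of the scale rate, divided by `-4 f`. The terms with `τ'` and
`f'` combine into the weight `2 scaleRate`, which is also the weight with which the field scales
`x²`. -/
theorem phaseQuad_timeComm (hI : IsOpen I) (hf : SmoothNZ I f) (h₁ : Smooth I τ₁)
    (h₂ : Smooth I τ₂) (ht : t ∈ I) : phaseQuad f (timeComm τ₁ τ₂) t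
      = τ₁ t * deriv (phaseQuad f τ₂) t - τ₂ t * deriv (phaseQuad f τ₁) t
        + (2 * scaleRate f τ₁ t * phaseQuad f τ₂ t - 2 * scaleRate f τ₂ t * phaseQuad f τ₁ t) := by
  have hn := hf.2 t ht
  have s₁ := Smooth.scaleRate hI hf h₁
  have s₂ := Smooth.scaleRate hI hf h₂
  have e : deriv (scaleRate f (timeComm τ₁ τ₂)) t = deriv τ₁ t * deriv (scaleRate f τ₂) t
      + τ₁ t * deriv (deriv (scaleRate f τ₂)) t - (deriv τ₂ t * deriv (scaleRate f τ₁) t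
      + τ₂ t * deriv (deriv (scaleRate f τ₁)) t) := by
    rw [deriv_eq_of_eqOn hI (fun s hs => scaleRate_timeComm hI hf h₁ h₂ hs) ht]
    exact (((h₁.hasDerivAt hI ht).mul ((s₂.deriv hI).hasDerivAt hI ht)).sub
      ((h₂.hasDerivAt hI ht).mul ((s₁.deriv hI).hasDerivAt hI ht))).deriv
  rw [deriv_phaseQuad hI hf h₁ ht, deriv_phaseQuad hI hf h₂ ht]
  simp only [phaseQuad]
  rw [e]
  simp only [scaleRate]
  field_simp
  ring

theorem phaseLin_spaceComm (hI : IsOpen I) (hf : SmoothNZ I f) (h₁ : Smooth I τ₁)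
    (h₂ : Smooth I τ₂) (k₁ : Smooth I g₁) (k₂ : Smooth I g₂) (ht : t ∈ I) :
    phaseLin f (spaceComm f τ₁ τ₂ g₁ g₂) t
      = τ₁ t * deriv (phaseLin f g₂) t - τ₂ t * deriv (phaseLin f g₁) t
        + (scaleRate f τ₁ t * phaseLin f g₂ t - scaleRate f τ₂ t * phaseLin f g₁ t
          + 2 * g₁ t * phaseQuad f τ₂ t - 2 * g₂ t * phaseQuad f τ₁ t) := by
  have hn := hf.2 t ht
  have s₁ := Smooth.scaleRate hI hf h₁
  have s₂ := Smooth.scaleRate hI hf h₂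
  have e : deriv (spaceComm f τ₁ τ₂ g₁ g₂) t = _ :=
    (((((h₁.hasDerivAt hI ht).mul ((k₂.deriv hI).hasDerivAt hI ht)).sub
      ((h₂.hasDerivAt hI ht).mul ((k₁.deriv hI).hasDerivAt hI ht))).add
      ((k₁.hasDerivAt hI ht).mul (s₂.hasDerivAt hI ht))).sub
      ((k₂.hasDerivAt hI ht).mul (s₁.hasDerivAt hI ht))).deriv
  rw [deriv_phaseLin hI hf k₁ ht, deriv_phaseLin hI hf k₂ ht]
  simp only [phaseLin, phaseQuad]
  rw [e]
  simp only [scaleRate]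
  field_simp
  ring

/-- The commutator formula for the shift of `w` which accompanies a term of the phase. -/
theorem shift_comm (hI : IsOpen I) (hf : SmoothNZ I f) (h₁ : Smooth I τ₁) (h₂ : Smooth I τ₂)
    {φ φ₁ φ₂ R : ℝ → ℝ} (k₁ : Smooth I φ₁) (k₂ : Smooth I φ₂)
    (hφ : ∀ s ∈ I, φ s = τ₁ s * deriv φ₂ s - τ₂ s * deriv φ₁ s + R s) {R' : ℝ} (ht : t ∈ I)
    (hR : HasDerivAt R R' t) :
    deriv φ t / f t = τ₁ t * deriv (fun s => deriv φ₂ s / f s) t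
      - τ₂ t * deriv (fun s => deriv φ₁ s / f s) t
      + -(2 * scaleRate f τ₂ t) * (deriv φ₁ t / f t) - -(2 * scaleRate f τ₁ t) * (deriv φ₂ t / f t)
      + R' / f t := by
  have hn := hf.2 t ht
  have e : deriv φ t = _ := (deriv_eq_of_eqOn hI hφ ht).trans
    ((((h₁.hasDerivAt hI ht).mul ((k₂.deriv hI).hasDerivAt hI ht)).sub
      ((h₂.hasDerivAt hI ht).mul ((k₁.deriv hI).hasDerivAt hI ht))).add hR).deriv
  have e₁ : deriv (fun s => deriv φ₁ s / f s) t = _ :=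
    (((k₁.deriv hI).hasDerivAt hI ht).div (hf.1.hasDerivAt hI ht) hn).deriv
  have e₂ : deriv (fun s => deriv φ₂ s / f s) t = _ :=
    (((k₂.deriv hI).hasDerivAt hI ht).div (hf.1.hasDerivAt hI ht) hn).deriv
  rw [e, e₁, e₂]
  simp only [scaleRate]
  field_simp
  ring

/-- The candidates are closed under commutators. -/
theorem bracket_symField (hI : IsOpen I) (hc : c.Admissible I)
    (hτ₁ : Smooth I τ₁) (hg₁ : Smooth I g₁) (hh₁ : Smooth I h₁) (hm₁ : Smooth I m₁)
    (hτ₂ : Smooth I τ₂) (hg₂ : Smooth I g₂) (hh₂ : Smooth I h₂) (hm₂ : Smooth I m₂) :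
    EqVF I (bracket (symField c τ₁ g₁ h₁ m₁).toVF (symField c τ₂ g₂ h₂ m₂).toVF)
      (symField c (timeComm τ₁ τ₂) (spaceComm c.p1 τ₁ τ₂ g₁ g₂) (spaceComm c.p2 τ₁ τ₂ h₁ h₂)
        (phaseComm c τ₁ τ₂ g₁ g₂ h₁ h₂ m₁ m₂)).toVF := by
  intro p hp
  have hp' : p.1 0 ∈ I := hp
  have sF₁ := symField_isSmooth hI hc hτ₁ hg₁ hh₁ hm₁
  have sF₂ := symField_isSmooth hI hc hτ₂ hg₂ hh₂ hm₂
  simp only [bracket, VectorField.lieBracket]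
  rw [sF₁.fderiv_toVF hI hp, sF₂.fderiv_toVF hI hp]
  have a₁ := scaleRate_timeComm hI hc.p1 hτ₁ hτ₂ hp'
  have a₂ := scaleRate_timeComm hI hc.p2 hτ₁ hτ₂ hp'
  have a₃ := scaleRate_timeComm hI hc.q1 hτ₁ hτ₂ hp'
  have a₄ := scaleRate_timeComm hI hc.q2 hτ₁ hτ₂ hp'
  have b₁ := phaseQuad_timeComm hI hc.p1 hτ₁ hτ₂ hp'
  have b₂ := phaseQuad_timeComm hI hc.p2 hτ₁ hτ₂ hp'
  have b₃ := phaseLin_spaceComm hI hc.p1 hτ₁ hτ₂ hg₁ hg₂ hp'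
  have b₄ := phaseLin_spaceComm hI hc.p2 hτ₁ hτ₂ hh₁ hh₂ hp'
  have D : ∀ {f : ℝ → ℝ}, Smooth I f → HasDerivAt f (deriv f (p.1 0)) (p.1 0) :=
    fun hf => hf.hasDerivAt hI hp'
  have α₁ := Smooth.scaleRate hI hc.p1 hτ₁
  have α₂ := Smooth.scaleRate hI hc.p1 hτ₂
  have β₁ := Smooth.scaleRate hI hc.p2 hτ₁
  have β₂ := Smooth.scaleRate hI hc.p2 hτ₂
  have A₁ := Smooth.phaseQuad hI hc.p1 hτ₁
  have A₂ := Smooth.phaseQuad hI hc.p1 hτ₂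
  have B₁ := Smooth.phaseQuad hI hc.p2 hτ₁
  have B₂ := Smooth.phaseQuad hI hc.p2 hτ₂
  have C₁ := Smooth.phaseLin hI hc.p1 hg₁
  have C₂ := Smooth.phaseLin hI hc.p1 hg₂
  have E₁ := Smooth.phaseLin hI hc.p2 hh₁
  have E₂ := Smooth.phaseLin hI hc.p2 hh₂
  -- Derivatives of scale rates and translations are rewritten through the phase coefficients. The
  -- products which arise in `s₁` to `s₅` from differentiating the lower order terms then cancel by
  -- antisymmetry.
  have q : ∀ {f τ : ℝ → ℝ}, SmoothNZ I f →
      deriv (scaleRate f τ) (p.1 0) = -(4 * f (p.1 0) * phaseQuad f τ (p.1 0)) := by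
    intro f τ hf
    have := hf.2 _ hp'
    simp only [phaseQuad]
    field_simp
  have l : ∀ {f g : ℝ → ℝ}, SmoothNZ I f →
      deriv g (p.1 0) = -(2 * f (p.1 0) * phaseLin f g (p.1 0)) := by
    intro f g hf
    have := hf.2 _ hp'
    simp only [phaseLin]
    field_simp
  have s₁ := shift_comm hI hc.q2 hτ₁ hτ₂ A₁ A₂
    (fun s hs => phaseQuad_timeComm hI hc.p1 hτ₁ hτ₂ hs) hp'
    ((((D α₁).const_mul 2).mul (D A₂)).sub (((D α₂).const_mul 2).mul (D A₁)))
  have s₂ := shift_comm hI hc.q2 hτ₁ hτ₂ B₁ B₂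
    (fun s hs => phaseQuad_timeComm hI hc.p2 hτ₁ hτ₂ hs) hp'
    ((((D β₁).const_mul 2).mul (D B₂)).sub (((D β₂).const_mul 2).mul (D B₁)))
  have s₃ := shift_comm hI hc.q2 hτ₁ hτ₂ C₁ C₂
    (fun s hs => phaseLin_spaceComm hI hc.p1 hτ₁ hτ₂ hg₁ hg₂ hs) hp'
    (((((D α₁).mul (D C₂)).sub ((D α₂).mul (D C₁))).add (((D hg₁).const_mul 2).mul (D A₂))).sub
      (((D hg₂).const_mul 2).mul (D A₁)))
  have s₄ := shift_comm hI hc.q2 hτ₁ hτ₂ E₁ E₂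
    (fun s hs => phaseLin_spaceComm hI hc.p2 hτ₁ hτ₂ hh₁ hh₂ hs) hp'
    (((((D β₁).mul (D E₂)).sub ((D β₂).mul (D E₁))).add (((D hh₁).const_mul 2).mul (D B₂))).sub
      (((D hh₂).const_mul 2).mul (D B₁)))
  have s₅ := shift_comm (φ := phaseComm c τ₁ τ₂ g₁ g₂ h₁ h₂ m₁ m₂) hI hc.q2 hτ₁ hτ₂ hm₁ hm₂
    (fun s _ => rfl) hp' (((((D hg₁).mul (D C₂)).sub ((D hg₂).mul (D C₁))).add
      ((D hh₁).mul (D E₂))).sub ((D hh₂).mul (D E₁)))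
  simp only [q hc.p1, q hc.p2, l (g := g₁) hc.p1, l (g := g₂) hc.p1, l (g := h₁) hc.p2,
    l (g := h₂) hc.p2] at s₁ s₂ s₃ s₄ s₅
  refine Prod.ext (funext fun i => ?_) (funext fun i => ?_)
  · fin_cases i
    · simp [Fld.lin, Fld.toVF, symField, timeComm]
      ring
    · simp [Fld.lin, Fld.toVF, symField, spaceComm]
      rw [a₁]
      ring
    · simp [Fld.lin, Fld.toVF, symField, spaceComm]
      rw [a₂]
      ring
  · fin_cases i
    · simp [Fld.lin, Fld.toVF, symField, deriv.fun_neg]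
      rw [a₃, b₁, b₂, b₃, b₄, phaseComm]
      ring
    · simp [Fld.lin, Fld.toVF, symField, deriv.fun_neg]
      rw [a₃, b₁, b₂, b₃, b₄, phaseComm]
      ring
    · simp [Fld.lin, Fld.toVF, symField, deriv.fun_neg]
      rw [a₄, s₁, s₂, s₃, s₄, s₅]
      ring

end

/-! ### Functions of time satisfying the Witt relations. -/

section
variable {I : Set ℝ} {c : Coeffs} {f g τ : ℝ → ℝ} {t : ℝ}

theorem exists_const_of_hasDerivAt_zero (hI : IsOpen I) (hconn : IsConnected I)
    (h : ∀ t ∈ I, HasDerivAt f 0 t) : ∃ k, ∀ t ∈ I, f t = k :=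
  hI.exists_is_const_of_deriv_eq_zero hconn.isPreconnected
    (fun t ht => (h t ht).differentiableAt.differentiableWithinAt) fun t ht => (h t ht).deriv

/-- The logarithmic derivative of a coefficient. -/
noncomputable def logRate (f : ℝ → ℝ) (t : ℝ) : ℝ := deriv f t / f t

theorem Smooth.logRate (hI : IsOpen I) (hf : SmoothNZ I f) : Smooth I (logRate f) :=
  (hf.1.deriv hI).div hf

/-- The `τ''` terms from the scale rate and from the division by `f` cancel. Hence `shift` has
exactly the shape treated by `WittTimes.leading_eq_zero`, and it drops to first order once its
leading coefficient is zero. -/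
theorem deriv_shift (hI : IsOpen I) (hf : SmoothNZ I f) (hτ : Smooth I τ) (ht : t ∈ I) :
    deriv (fun s => deriv (scaleRate f τ) s / f s) t = 1 / (2 * f t) * (deriv (deriv (deriv τ)) t
      + (2 * deriv (logRate f) t - logRate f t ^ 2) * deriv τ t
      + (deriv (deriv (logRate f)) t - logRate f t * deriv (logRate f) t) * τ t) := by
  have hn := hf.2 t ht
  have sl := Smooth.logRate hI hf
  have hτ' := hτ.deriv hI
  have e₁ : ∀ s ∈ I, deriv (scaleRate f τ) s = (deriv (deriv τ) s + deriv τ s * logRate f s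
      + τ s * deriv (logRate f) s) / 2 := fun s hs => deriv_scaleRate hI hf hτ hs
  have e₂ : deriv (deriv (scaleRate f τ)) t = _ := (deriv_eq_of_eqOn hI e₁ ht).trans
    (((((hτ'.deriv hI).hasDerivAt hI ht).add ((hτ'.hasDerivAt hI ht).mul
      (sl.hasDerivAt hI ht))).add ((hτ.hasDerivAt hI ht).mul
      ((sl.deriv hI).hasDerivAt hI ht))).div_const 2).deriv
  have e₃ : deriv (fun s => deriv (scaleRate f τ) s / f s) t = _ :=
    ((((Smooth.scaleRate hI hf hτ).deriv hI).hasDerivAt hI ht).div (hf.1.hasDerivAt hI ht) hn).deriv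
  have e₄ : deriv f t = f t * logRate f t := by
    simp only [logRate]
    field_simp
  rw [e₃, e₂, e₁ t ht, e₄]
  field_simp
  ring

/-- Functions on `I` which satisfy the relations of the centerless Virasoro algebra with respect to
the commutator of time components. -/
structure WittTimes (I : Set ℝ) (τ : ℤ → ℝ → ℝ) : Prop where
  smooth : ∀ n, Smooth I (τ n)
  comm : ∀ m n, ∀ t ∈ I, timeComm (τ m) (τ n) t = ((m - n : ℤ) : ℝ) * τ (m + n) t

variable {T : ℤ → ℝ → ℝ}

/-- The automorphism `L n ↦ -L (-n)` of the Witt algebra exchanges the roles of `T (-1)` and `T 1`.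
-/
theorem WittTimes.reflect (hT : WittTimes I T) : WittTimes I (fun n t => -T (-n) t) := by
  refine ⟨fun n => (hT.smooth _).neg, fun m n t ht => ?_⟩
  have := hT.comm (-m) (-n) t ht
  rw [show -(m + n) = -m + -n by ring]
  simp only [timeComm, deriv.fun_neg] at this ⊢
  push_cast at this ⊢
  linear_combination this

/-- Either all functions vanish identically or the first three have no common zero. -/
theorem WittTimes.dichotomy (hI : IsOpen I) (hconn : IsConnected I) (hT : WittTimes I T) :
    (∀ n, ∀ t ∈ I, T n t = 0) ∨ ∀ t ∈ I, T (-1) t ≠ 0 ∨ T 1 t ≠ 0 := by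
  have eh : ∀ t ∈ I, timeComm (T (-1)) (T 0) t = -T (-1) t := fun t ht => by
    simpa using hT.comm (-1) 0 t ht
  have hf : ∀ t ∈ I, timeComm (T 0) (T 1) t = -T 1 t := fun t ht => by
    simpa using hT.comm 0 1 t ht
  have ef : ∀ t ∈ I, timeComm (T (-1)) (T 1) t = -(2 * T 0 t) := fun t ht => by
    have := hT.comm (-1) 1 t ht
    norm_num at this
    linarith
  -- The Casimir element of the `sl₂` spanned by the indices `-1, 0, 1` vanishes for vector fields
  -- on a line.
  have cas : ∀ t ∈ I, T 0 t ^ 2 = T (-1) t * T 1 t := by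
    intro t ht
    have h1 := eh t ht
    have h2 := hf t ht
    have h3 := ef t ht
    simp only [timeComm] at h1 h2 h3
    linear_combination -(1 / 2) * T 1 t * h1 - (1 / 2) * T (-1) t * h2 + (1 / 2) * T 0 t * h3
  set U : Set ℝ := {t | t ∈ I ∧ T (-1) t = 0 ∧ T 0 t = 0 ∧ T 1 t = 0} with hU
  set W : Set ℝ := {t | t ∈ I ∧ ¬(T (-1) t = 0 ∧ T 0 t = 0 ∧ T 1 t = 0)} with hW
  have cont : ∀ {f : ℝ → ℝ}, Smooth I f → ∀ t ∈ I, ContinuousAt f t := fun hf t ht =>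
    (hf.hasDerivAt hI ht).continuousAt
  -- At a common zero the differentiated relations make the three derivatives vanish too, since the
  -- derivative of `timeComm` has no first derivatives in it. Nearby all three derivatives are below
  -- `1/4`, and the relations bound the functions by proper fractions of one another, so they vanish
  -- nearby.
  have oU : IsOpen U := by
    rw [isOpen_iff_mem_nhds]
    rintro t ⟨ht, he, hh, hff⟩
    have d1 : deriv (T (-1)) t = 0 := by
      have := deriv_eq_of_eqOn hI eh ht
      rw [deriv_timeComm hI (hT.smooth _) (hT.smooth _) ht, he, hh, deriv.fun_neg] at this
      linarith
    have d2 : deriv (T 1) t = 0 := by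
      have := deriv_eq_of_eqOn hI hf ht
      rw [deriv_timeComm hI (hT.smooth _) (hT.smooth _) ht, hff, hh, deriv.fun_neg] at this
      linarith
    have d3 : deriv (T 0) t = 0 := by
      have := deriv_eq_of_eqOn hI ef ht
      rw [deriv_timeComm hI (hT.smooth _) (hT.smooth _) ht, hff, he, deriv.fun_neg,
        deriv_const_mul_field] at this
      linarith
    have near : ∀ n, deriv (T n) t = 0 → ∀ᶠ s in nhds t, |deriv (T n) s| < 1 / 4 := by
      intro n hn
      have h1 := (cont ((hT.smooth n).deriv hI) t ht).abs
      have h2 : |deriv (T n) t| < 1 / 4 := by rw [hn]; norm_num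
      exact h1.eventually_lt continuousAt_const h2
    filter_upwards [near _ d1, near _ d2, near _ d3, hI.mem_nhds ht] with s h1 h2 h3 hs
    have r1 := eh s hs
    have r2 := hf s hs
    have r3 := ef s hs
    simp only [timeComm] at r1 r2 r3
    have bound : ∀ {x y z w : ℝ}, x * (1 + y) = z * w → |y| < 1 / 4 → |w| < 1 / 4 →
        |x| ≤ |z| / 3 := by
      intro x y z w hxy hy hw
      have h4 : |x| * |1 + y| = |z| * |w| := by rw [← abs_mul, hxy, abs_mul]
      have h5 : 3 / 4 ≤ |1 + y| := by
        have := neg_abs_le y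
        have := le_abs_self (1 + y)
        linarith
      have h6 : |z| * |w| ≤ |z| * (1 / 4) := mul_le_mul_of_nonneg_left hw.le (abs_nonneg z)
      have h7 : |x| * (3 / 4) ≤ |x| * |1 + y| := mul_le_mul_of_nonneg_left h5 (abs_nonneg x)
      linarith
    have b1 : |T (-1) s| ≤ |T 0 s| / 3 :=
      bound (by linear_combination r1) h3 h1
    have b2 : |T 1 s| ≤ |T 0 s| / 3 :=
      bound (y := -deriv (T 0) s) (w := -deriv (T 1) s) (by linear_combination r2)
        (by rwa [abs_neg]) (by rwa [abs_neg])
    have b3 : 2 * |T 0 s| ≤ |T 1 s| * (1 / 4) + |T (-1) s| * (1 / 4) := by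
      have : 2 * |T 0 s| = |T 1 s * deriv (T (-1)) s - T (-1) s * deriv (T 1) s| := by
        rw [show (2 : ℝ) * |T 0 s| = |2 * T 0 s| by rw [abs_mul, abs_two]]
        congr 1
        linarith
      rw [this]
      refine (abs_sub _ _).trans ?_
      rw [abs_mul, abs_mul]
      exact add_le_add (mul_le_mul_of_nonneg_left h1.le (abs_nonneg _))
        (mul_le_mul_of_nonneg_left h2.le (abs_nonneg _))
    have z0 : |T 0 s| = 0 := le_antisymm (by linarith) (abs_nonneg _)
    rw [z0] at b1 b2
    exact ⟨hs, abs_eq_zero.1 (le_antisymm (by linarith) (abs_nonneg _)), abs_eq_zero.1 z0,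
      abs_eq_zero.1 (le_antisymm (by linarith) (abs_nonneg _))⟩
  have oW : IsOpen W := by
    rw [isOpen_iff_mem_nhds]
    rintro t ⟨ht, hne⟩
    have key : ∀ n, T n t ≠ 0 → ∀ᶠ s in nhds t, T n s ≠ 0 := fun n hn =>
      (cont (hT.smooth n) t ht).eventually_ne hn
    have h1 : ∀ᶠ s in nhds t, ¬(T (-1) s = 0 ∧ T 0 s = 0 ∧ T 1 s = 0) := by
      by_cases h1 : T (-1) t = 0
      · by_cases h2 : T 0 t = 0
        · have h3 : T 1 t ≠ 0 := fun h3 => hne ⟨h1, h2, h3⟩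
          filter_upwards [key _ h3] with s hs h using hs h.2.2
        · filter_upwards [key _ h2] with s hs h using hs h.2.1
      · filter_upwards [key _ h1] with s hs h using hs h.1
    filter_upwards [h1, hI.mem_nhds ht] with s h hs using ⟨hs, h⟩
  by_cases hne : (I ∩ U).Nonempty
  · left
    -- The common zero set and its complement in `I` are both open, so connectedness leaves only one
    -- of them.
    have hsub : I ⊆ U := hconn.isPreconnected.subset_left_of_subset_union oU oW
      (Set.disjoint_left.2 fun t h1 h2 => h2.2 h1.2)
      (fun t ht => by
        by_cases h : T (-1) t = 0 ∧ T 0 t = 0 ∧ T 1 t = 0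
        · exact Or.inl ⟨ht, h⟩
        · exact Or.inr ⟨ht, h⟩) hne
    intro n t ht
    by_cases hn : n = 0
    · rw [hn]
      exact (hsub ht).2.2.1
    · have h0 := hT.comm 0 n t ht
      have h1 : deriv (T 0) t = 0 := by
        rw [deriv_eq_of_eqOn hI (g := fun _ => 0) (fun s hs => (hsub hs).2.2.1) ht]
        simp
      rw [timeComm, (hsub ht).2.2.1, h1] at h0
      simp [hn] at h0
      exact h0
  · right
    intro t ht
    by_contra hcon
    push Not at hcon
    refine hne ⟨t, ht, ht, hcon.1, ?_, hcon.2⟩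
    have := cas t ht
    rw [hcon.1, zero_mul] at this
    exact pow_eq_zero_iff (two_ne_zero) |>.1 this

/-- Derivatives of a product up to the third. -/
theorem deriv_mul_three (hI : IsOpen I) {h : ℝ → ℝ} (hf : Smooth I f) (hg : Smooth I g)
    (hh : ∀ t ∈ I, h t = f t * g t) (ht : t ∈ I) :
    deriv h t = deriv f t * g t + f t * deriv g t ∧
    deriv (deriv h) t = deriv (deriv f) t * g t + deriv f t * deriv g t
      + (deriv f t * deriv g t + f t * deriv (deriv g) t) ∧
    deriv (deriv (deriv h)) t = deriv (deriv (deriv f)) t * g t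
      + 3 * deriv (deriv f) t * deriv g t + 3 * deriv f t * deriv (deriv g) t
      + f t * deriv (deriv (deriv g)) t := by
  have f1 := hf.deriv hI
  have g1 := hg.deriv hI
  have f2 := f1.deriv hI
  have g2 := g1.deriv hI
  have e1 : ∀ t ∈ I, deriv h t = deriv f t * g t + f t * deriv g t := fun t ht =>
    (deriv_eq_of_eqOn hI hh ht).trans ((hf.hasDerivAt hI ht).mul (hg.hasDerivAt hI ht)).deriv
  have e2 : ∀ t ∈ I, deriv (deriv h) t = deriv (deriv f) t * g t + deriv f t * deriv g t
      + (deriv f t * deriv g t + f t * deriv (deriv g) t) := fun t ht =>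
    (deriv_eq_of_eqOn hI e1 ht).trans (((f1.hasDerivAt hI ht).mul (hg.hasDerivAt hI ht)).add
      ((hf.hasDerivAt hI ht).mul (g1.hasDerivAt hI ht))).deriv
  refine ⟨e1 t ht, e2 t ht, ?_⟩
  rw [deriv_eq_of_eqOn hI e2 ht]
  refine ((((f2.hasDerivAt hI ht).mul (hg.hasDerivAt hI ht)).add
    ((f1.hasDerivAt hI ht).mul (g1.hasDerivAt hI ht))).add
    (((f1.hasDerivAt hI ht).mul (g1.hasDerivAt hI ht)).add
    ((hf.hasDerivAt hI ht).mul (g2.hasDerivAt hI ht)))).deriv.trans ?_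
  ring

/-- The functions cannot all satisfy a third order equation with nonzero leading coefficient. -/
theorem WittTimes.leading_eq_zero (hI : IsOpen I) (hT : WittTimes I T) (ht : t ∈ I)
    (he : T (-1) t ≠ 0) {c₃ c₁ c₀ : ℝ}
    (hM : ∀ n, c₃ * deriv (deriv (deriv (T n))) t + c₁ * deriv (T n) t + c₀ * T n t = 0) :
    c₃ = 0 := by
  -- The quotient `s = T 0 / T (-1)` is smooth only here. It acts as a local coordinate: `T 0`, `T
  -- 1`, `T 2` are `s`, `s²`, `s³` times `T (-1)`, and `s' T (-1) = -1`.
  set U : Set ℝ := {s | s ∈ I ∧ T (-1) s ≠ 0} with hU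
  have oU : IsOpen U := by
    rw [isOpen_iff_mem_nhds]
    rintro s ⟨hs, hs'⟩
    filter_upwards [hI.mem_nhds hs, (((hT.smooth (-1)).hasDerivAt hI hs).continuousAt).eventually_ne
      hs'] with r h1 h2 using ⟨h1, h2⟩
  have tU : t ∈ U := ⟨ht, he⟩
  have hUI : U ⊆ I := fun s hs => hs.1
  have sm : ∀ n, Smooth U (T n) := fun n => (hT.smooth n).mono hUI
  set s : ℝ → ℝ := fun r => T 0 r / T (-1) r with hs
  have ss : Smooth U s := (sm 0).div ⟨sm (-1), fun r hr => hr.2⟩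
  have q0 : ∀ r ∈ U, T 0 r = s r * T (-1) r := by
    intro r hr
    have := hr.2
    simp only [hs]
    field_simp
  have rel := fun r (hr : r ∈ U) => And.intro (hT.comm (-1) 0 r hr.1) <|
    And.intro (hT.comm 0 1 r hr.1) <| And.intro (hT.comm (-1) 1 r hr.1) <|
    And.intro (hT.comm (-1) 2 r hr.1) (hT.comm 0 2 r hr.1)
  norm_num [timeComm] at rel
  have cas : ∀ r ∈ U, T 0 r ^ 2 = T (-1) r * T 1 r := by
    intro r hr
    obtain ⟨h1, h2, h3, -, -⟩ := rel r hr
    linear_combination -(1 / 2) * T 1 r * h1 - (1 / 2) * T (-1) r * h2 + (1 / 2) * T 0 r * h3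
  have q1 : ∀ r ∈ U, T 1 r = s r * T 0 r := by
    intro r hr
    have h1 := hr.2
    have := cas r hr
    simp only [hs]
    field_simp
    linear_combination -this
  have q2 : ∀ r ∈ U, T 2 r = s r * T 1 r := by
    intro r hr
    have h0 := hr.2
    obtain ⟨h1, -, -, h4, h5⟩ := rel r hr
    simp only [hs]
    field_simp
    linear_combination -(1 / 3) * (T 0 r * h4 - T (-1) r * h5 - T 2 r * h1)
  have ds : deriv s t * T (-1) t = -1 := by
    have h1 := (rel t tU).1
    have h2 : deriv s t = _ := (((sm 0).hasDerivAt oU tU).div ((sm (-1)).hasDerivAt oU tU) he).deriv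
    rw [h2]
    field_simp
    linear_combination h1
  obtain ⟨a1, a2, a3⟩ := deriv_mul_three oU ss (sm (-1)) q0 tU
  obtain ⟨b1, b2, b3⟩ := deriv_mul_three oU ss (sm 0) q1 tU
  obtain ⟨d1, -, d3⟩ := deriv_mul_three oU ss (sm 1) q2 tU
  have v0 := q0 t tU
  have v1 := q1 t tU
  have v2 := q2 t tU
  have h0 := hM 0
  have h1 := hM 1
  have h2 := hM 2
  have h3 := hM (-1)
  rw [d3, d1, v2, b3, b2, b1, v1, a3, a2, a1, v0] at h2
  rw [b3, b1, v1, a3, a2, a1, v0] at h1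
  rw [a3, a1, v0] at h0
  -- Threefold commutator of the operator with multiplication by `s`: the binomial combination
  -- removes everything except `6 c₃ s'^3`.
  have key : c₃ * (6 * deriv s t ^ 3 * T (-1) t) = 0 := by
    linear_combination h2 - 3 * s t * h1 + 3 * s t ^ 2 * h0 - s t ^ 3 * h3
  have ds' : deriv s t ≠ 0 := by
    rintro h
    rw [h, zero_mul] at ds
    norm_num at ds
  exact (mul_eq_zero.1 key).resolve_right
    (mul_ne_zero (mul_ne_zero (by norm_num) (pow_ne_zero _ ds')) he)

end

/-! ### From the Witt relations to relations between the coefficients. -/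

section
variable {I : Set ℝ} {c : Coeffs} {f g τ : ℝ → ℝ} {t : ℝ} {T : ℤ → ℝ → ℝ}

/-- Eliminating `B` between two indices leaves `A` times a commutator, hence `A (m - n) T (m + n) =
0`; the pairs `(-1, 0)` and `(1, 0)` reach `T (-1)` and `T 1`. -/
theorem WittTimes.coeff_eq_zero (hT : WittTimes I T) (ht : t ∈ I)
    (hne : T (-1) t ≠ 0 ∨ T 1 t ≠ 0) {A B : ℝ} (h : ∀ n, A * deriv (T n) t + B * T n t = 0) :
    A = 0 ∧ B = 0 := by
  have key : ∀ m n : ℤ, A * (((m - n : ℤ) : ℝ) * T (m + n) t) = 0 := by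
    intro m n
    rw [← hT.comm m n t ht]
    simp only [timeComm]
    linear_combination T m t * h n - T n t * h m
  have hA : A = 0 := by
    rcases hne with h1 | h1
    · have := key (-1) 0
      norm_num at this
      exact this.resolve_right h1
    · have := key 1 0
      norm_num at this
      exact this.resolve_right h1
  refine ⟨hA, ?_⟩
  rcases hne with h1 | h1
  · have := h (-1)
    rw [hA, zero_mul, zero_add] at this
    exact (mul_eq_zero.1 this).resolve_right h1
  · have := h 1
    rw [hA, zero_mul, zero_add] at this
    exact (mul_eq_zero.1 this).resolve_right h1

theorem WittTimes.leading_eq_zero' (hI : IsOpen I) (hT : WittTimes I T) (ht : t ∈ I)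
    (hne : T (-1) t ≠ 0 ∨ T 1 t ≠ 0) {c₃ c₁ c₀ : ℝ}
    (hM : ∀ n, c₃ * deriv (deriv (deriv (T n))) t + c₁ * deriv (T n) t + c₀ * T n t = 0) :
    c₃ = 0 := by
  rcases hne with h | h
  · exact hT.leading_eq_zero hI ht h hM
  · refine hT.reflect.leading_eq_zero hI ht (c₁ := c₁) (c₀ := c₀) (by simpa using h) fun n => ?_
    have := hM (-n)
    simp only [deriv.fun_neg', deriv.fun_neg]
    linear_combination -this

theorem logRate_mul (hf : SmoothNZ I f) (ht : t ∈ I) : deriv f t = logRate f t * f t :=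
  (div_mul_cancel₀ _ (hf.2 t ht)).symm

/-- The conditions on the coefficients in terms of their logarithmic derivatives. -/
structure RateRelations (I : Set ℝ) (c : Coeffs) : Prop where
  p2_eq : ∀ t ∈ I, c.p2 t = -(c.p1 t * c.r1 t)
  ratio : ∀ t ∈ I, deriv (logRate c.p1) t - deriv (logRate c.p2) t
    = (logRate c.p1 t - logRate c.p2 t) * logRate c.q1 t
  mean : ∀ t ∈ I, logRate c.p1 t + logRate c.p2 t = 2 * logRate c.q1 t
  r1 : ∀ t ∈ I, logRate c.r1 t = logRate c.p2 t - logRate c.p1 t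
  r2 : ∀ t ∈ I, logRate c.r2 t = logRate c.q1 t + logRate c.p2 t - logRate c.p1 t
    - logRate c.q2 t

/-- Each time condition is a linear equation in `τ` whose coefficients do not depend on `n`. The
leading coefficient of `shift` gives `p₂ = -p₁ r₁`; inserting this leaves a first order equation,
and the coefficients of all first order equations vanish. -/
theorem WittTimes.rateRelations (hI : IsOpen I) (hc : c.Admissible I) (hT : WittTimes I T)
    (hne : ∀ t ∈ I, T (-1) t ≠ 0 ∨ T 1 t ≠ 0) (hcond : ∀ n, ∀ t ∈ I, TimeCond c (T n) t) :
    RateRelations I c := by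
  have hp2 : ∀ t ∈ I, c.p2 t = -(c.p1 t * c.r1 t) := by
    intro t ht
    have hp := hc.p1.2 t ht
    have hp' := hc.p2.2 t ht
    have := hT.leading_eq_zero' hI ht (hne t ht) (c₃ := 1 / (2 * c.p1 t) + c.r1 t / (2 * c.p2 t))
      (c₁ := 1 / (2 * c.p1 t) * (2 * deriv (logRate c.p1) t - logRate c.p1 t ^ 2)
        + c.r1 t / (2 * c.p2 t) * (2 * deriv (logRate c.p2) t - logRate c.p2 t ^ 2))
      (c₀ := 1 / (2 * c.p1 t) * (deriv (deriv (logRate c.p1)) t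
          - logRate c.p1 t * deriv (logRate c.p1) t)
        + c.r1 t / (2 * c.p2 t) * (deriv (deriv (logRate c.p2)) t
          - logRate c.p2 t * deriv (logRate c.p2) t)) fun n => by
        have := (hcond n t ht).shift
        rw [deriv_shift hI hc.p1 (hT.smooth n) ht, deriv_shift hI hc.p2 (hT.smooth n) ht] at this
        linear_combination this
    field_simp at this
    linear_combination this
  have hmean : ∀ t ∈ I, logRate c.p1 t + logRate c.p2 t = 2 * logRate c.q1 t := by
    intro t ht
    have := (hT.coeff_eq_zero ht (hne t ht)
      (A := logRate c.p1 t + logRate c.p2 t - 2 * logRate c.q1 t)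
      (B := deriv (logRate c.p1) t + deriv (logRate c.p2) t - 2 * deriv (logRate c.q1) t)
      fun n => by
        have := (hcond n t ht).phase
        rw [deriv_scaleRate hI hc.p1 (hT.smooth n) ht, deriv_scaleRate hI hc.p2 (hT.smooth n) ht,
          deriv_scaleRate hI hc.q1 (hT.smooth n) ht] at this
        have e : ∀ f, logRate f = fun s => deriv f s / f s := fun _ => rfl
        simp only [e]
        linear_combination 2 * this).1
    linarith
  refine ⟨hp2, fun t ht => ?_, hmean, fun t ht => ?_, fun t ht => ?_⟩
  · have hp := hc.p1.2 t ht
    have hr := hc.r1.2 t ht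
    have := (hT.coeff_eq_zero ht (hne t ht)
      (A := 2 * deriv (logRate c.p1) t - logRate c.p1 t ^ 2
        - (2 * deriv (logRate c.p2) t - logRate c.p2 t ^ 2))
      (B := deriv (deriv (logRate c.p1)) t - logRate c.p1 t * deriv (logRate c.p1) t
        - (deriv (deriv (logRate c.p2)) t - logRate c.p2 t * deriv (logRate c.p2) t))
      fun n => by
        have := (hcond n t ht).shift
        rw [deriv_shift hI hc.p1 (hT.smooth n) ht, deriv_shift hI hc.p2 (hT.smooth n) ht,
          hp2 t ht] at this
        field_simp at this
        linear_combination this).1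
    linear_combination (1 / 2) * this
      + (1 / 2) * (logRate c.p1 t - logRate c.p2 t) * hmean t ht
  · have := (hT.coeff_eq_zero ht (hne t ht) (A := 0)
      (B := deriv c.r1 t + c.r1 t * (logRate c.p1 t - logRate c.p2 t)) fun n => by
        have := (hcond n t ht).space
        simp only [scaleRate, logRate] at *
        linear_combination this).2
    rw [logRate_mul hc.r1 ht] at this
    apply mul_right_cancel₀ (hc.r1.2 t ht)
    linear_combination this
  · have := (hT.coeff_eq_zero ht (hne t ht) (A := 0)
      (B := deriv c.r2 t + c.r2 t * (logRate c.q2 t + logRate c.p1 t - logRate c.q1 t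
        - logRate c.p2 t)) fun n => by
        have := (hcond n t ht).source
        simp only [scaleRate, logRate] at *
        linear_combination this).2
    rw [logRate_mul hc.r2 ht] at this
    apply mul_right_cancel₀ (hc.r2.2 t ht)
    linear_combination this

theorem SmoothNZ.hasDerivAt (hI : IsOpen I) (hf : SmoothNZ I f) (ht : t ∈ I) :
    HasDerivAt f (logRate f t * f t) t := by
  rw [← logRate_mul hf ht]
  exact hf.1.hasDerivAt hI ht

/-- Each quotient has derivative zero on the connected set `I`. For the first one, `r₁' / (q₁ r₁)`
is the difference of the rates of `p₂` and `p₁` divided by `q₁`, and `ratio` says that this is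
stationary. -/
theorem RateRelations.relations (hI : IsOpen I) (hconn : IsConnected I) (hc : c.Admissible I)
    (h : RateRelations I c) : Relations I c := by
  refine ⟨h.p2_eq, ?_, ?_, ?_⟩
  · obtain ⟨k, hk⟩ := exists_const_of_hasDerivAt_zero hI hconn
      (f := fun t => (logRate c.p2 t - logRate c.p1 t) / c.q1 t) fun t ht =>
      ((((Smooth.logRate hI hc.p2).hasDerivAt hI ht).sub
        ((Smooth.logRate hI hc.p1).hasDerivAt hI ht)).div (hc.q1.hasDerivAt hI ht)
        (hc.q1.2 t ht)).congr_deriv (by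
          have := hc.q1.2 t ht
          simp only [Pi.sub_apply]
          field_simp
          linear_combination -h.ratio t ht)
    refine ⟨k, fun t ht => ?_⟩
    rw [← hk t ht, logRate_mul hc.r1 ht, h.r1 t ht]
    have := hc.q1.2 t ht
    have := hc.r1.2 t ht
    field_simp
  · refine exists_const_of_hasDerivAt_zero hI hconn fun t ht =>
      (((hc.p1.hasDerivAt hI ht).mul (hc.p2.hasDerivAt hI ht)).div
        ((hc.q1.hasDerivAt hI ht).pow 2) (pow_ne_zero 2 (hc.q1.2 t ht))).congr_deriv ?_
    have := hc.q1.2 t ht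
    simp only [Pi.mul_apply, Pi.pow_apply]
    field_simp
    linear_combination c.p1 t * c.p2 t * c.q1 t * h.mean t ht
  · refine exists_const_of_hasDerivAt_zero hI hconn fun t ht =>
      ((((hc.q1.hasDerivAt hI ht).mul (hc.q2.hasDerivAt hI ht)).mul
        (hc.r2.hasDerivAt hI ht)).div
        ((hc.p2.hasDerivAt hI ht).pow 2) (pow_ne_zero 2 (hc.p2.2 t ht))).congr_deriv ?_
    have := hc.p2.2 t ht
    simp only [Pi.mul_apply, Pi.pow_apply]
    field_simp
    linear_combination c.q1 t * c.q2 t * c.r2 t * c.p2 t * (h.r2 t ht - h.mean t ht)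

end

/-! ### Sufficiency of the relations, and the two tables. -/

section
variable {I : Set ℝ} {c : Coeffs} {f g τ : ℝ → ℝ} {t : ℝ} {k0 k1 r10 r20 : ℝ} {P Q : ℝ → ℝ}

/-- In `phase` and in `shift` with `p₂ = -p₁ r₁`, the coefficient of `τ` is, up to a constant
factor, the derivative of that of `τ'`. So vanishing of the first order coefficients on all of `I`
suffices. -/
theorem RateRelations.timeCond (hI : IsOpen I) (hc : c.Admissible I) (h : RateRelations I c)
    (hτ : Smooth I τ) (ht : t ∈ I) : TimeCond c τ t := by
  have l1 := Smooth.logRate hI hc.p1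
  have l2 := Smooth.logRate hI hc.p2
  have l3 := Smooth.logRate hI hc.q1
  have hmean' : deriv (logRate c.p1) t + deriv (logRate c.p2) t = 2 * deriv (logRate c.q1) t :=
    ((l1.hasDerivAt hI ht).add (l2.hasDerivAt hI ht)).deriv.symm.trans
      ((deriv_eq_of_eqOn hI h.mean ht).trans ((l3.hasDerivAt hI ht).const_mul 2).deriv)
  have hratio : ∀ s ∈ I, 2 * (deriv (logRate c.p1) s - deriv (logRate c.p2) s)
      = logRate c.p1 s * logRate c.p1 s - logRate c.p2 s * logRate c.p2 s := fun s hs => by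
    linear_combination 2 * h.ratio s hs - (logRate c.p1 s - logRate c.p2 s) * h.mean s hs
  have hratio' := ((((l1.deriv hI).hasDerivAt hI ht).sub
    ((l2.deriv hI).hasDerivAt hI ht)).const_mul 2).deriv.symm.trans
      ((deriv_eq_of_eqOn hI hratio ht).trans (((l1.hasDerivAt hI ht).mul
        (l1.hasDerivAt hI ht)).sub ((l2.hasDerivAt hI ht).mul (l2.hasDerivAt hI ht))).deriv)
  have e : ∀ f, logRate f = fun s => deriv f s / f s := fun _ => rfl
  refine ⟨?_, ?_, ?_, ?_⟩
  · rw [deriv_scaleRate hI hc.p1 hτ ht, deriv_scaleRate hI hc.p2 hτ ht,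
      deriv_scaleRate hI hc.q1 hτ ht]
    have := h.mean t ht
    simp only [e] at this hmean'
    linear_combination (1 / 2) * deriv τ t * this + (1 / 2) * τ t * hmean'
  · have := h.r1 t ht
    rw [logRate_mul hc.r1 ht]
    simp only [e, scaleRate] at this ⊢
    linear_combination τ t * c.r1 t * this
  · have := h.r2 t ht
    rw [logRate_mul hc.r2 ht]
    simp only [e, scaleRate] at this ⊢
    linear_combination τ t * c.r2 t * this
  · have hp := hc.p1.2 t ht
    have hr := hc.r1.2 t ht
    rw [deriv_shift hI hc.p1 hτ ht, deriv_shift hI hc.p2 hτ ht, h.p2_eq t ht]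
    field_simp
    linear_combination deriv τ t * hratio t ht + (1 / 2) * τ t * hratio'

theorem exists_antideriv (hI : IsOpen I) (hconn : IsConnected I) (hf : Smooth I f) :
    ∃ F, IsAntideriv I F f := by
  obtain ⟨a, ha⟩ := hconn.nonempty
  refine ⟨fun t => ∫ s in a..t, f s, fun t ht => ?_⟩
  have hsub : Set.uIcc a t ⊆ I := hconn.isPreconnected.ordConnected.uIcc_subset ha ht
  refine intervalIntegral.integral_hasDerivAt_right (hf.continuousOn.mono hsub).intervalIntegrable
    ?_ (hf.continuousOn.continuousAt (hI.mem_nhds ht))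
  exact hf.continuousOn.stronglyMeasurableAtFilter hI t ht

theorem Relations.exists_table1 (hI : IsOpen I) (hconn : IsConnected I) (hc : c.Admissible I)
    (h : Relations I c) : ∃ k0 k1 r10 r20 Q, Table1 I c k0 k1 r10 r20 Q := by
  obtain ⟨hp2, ⟨K, hK⟩, ⟨k₂, h₂⟩, ⟨k₃, h₃⟩⟩ := h
  obtain ⟨Q, hQ⟩ := exists_antideriv hI hconn hc.q1.1
  -- Since `r₁' = K q₁ r₁` and Table 1 has `r₁` proportional to `exp (-2 k₀ Q)`, the exponent must
  -- be `k₀ = -K / 2`; then `r₁ E²` is constant.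
  set E : ℝ → ℝ := fun t => Real.exp (-K / 2 * Q t) with hE
  have dE : ∀ t ∈ I, HasDerivAt E (-K / 2 * c.q1 t * E t) t := fun t ht =>
    (((hQ t ht).const_mul (-K / 2)).exp).congr_deriv (by simp only [hE]; ring)
  have E0 : ∀ t, E t ≠ 0 := fun t => Real.exp_ne_zero _
  obtain ⟨r10, h₄⟩ := exists_const_of_hasDerivAt_zero hI hconn (f := fun t => c.r1 t * E t ^ 2)
    fun t ht => ((hc.r1.1.hasDerivAt hI ht).mul ((dE t ht).pow 2)).congr_deriv (by
      have h1 := hc.q1.2 t ht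
      have h2 := hc.r1.2 t ht
      have h3 := hK t ht
      simp only [Pi.pow_apply]
      field_simp at h3
      rw [h3]
      ring)
  have dF : ∀ t ∈ I, HasDerivAt (fun t => c.p1 t / (c.q1 t * E t))
      (deriv (fun t => c.p1 t / (c.q1 t * E t)) t) t := fun t ht =>
    ((hc.p1.1.hasDerivAt hI ht).div ((hc.q1.1.hasDerivAt hI ht).mul (dE t ht))
      (mul_ne_zero (hc.q1.2 t ht) (E0 t))).differentiableAt.hasDerivAt
  have F2 : ∀ t ∈ I, (c.p1 t / (c.q1 t * E t)) ^ 2 = -k₂ / r10 := fun t ht => by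
    have h1 := hc.q1.2 t ht
    have h2 := hc.r1.2 t ht
    have h3 := E0 t
    rw [← h₂ t ht, ← h₄ t ht, hp2 t ht]
    field_simp
  -- The relations fix only the square of `p₁ / (q₁ E)`. As this function has no zero, a constant
  -- square forces derivative zero, and connectedness fixes the sign.
  obtain ⟨k1, h₅⟩ := exists_const_of_hasDerivAt_zero hI hconn
    (f := fun t => c.p1 t / (c.q1 t * E t)) fun t ht => by
      have h1 := ((dF t ht).pow 2).deriv.symm.trans
        ((deriv_eq_of_eqOn hI (g := fun _ => -k₂ / r10) F2 ht).trans (deriv_const _ _))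
      have h2 : c.p1 t / (c.q1 t * E t) ≠ 0 :=
        div_ne_zero (hc.p1.2 t ht) (mul_ne_zero (hc.q1.2 t ht) (E0 t))
      have h3 : deriv (fun t => c.p1 t / (c.q1 t * E t)) t = 0 := by
        simpa [h2] using h1
      exact (dF t ht).congr_deriv h3
  have e1 : ∀ t, Real.exp (-(-K / 2 * Q t)) = (E t)⁻¹ := fun t => Real.exp_neg _
  have e2 : ∀ t, Real.exp (-(2 * (-K / 2) * Q t)) = (E t ^ 2)⁻¹ := fun t => by
    rw [hE, ← Real.exp_nat_mul, ← Real.exp_neg]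
    congr 1
    push_cast
    ring
  have a1 : ∀ t ∈ I, c.p1 t = k1 * c.q1 t * E t := fun t ht => by
    have h1 := hc.q1.2 t ht
    have h3 := E0 t
    rw [← h₅ t ht]
    field_simp
  have a3 : ∀ t ∈ I, c.r1 t = r10 * (E t ^ 2)⁻¹ := fun t ht => by
    have h3 := E0 t
    rw [← h₄ t ht]
    field_simp
  have a2 : ∀ t ∈ I, c.p2 t = -(r10 * k1 * c.q1 t * (E t)⁻¹) := fun t ht => by
    have h3 := E0 t
    rw [hp2 t ht, a1 t ht, a3 t ht]
    field_simp
  -- The value of `r₂₀` comes from solving `q₁ q₂ r₂ = k₃ p₂²` with `p₂ = -r₁₀ k₁ q₁ / E`.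
  refine ⟨-K / 2, k1, r10, k₃ * r10 ^ 2 * k1 ^ 2, Q, hQ, a1, fun t ht => ?_, fun t ht => ?_,
    fun t ht => ?_⟩
  · rw [e1, a2 t ht]
  · rw [e2, a3 t ht]
  · have h1 := hc.q1.2 t ht
    have h2 := hc.q2.2 t ht
    have h4 := hc.p2.2 t ht
    have h5 := E0 t
    rw [e2]
    have h3 := h₃ t ht
    have h6 : c.q1 t * c.q2 t * c.r2 t = k₃ * c.p2 t ^ 2 := by
      rw [← h3]
      field_simp
    rw [a2 t ht] at h6
    field_simp at h6 ⊢
    linear_combination h6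

theorem Table1.k1_ne (h : Table1 I c k0 k1 r10 r20 Q) (hc : c.Admissible I) (ht : t ∈ I) :
    k1 ≠ 0 := by
  rintro rfl
  exact hc.p1.2 t ht (by simp [h.p1 t ht])

theorem Table1.r10_ne (h : Table1 I c k0 k1 r10 r20 Q) (hc : c.Admissible I) (ht : t ∈ I) :
    r10 ≠ 0 := by
  rintro rfl
  exact hc.r1.2 t ht (by simp [h.r1 t ht])

/-- `k₁ exp (k₀ Q)` has derivative `k₀ p₁`, so it equals `k₀ P + d`. This is the denominator of
Table 2, and its factor `k₁` is compensated by `k₁²` in the new `r₁₀` and `r₂₀`. -/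
theorem Table1.exists_table2 (hI : IsOpen I) (hconn : IsConnected I) (hc : c.Admissible I)
    (h : Table1 I c k0 k1 r10 r20 Q) : ∃ k0 k1 r10 r20 P, Table2 I c k0 k1 r10 r20 P := by
  obtain ⟨P, hP⟩ := exists_antideriv hI hconn hc.p1.1
  obtain ⟨d, hd⟩ := exists_const_of_hasDerivAt_zero hI hconn
    (f := fun t => k1 * Real.exp (k0 * Q t) - k0 * P t) fun t ht =>
      (((((h.antideriv t ht).const_mul k0).exp).const_mul k1).sub
        ((hP t ht).const_mul k0)).congr_deriv (by rw [h.p1 t ht]; ring)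
  have hD : ∀ t ∈ I, k0 * P t + d = k1 * Real.exp (k0 * Q t) := fun t ht => by
    rw [← hd t ht]
    ring
  have e0 : ∀ t, Real.exp (k0 * Q t) ≠ 0 := fun t => Real.exp_ne_zero _
  have e1 : ∀ t, Real.exp (-(k0 * Q t)) = (Real.exp (k0 * Q t))⁻¹ := fun t => Real.exp_neg _
  have e2 : ∀ t, Real.exp (-(2 * k0 * Q t)) = (Real.exp (k0 * Q t) ^ 2)⁻¹ := fun t => by
    rw [← Real.exp_nat_mul, ← Real.exp_neg]
    congr 1
    push_cast
    ring
  refine ⟨k0, d, r10 * k1 ^ 2, r20 * k1 ^ 2, P, hP, fun t ht => ?_, fun t ht => ?_, fun t ht => ?_,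
    fun t ht => ?_, fun t ht => ?_⟩ <;> have hk := h.k1_ne hc ht <;> have he := e0 t <;>
    rw [hD t ht]
  · exact mul_ne_zero hk he
  · rw [h.p1 t ht]
    field_simp
  · rw [h.r1 t ht, e2]
    field_simp
  · rw [h.p1 t ht, h.p2 t ht, e1]
    field_simp
  · have := hc.q2.2 t ht
    rw [h.p1 t ht, h.r2 t ht, e2]
    field_simp

theorem Table2.relations (hI : IsOpen I) (hc : c.Admissible I)
    (h : Table2 I c k0 k1 r10 r20 P) : Relations I c := by
  refine ⟨fun t ht => ?_, ⟨-(2 * k0), fun t ht => ?_⟩, ⟨-r10, fun t ht => ?_⟩,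
    ⟨r20 / r10 ^ 2, fun t ht => ?_⟩⟩ <;> have hD := h.denom_ne t ht <;> have hp := hc.p1.2 t ht
  · rw [h.p2 t ht, h.r1 t ht]
    ring
  · have hr : r10 ≠ 0 := by
      rintro rfl
      exact hc.r1.2 t ht (by simp [h.r1 t ht])
    have e : deriv c.r1 t = _ := (deriv_eq_of_eqOn hI h.r1 ht).trans
      ((hasDerivAt_const t r10).div ((((h.antideriv t ht).const_mul k0).add_const k1).pow 2)
        (pow_ne_zero 2 hD)).deriv
    rw [e, h.q1 t ht, h.r1 t ht]
    simp only [Pi.pow_apply]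
    field_simp
    ring
  · rw [h.p2 t ht, h.q1 t ht]
    field_simp
  · have hr : r10 ≠ 0 := by
      rintro rfl
      exact hc.r1.2 t ht (by simp [h.r1 t ht])
    have := hc.q2.2 t ht
    rw [h.p2 t ht, h.q1 t ht, h.r2 t ht]
    field_simp

theorem Table1.logRate_p1 (hI : IsOpen I) (hc : c.Admissible I)
    (h : Table1 I c k0 k1 r10 r20 Q) (ht : t ∈ I) :
    logRate c.p1 t = logRate c.q1 t + k0 * c.q1 t := by
  have hk := h.k1_ne hc ht
  have hq := hc.q1.2 t ht
  have e : deriv c.p1 t = _ := (deriv_eq_of_eqOn hI h.p1 ht).trans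
    (((hc.q1.1.hasDerivAt hI ht).const_mul k1).mul
      (((h.antideriv t ht).const_mul k0).exp)).deriv
  rw [logRate, logRate, e, h.p1 t ht]
  field_simp

theorem Table1.logRate_p2 (hI : IsOpen I) (hc : c.Admissible I)
    (h : Table1 I c k0 k1 r10 r20 Q) (ht : t ∈ I) :
    logRate c.p2 t = logRate c.q1 t - k0 * c.q1 t := by
  have hk := h.k1_ne hc ht
  have hr := h.r10_ne hc ht
  have hq := hc.q1.2 t ht
  have e : deriv c.p2 t = _ := (deriv_eq_of_eqOn hI h.p2 ht).trans
    ((((hc.q1.1.hasDerivAt hI ht).const_mul (r10 * k1)).mul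
      (((h.antideriv t ht).const_mul k0).neg.exp)).neg).deriv
  rw [logRate, logRate, e, h.p2 t ht]
  simp only [Pi.neg_apply]
  field_simp
  ring

theorem Table1.rateRelations (hI : IsOpen I) (hc : c.Admissible I)
    (h : Table1 I c k0 k1 r10 r20 Q) : RateRelations I c := by
  have a1 := fun s (hs : s ∈ I) => h.logRate_p1 hI hc hs
  have a2 := fun s (hs : s ∈ I) => h.logRate_p2 hI hc hs
  have l1 := Smooth.logRate hI hc.p1
  have l2 := Smooth.logRate hI hc.p2
  refine ⟨fun t ht => ?_, fun t ht => ?_, fun t ht => ?_, fun t ht => ?_, fun t ht => ?_⟩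
  · rw [h.p2 t ht, h.p1 t ht, h.r1 t ht,
      show -(k0 * Q t) = k0 * Q t + -(2 * k0 * Q t) by ring, Real.exp_add]
    ring
  · have e := ((l1.hasDerivAt hI ht).sub (l2.hasDerivAt hI ht)).deriv.symm.trans
      ((deriv_eq_of_eqOn hI (g := fun s => 2 * k0 * c.q1 s) (fun s hs => by
        rw [Pi.sub_apply, a1 s hs, a2 s hs]
        ring) ht).trans ((hc.q1.hasDerivAt hI ht).const_mul (2 * k0)).deriv)
    rw [e, a1 t ht, a2 t ht]
    ring
  · rw [a1 t ht, a2 t ht]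
    ring
  · have hr := h.r10_ne hc ht
    have e : deriv c.r1 t = _ := (deriv_eq_of_eqOn hI h.r1 ht).trans
      ((((h.antideriv t ht).const_mul (2 * k0)).neg.exp).const_mul r10).deriv
    rw [a1 t ht, a2 t ht, logRate, e, h.r1 t ht]
    simp only [Pi.neg_apply]
    field_simp
    ring
  · have hq := hc.q1.2 t ht
    have hq' := hc.q2.2 t ht
    have hr : r20 ≠ 0 := by
      rintro rfl
      exact hc.r2.2 t ht (by simp [h.r2 t ht])
    have e : deriv c.r2 t = _ := (deriv_eq_of_eqOn hI h.r2 ht).trans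
      ((((hc.q1.1.hasDerivAt hI ht).div (hc.q2.1.hasDerivAt hI ht) hq').const_mul r20).mul
        (((h.antideriv t ht).const_mul (2 * k0)).neg.exp)).deriv
    rw [a1 t ht, a2 t ht, logRate, e, h.r2 t ht]
    simp only [Pi.neg_apply, Pi.div_apply, logRate]
    field_simp
    ring

end

/-! ### Symmetry algebras and the coefficient relations. -/

section
variable {I : Set ℝ} {c : Coeffs} {f τ τ' g g' h h' m m' : ℝ → ℝ} {t : ℝ} {V : VF}

theorem scaleRate_congr (hI : IsOpen I) (hτ : ∀ t ∈ I, τ t = τ' t) (ht : t ∈ I) :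
    scaleRate f τ t = scaleRate f τ' t := by
  simp only [scaleRate, hτ t ht, deriv_eq_of_eqOn hI hτ ht]

theorem phaseQuad_congr (hI : IsOpen I) (hτ : ∀ t ∈ I, τ t = τ' t) (ht : t ∈ I) :
    phaseQuad f τ t = phaseQuad f τ' t := by
  simp only [phaseQuad, deriv_eq_of_eqOn hI (fun s hs => scaleRate_congr (f := f) hI hτ hs) ht]

theorem phaseLin_congr (hI : IsOpen I) (hg : ∀ t ∈ I, g t = g' t) (ht : t ∈ I) :
    phaseLin f g t = phaseLin f g' t := by
  simp only [phaseLin, deriv_eq_of_eqOn hI hg ht]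

theorem symField_congr (hI : IsOpen I) (hτ : ∀ t ∈ I, τ t = τ' t) (hg : ∀ t ∈ I, g t = g' t)
    (hh : ∀ t ∈ I, h t = h' t) (hm : ∀ t ∈ I, m t = m' t) :
    EqVF I (symField c τ g h m).toVF (symField c τ' g' h' m').toVF := by
  intro z (hz : z.1 0 ∈ I)
  simp only [Fld.toVF, symField, hτ _ hz, hg _ hz, hh _ hz, hm _ hz,
    scaleRate_congr (f := c.p1) hI hτ hz, scaleRate_congr (f := c.p2) hI hτ hz,
    scaleRate_congr (f := c.q1) hI hτ hz, scaleRate_congr (f := c.q2) hI hτ hz,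
    phaseQuad_congr (f := c.p1) hI hτ hz, phaseQuad_congr (f := c.p2) hI hτ hz,
    phaseLin_congr (f := c.p1) hI hg hz, phaseLin_congr (f := c.p2) hI hh hz,
    deriv_eq_of_eqOn hI (fun s hs => phaseQuad_congr (f := c.p1) hI hτ hs) hz,
    deriv_eq_of_eqOn hI (fun s hs => phaseQuad_congr (f := c.p2) hI hτ hs) hz,
    deriv_eq_of_eqOn hI (fun s hs => phaseLin_congr (f := c.p1) hI hg hs) hz,
    deriv_eq_of_eqOn hI (fun s hs => phaseLin_congr (f := c.p2) hI hh hs) hz,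
    deriv_eq_of_eqOn hI hm hz]

theorem scaleRate_zero (f : ℝ → ℝ) : scaleRate f (fun _ => 0) = fun _ => 0 := by
  funext t
  simp [scaleRate]

theorem phaseQuad_zero (f : ℝ → ℝ) : phaseQuad f (fun _ => 0) = fun _ => 0 := by
  funext t
  simp [phaseQuad, scaleRate_zero]

theorem phaseLin_zero (f : ℝ → ℝ) : phaseLin f (fun _ => 0) = fun _ => 0 := by
  funext t
  simp [phaseLin]

theorem symField_zero : (symField c (fun _ => 0) (fun _ => 0) (fun _ => 0) (fun _ => 0)).toVF
    = 0 := by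
  funext z
  ext i <;> fin_cases i <;>
    simp [Fld.toVF, symField, scaleRate_zero, phaseQuad_zero, phaseLin_zero]

/-- A point at which the four functions of a candidate can be read off. -/
def probe (t : ℝ) : J0 := (![t, 0, 0], ![0, 1, 0])

theorem probe_mem (ht : t ∈ I) : probe t ∈ dom I := by simpa [probe, dom] using ht

theorem symField_probe (t : ℝ) : ((symField c τ g h m).toVF (probe t)).1 0 = τ t ∧
    ((symField c τ g h m).toVF (probe t)).1 1 = g t ∧
    ((symField c τ g h m).toVF (probe t)).1 2 = h t ∧
    ((symField c τ g h m).toVF (probe t)).2 0 = m t := by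
  simp [Fld.toVF, symField, probe]

/-- The factor `k` covers both uses: `k = m - n` for the Witt relations and `k = 1` for uniqueness
of the decomposition. -/
theorem eqOn_of_eqVF_smul {k : ℝ}
    (he : EqVF I (symField c τ g h m).toVF (k • (symField c τ' g' h' m').toVF)) (ht : t ∈ I) :
    τ t = k * τ' t ∧ g t = k * g' t ∧ h t = k * h' t ∧ m t = k * m' t := by
  have e := he (probe_mem ht)
  obtain ⟨a1, a2, a3, a4⟩ := symField_probe (c := c) (τ := τ) (g := g) (h := h) (m := m) t
  obtain ⟨b1, b2, b3, b4⟩ := symField_probe (c := c) (τ := τ') (g := g') (h := h') (m := m') t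
  rw [← a1, ← a2, ← a3, ← a4, ← b1, ← b2, ← b3, ← b4, e]
  simp

theorem AdmitsWitt.rateRelations (hI : IsOpen I) (hconn : IsConnected I) (hc : c.Admissible I)
    (hW : AdmitsWitt I c) : RateRelations I c := by
  obtain ⟨L, hL, hind, hbr⟩ := hW
  choose τ g h m sτ sg sh sm he hcond using fun n => (hL n).exists_symField hI hc
  have key : ∀ a b : ℤ, EqVF I (symField c (timeComm (τ a) (τ b))
      (spaceComm c.p1 (τ a) (τ b) (g a) (g b)) (spaceComm c.p2 (τ a) (τ b) (h a) (h b))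
      (phaseComm c (τ a) (τ b) (g a) (g b) (h a) (h b) (m a) (m b))).toVF
      (((a - b : ℤ) : ℝ) • (symField c (τ (a + b)) (g (a + b)) (h (a + b)) (m (a + b))).toVF) := by
    intro a b z hz
    rw [← bracket_symField hI hc (sτ a) (sg a) (sh a) (sm a) (sτ b) (sg b) (sh b) (sm b) hz,
      ← bracket_congr hI (he a) (he b) hz, hbr a b hz, Pi.smul_apply, Pi.smul_apply,
      he (a + b) hz]
  have slots := fun (a b : ℤ) (t : ℝ) (ht : t ∈ I) => eqOn_of_eqVF_smul (key a b) ht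
  have hT : WittTimes I τ := ⟨sτ, fun a b t ht => (slots a b t ht).1⟩
  rcases hT.dichotomy hI hconn with h0 | hne
  · exfalso
    -- Every generator is a nonzero multiple of a commutator. Without time components the
    -- commutators have no translations, so `g` and `h` vanish; then `phaseComm` is zero as well, so
    -- `m` vanishes.
    have split : ∀ k : ℤ, ∃ a b : ℤ, a + b = k ∧ ((a - b : ℤ) : ℝ) ≠ 0 := by
      intro k
      by_cases hk : k = 0
      · exact ⟨1, -1, by simp [hk], by norm_num⟩
      · exact ⟨k, 0, by simp, by simpa using hk⟩
    have d0 : ∀ n, ∀ t ∈ I, deriv (τ n) t = 0 := fun n t ht => by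
      rw [deriv_eq_of_eqOn hI (g := fun _ => 0) (h0 n) ht, deriv_const]
    have space : ∀ f : ℝ → ℝ, ∀ a b, ∀ g₁ g₂ : ℝ → ℝ, ∀ t ∈ I,
        spaceComm f (τ a) (τ b) g₁ g₂ t = 0 := fun f a b g₁ g₂ t ht => by
      simp [spaceComm, scaleRate, h0 _ t ht, d0 _ t ht]
    have g0 : ∀ k, ∀ t ∈ I, g k t = 0 := by
      intro k t ht
      obtain ⟨a, b, rfl, hab⟩ := split k
      have := (slots a b t ht).2.1
      rw [space _ _ _ _ _ t ht] at this
      exact (mul_eq_zero.1 this.symm).resolve_left hab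
    have z0 : ∀ k, ∀ t ∈ I, h k t = 0 := by
      intro k t ht
      obtain ⟨a, b, rfl, hab⟩ := split k
      have := (slots a b t ht).2.2.1
      rw [space _ _ _ _ _ t ht] at this
      exact (mul_eq_zero.1 this.symm).resolve_left hab
    have m0 : ∀ k, ∀ t ∈ I, m k t = 0 := by
      intro k t ht
      obtain ⟨a, b, rfl, hab⟩ := split k
      have := (slots a b t ht).2.2.2
      simp only [phaseComm, h0 _ t ht, g0 _ t ht, z0 _ t ht] at this
      simp only [zero_mul, sub_zero, add_zero] at this
      exact (mul_eq_zero.1 this.symm).resolve_left hab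
    refine hind.ne_zero 0 ?_
    funext z
    have := (he 0 z.2).trans (symField_congr hI (h0 0) (g0 0) (z0 0) (m0 0) z.2)
    rw [symField_zero] at this
    exact this
  · exact hT.rateRelations hI hc hne hcond

/-- The time components realising the Virasoro relations. -/
noncomputable def expTime (n : ℤ) (t : ℝ) : ℝ := Real.exp (-(n * t))

theorem smooth_expTime (n : ℤ) : Smooth I (expTime n) := by
  refine ContDiff.contDiffOn ?_
  unfold expTime
  fun_prop

theorem deriv_expTime (n : ℤ) (t : ℝ) : deriv (expTime n) t = -n * expTime n t := by
  have h : HasDerivAt (expTime n) _ t := (((hasDerivAt_id t).const_mul (n : ℝ)).neg).exp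
  rw [h.deriv]
  simp only [expTime, Pi.neg_apply, id]
  ring

theorem expTime_add (a b : ℤ) (t : ℝ) : expTime (a + b) t = expTime a t * expTime b t := by
  rw [expTime, expTime, expTime, ← Real.exp_add]
  congr 1
  push_cast
  ring

theorem timeComm_expTime (a b : ℤ) :
    timeComm (expTime a) (expTime b) = fun t => ((a - b : ℤ) : ℝ) * expTime (a + b) t := by
  funext t
  rw [timeComm, deriv_expTime, deriv_expTime, expTime_add]
  push_cast
  ring

theorem wittTimes_of_eqOn_expTime (hI : IsOpen I) {T : ℤ → ℝ → ℝ} (hs : ∀ n, Smooth I (T n))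
    (hT : ∀ n, ∀ t ∈ I, T n t = expTime n t) : WittTimes I T := by
  refine ⟨hs, fun a b t ht => ?_⟩
  rw [hT (a + b) t ht, ← congrFun (timeComm_expTime a b) t]
  simp only [timeComm, hT _ t ht, deriv_eq_of_eqOn hI (hT _) ht]

/-- Adding the derivative of the relation to `k` times the relation removes the index `k` and
multiplies the other coefficients by `k - n ≠ 0`, which allows induction on the number of terms. -/
theorem expTime_coeff_eq_zero (hI : IsOpen I) (ht : t ∈ I) (s : Finset ℤ) :
    ∀ a : ℤ → ℝ, (∀ t ∈ I, ∑ n ∈ s, a n * expTime n t = 0) → ∀ n ∈ s, a n = 0 := by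
  induction s using Finset.induction_on with
  | empty => simp
  | insert k s hk ih =>
    intro a ha
    have hs : ∀ n ∈ s, a n = 0 := by
      intro n hn
      have h1 := ih (fun n => a n * (k - n)) (fun t ht => ?_) n hn
      · refine (mul_eq_zero.1 h1).resolve_right (sub_ne_zero.2 ?_)
        rintro h
        exact hk (Int.cast_injective (α := ℝ) h ▸ hn)
      · have hd : HasDerivAt (fun t => ∑ n ∈ insert k s, a n * expTime n t)
            (∑ n ∈ insert k s, a n * (-n * expTime n t)) t := by
          refine HasDerivAt.fun_sum fun n _ => HasDerivAt.const_mul _ ?_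
          rw [← deriv_expTime]
          exact (smooth_expTime (I := I) n).hasDerivAt hI ht
        have h2 := hd.deriv.symm.trans (deriv_eq_of_eqOn hI (g := fun _ => 0) ha ht)
        rw [deriv_const, Finset.sum_insert hk] at h2
        have h3 := ha t ht
        rw [Finset.sum_insert hk] at h3
        have h4 : ∑ n ∈ s, a n * (k - n) * expTime n t
            = k * ∑ n ∈ s, a n * expTime n t + ∑ n ∈ s, a n * (-n * expTime n t) := by
          rw [Finset.mul_sum, ← Finset.sum_add_distrib]
          exact Finset.sum_congr rfl fun n _ => by ring
        rw [h4]
        linear_combination k * h3 + h2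
    intro n hn
    rcases Finset.mem_insert.1 hn with rfl | hn
    · have h3 := ha t ht
      rw [Finset.sum_insert hk, Finset.sum_eq_zero (fun i hi => by rw [hs i hi, zero_mul]),
        add_zero] at h3
      exact (mul_eq_zero.1 h3).resolve_right (Real.exp_ne_zero _)
    · exact hs n hn

/-- The functions `exp (-n t)` are independent on `I` and satisfy the Witt relations; linearity and
injectivity of `X` carry both facts over to the fields. -/
theorem AdmitsVirasoro.admitsWitt (hI : IsOpen I) (hconn : IsConnected I)
    (hV : AdmitsVirasoro I c) : AdmitsWitt I c := by
  obtain ⟨X, hX, hlin, hinj, hbr⟩ := hV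
  refine ⟨fun n => X (expTime n), fun n => hX _ (smooth_expTime n), ?_, fun a b z hz => ?_⟩
  · rw [linearIndependent_iff']
    intro s a ha
    have hsm : ∀ s : Finset ℤ, Smooth I (∑ n ∈ s, a n • expTime n) := fun s => by
      refine ContDiffOn.congr (f := fun t => ∑ n ∈ s, a n * expTime n t)
        (ContDiffOn.sum fun n _ => contDiffOn_const.mul (smooth_expTime n)) fun t _ => ?_
      simp
    have hsum : ∀ s : Finset ℤ, EqVF I (X (∑ n ∈ s, a n • expTime n))
        (∑ n ∈ s, a n • X (expTime n)) := by
      intro s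
      induction s using Finset.induction_on with
      | empty =>
        rw [Finset.sum_empty, Finset.sum_empty]
        exact (hinj 0 contDiffOn_const).2 fun _ _ => rfl
      | insert k s hk ih =>
        intro z hz
        have := hlin (a k) 1 _ _ (smooth_expTime k) (hsm s) hz
        rw [one_smul, one_smul] at this
        rw [Finset.sum_insert hk, Finset.sum_insert hk, this, Pi.add_apply, Pi.add_apply, ih hz]
    have h0 : Set.EqOn (∑ n ∈ s, a n • expTime n) 0 I := by
      refine (hinj _ (hsm s)).1 fun z hz => (hsum s hz).trans ?_
      have := congrFun ha ⟨z, hz⟩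
      simpa [Finset.sum_apply] using this
    obtain ⟨t, ht⟩ := hconn.nonempty
    refine expTime_coeff_eq_zero hI ht s a fun t ht => ?_
    simpa using h0 ht
  -- Linearity of `X` is available for combinations of two functions, so a second summand with
  -- coefficient zero is added.
  · have e : expTime a * deriv (expTime b) - expTime b * deriv (expTime a)
        = ((a - b : ℤ) : ℝ) • expTime (a + b) + (0 : ℝ) • expTime 0 := by
      rw [zero_smul, add_zero]
      exact timeComm_expTime a b
    have := hlin ((a - b : ℤ) : ℝ) 0 _ _ (smooth_expTime (a + b)) (smooth_expTime 0) hz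
    rw [← e, zero_smul, add_zero] at this
    exact (hbr _ _ (smooth_expTime a) (smooth_expTime b) hz).trans this

/-- Only the time components enter `TimeCond`, so no commutators of the chosen symmetries are
needed; the functions `exp (-n t)` satisfy the Witt relations and have no zeros. -/
theorem TimeComponentFree.rateRelations (hI : IsOpen I) (hc : c.Admissible I)
    (hV : TimeComponentFree I c) : RateRelations I c := by
  choose V hV hV' using fun n => hV (expTime n) (smooth_expTime n)
  choose τ g h m sτ sg sh sm he hcond using fun n => (hV n).exists_symField hI hc
  have e : ∀ n, ∀ t ∈ I, τ n t = expTime n t := fun n t ht => by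
    rw [← (symField_probe (c := c) (τ := τ n) (g := g n) (h := h n) (m := m n) t).1,
      ← he n (probe_mem ht), hV' n _ (probe_mem ht)]
    simp [probe]
  refine (wittTimes_of_eqOn_expTime hI sτ e).rateRelations hI hc (fun t ht => Or.inl ?_) hcond
  rw [e _ t ht]
  exact Real.exp_ne_zero _

end

/-! ### The generators and the Kac–Moody–Virasoro algebra. -/

section
variable {I : Set ℝ} {c : Coeffs} {f g h m τ τ₁ τ₂ : ℝ → ℝ} {t : ℝ} {k0 k1 r10 r20 : ℝ} {Q : ℝ → ℝ}

theorem genY_eq (c : Coeffs) (g : ℝ → ℝ) :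
    genY c g = (symField c (fun _ => 0) g (fun _ => 0) (fun _ => 0)).toVF := by
  have e : ∀ t, deriv (phaseLin c.p1 g) t = -(1 / 2) * deriv (fun s => deriv g s / c.p1 s) t := by
    intro t
    rw [← deriv_const_mul_field]
    congr 1
    funext s
    rw [phaseLin, mul_comm 2 (c.p1 s), ← div_div]
    ring
  funext z
  simp only [genY, Fld.toVF, symField, scaleRate_zero, phaseQuad_zero, phaseLin_zero, e, phaseLin,
    deriv_const]
  ext i <;> fin_cases i <;> simp [-mul_eq_mul_right_iff, -mul_eq_mul_left_iff] <;> ring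

theorem genZ_eq (c : Coeffs) (h : ℝ → ℝ) :
    genZ c h = (symField c (fun _ => 0) (fun _ => 0) h (fun _ => 0)).toVF := by
  have e : ∀ t, deriv (phaseLin c.p2 h) t = -(1 / 2) * deriv (fun s => deriv h s / c.p2 s) t := by
    intro t
    rw [← deriv_const_mul_field]
    congr 1
    funext s
    rw [phaseLin, mul_comm 2 (c.p2 s), ← div_div]
    ring
  funext z
  simp only [genZ, Fld.toVF, symField, scaleRate_zero, phaseQuad_zero, phaseLin_zero, e, phaseLin,
    deriv_const]
  ext i <;> fin_cases i <;> simp [-mul_eq_mul_right_iff, -mul_eq_mul_left_iff] <;> ring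

theorem genW_eq (c : Coeffs) (m : ℝ → ℝ) :
    genW c m = (symField c (fun _ => 0) (fun _ => 0) (fun _ => 0) m).toVF := by
  funext z
  simp only [genW, Fld.toVF, symField, scaleRate_zero, phaseQuad_zero, phaseLin_zero,
    deriv_const]
  ext i <;> fin_cases i <;> simp

theorem symField_eq_add (c : Coeffs) (τ g h m : ℝ → ℝ) : (symField c τ g h m).toVF
    = (symField c τ (fun _ => 0) (fun _ => 0) (fun _ => 0)).toVF + genY c g + genZ c h
      + genW c m := by
  rw [genY_eq, genZ_eq, genW_eq]
  funext z
  simp only [Pi.add_apply, Fld.toVF, symField, scaleRate_zero, phaseQuad_zero, phaseLin_zero,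
    deriv_const]
  ext i <;> fin_cases i <;> simp <;> ring

theorem Table1.scaleRate_p1 (hI : IsOpen I) (hc : c.Admissible I)
    (h : Table1 I c k0 k1 r10 r20 Q) (ht : t ∈ I) : scaleRate c.p1 τ t
      = 1 / 2 * (deriv τ t + (deriv c.q1 t / c.q1 t + k0 * c.q1 t) * τ t) := by
  have := h.logRate_p1 hI hc ht
  simp only [logRate] at this
  rw [scaleRate, this]
  ring

theorem Table1.scaleRate_p2 (hI : IsOpen I) (hc : c.Admissible I)
    (h : Table1 I c k0 k1 r10 r20 Q) (ht : t ∈ I) : scaleRate c.p2 τ t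
      = 1 / 2 * (deriv τ t + (deriv c.q1 t / c.q1 t - k0 * c.q1 t) * τ t) := by
  have := h.logRate_p2 hI hc ht
  simp only [logRate] at this
  rw [scaleRate, this]
  ring

theorem Table1.Phi_eq (hI : IsOpen I) (hc : c.Admissible I)
    (h : Table1 I c k0 k1 r10 r20 Q) (ht : t ∈ I) (x y : ℝ) :
    Phi c k0 τ t x y = phaseQuad c.p1 τ t * x ^ 2 + phaseQuad c.p2 τ t * y ^ 2 := by
  have hp1 := hc.p1.2 t ht
  have hp2 := hc.p2.2 t ht
  rw [Phi, phaseQuad, phaseQuad,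
    deriv_eq_of_eqOn hI (fun s hs => h.scaleRate_p1 (τ := τ) hI hc hs) ht,
    deriv_eq_of_eqOn hI (fun s hs => h.scaleRate_p2 (τ := τ) hI hc hs) ht,
    deriv_const_mul_field, deriv_const_mul_field]
  generalize deriv (fun s => deriv τ s + (deriv c.q1 s / c.q1 s + k0 * c.q1 s) * τ s) t = A
  generalize deriv (fun s => deriv τ s + (deriv c.q1 s / c.q1 s - k0 * c.q1 s) * τ s) t = B
  field_simp
  ring

/-- `genX` contains `q₁'/q₁ ± k₀ q₁` where the candidate has the logarithmic derivatives of `p₁` and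
`p₂`; Table 1 identifies the two. -/
theorem Table1.genX_eqVF (hI : IsOpen I) (hc : c.Admissible I)
    (h : Table1 I c k0 k1 r10 r20 Q) (hτ : Smooth I τ) :
    EqVF I (genX c k0 τ) (symField c τ (fun _ => 0) (fun _ => 0) (fun _ => 0)).toVF := by
  intro z (hz : z.1 0 ∈ I)
  have hd : ∀ x y, deriv (fun s => Phi c k0 τ s x y) (z.1 0)
      = deriv (phaseQuad c.p1 τ) (z.1 0) * x ^ 2 + deriv (phaseQuad c.p2 τ) (z.1 0) * y ^ 2 :=
    fun x y => (deriv_eq_of_eqOn hI (fun s hs => h.Phi_eq hI hc hs x y) hz).trans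
      ((((Smooth.phaseQuad hI hc.p1 hτ).hasDerivAt hI hz).mul_const (x ^ 2)).add
        (((Smooth.phaseQuad hI hc.p2 hτ).hasDerivAt hI hz).mul_const (y ^ 2))).deriv
  simp only [genX, Fld.toVF, symField, phaseLin_zero, deriv_const, hd, h.Phi_eq hI hc hz,
    h.scaleRate_p1 hI hc hz, h.scaleRate_p2 hI hc hz]
  ext i <;> fin_cases i <;> simp [scaleRate] <;> ring

theorem Table1.commXX (hI : IsOpen I) (hc : c.Admissible I) (h : Table1 I c k0 k1 r10 r20 Q)
    (h₁ : Smooth I τ₁) (h₂ : Smooth I τ₂) : EqVF I (bracket (genX c k0 τ₁) (genX c k0 τ₂))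
      (genX c k0 (timeComm τ₁ τ₂)) := by
  have s0 : Smooth I (fun _ => 0) := Smooth.const 0
  refine (bracket_congr hI (h.genX_eqVF hI hc h₁) (h.genX_eqVF hI hc h₂)).trans
    ((bracket_symField hI hc h₁ s0 s0 s0 h₂ s0 s0 s0).trans
      ((symField_congr hI ?_ ?_ ?_ ?_).trans
        (h.genX_eqVF hI hc (Smooth.timeComm hI h₁ h₂)).symm)) <;> intro t _ <;>
    simp [spaceComm, phaseComm]

/-- Every generator is a candidate with at most one function not zero, so each commutator is
`bracket_symField` with most entries zero. Fullness is `IsSymmetry.exists_symField`, and uniqueness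
follows from evaluation at `probe`. -/
theorem Table1.isKMV (hI : IsOpen I) (hc : c.Admissible I) (h : Table1 I c k0 k1 r10 r20 Q) :
    IsKMV I c k0 k1 r10 Q := by
  have s0 : Smooth I (fun _ => 0) := Smooth.const 0
  have cond := fun τ (hτ : Smooth I τ) t (ht : t ∈ I) =>
    (h.rateRelations hI hc).timeCond hI hc hτ ht
  have sum : ∀ τ g h m, Smooth I τ → EqVF I (symField c τ g h m).toVF
      (genX c k0 τ + genY c g + genZ c h + genW c m) := by
    intro τ g h' m hτ z hz
    rw [symField_eq_add]
    simp only [Pi.add_apply, h.genX_eqVF hI hc hτ hz]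
  refine ⟨fun τ hτ => ?_, fun g hg => ?_, fun k hk => ?_, fun m hm => ?_, fun V hV => ?_, ?_,
    fun τ₁ τ₂ h₁ h₂ => h.commXX hI hc h₁ h₂, fun τ m hτ hm => ?_, fun τ g hτ hg => ?_,
    fun τ k hτ hk => ?_, fun g₁ g₂ h₁ h₂ => ?_, fun k₁ k₂ h₁ h₂ => ?_, fun g k hg hk => ?_,
    fun g m hg hm => ?_, fun k m hk hm => ?_, fun m₁ m₂ h₁ h₂ => ?_⟩
  · exact ((symField_isSymmetry_iff hI hc hτ s0 s0 s0).2 (cond τ hτ)).congr hI hc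
      (h.genX_eqVF hI hc hτ).symm
  · rw [genY_eq]
    exact (symField_isSymmetry_iff hI hc s0 hg s0 s0).2 (cond _ s0)
  · rw [genZ_eq]
    exact (symField_isSymmetry_iff hI hc s0 s0 hk s0).2 (cond _ s0)
  · rw [genW_eq]
    exact (symField_isSymmetry_iff hI hc s0 s0 s0 hm).2 (cond _ s0)
  · obtain ⟨τ, g, k, m, hτ, hg, hk, hm, he, -⟩ := hV.exists_symField hI hc
    exact ⟨τ, g, k, m, hτ, hg, hk, hm, he.trans (sum τ g k m hτ)⟩
  · intro τ g k m τ' g' k' m' hτ _ _ _ hτ' _ _ _ he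
    have e : EqVF I (symField c τ g k m).toVF ((1 : ℝ) • (symField c τ' g' k' m').toVF) := by
      rw [one_smul]
      exact (sum τ g k m hτ).trans (he.trans (sum τ' g' k' m' hτ').symm)
    have := fun t (ht : t ∈ I) => eqOn_of_eqVF_smul e ht
    simp only [one_mul] at this
    exact ⟨fun t ht => (this t ht).1, fun t ht => (this t ht).2.1, fun t ht => (this t ht).2.2.1,
      fun t ht => (this t ht).2.2.2⟩
  · rw [genW_eq, genW_eq]
    refine (bracket_congr hI (h.genX_eqVF hI hc hτ) fun _ _ => rfl).trans
      ((bracket_symField hI hc hτ s0 s0 s0 s0 s0 s0 hm).trans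
        (symField_congr hI ?_ ?_ ?_ ?_)) <;> intro t ht <;>
      simp [timeComm, spaceComm, phaseComm, phaseLin_zero]
  · rw [genY_eq, genY_eq]
    refine (bracket_congr hI (h.genX_eqVF hI hc hτ) fun _ _ => rfl).trans
      ((bracket_symField hI hc hτ s0 s0 s0 s0 hg s0 s0).trans
        (symField_congr hI ?_ ?_ ?_ ?_)) <;> intro t ht <;>
      simp [timeComm, spaceComm, phaseComm, phaseLin_zero]
    rw [h.scaleRate_p1 hI hc ht]
    ring
  · rw [genZ_eq, genZ_eq]
    refine (bracket_congr hI (h.genX_eqVF hI hc hτ) fun _ _ => rfl).trans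
      ((bracket_symField hI hc hτ s0 s0 s0 s0 s0 hk s0).trans
        (symField_congr hI ?_ ?_ ?_ ?_)) <;> intro t ht <;>
      simp [timeComm, spaceComm, phaseComm, phaseLin_zero]
    rw [h.scaleRate_p2 hI hc ht]
    ring
  · rw [genY_eq, genY_eq, genW_eq]
    refine (bracket_symField hI hc s0 h₁ s0 s0 s0 h₂ s0 s0).trans
      (symField_congr hI ?_ ?_ ?_ ?_) <;> intro t ht <;>
      simp [timeComm, spaceComm, phaseComm, phaseLin_zero, scaleRate_zero]
    have hk := h.k1_ne hc ht
    have hq := hc.q1.2 t ht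
    have he := Real.exp_ne_zero (k0 * Q t)
    rw [phaseLin, phaseLin, h.p1 t ht, Real.exp_neg]
    field_simp
    ring
  · rw [genZ_eq, genZ_eq, genW_eq]
    refine (bracket_symField hI hc s0 s0 h₁ s0 s0 s0 h₂ s0).trans
      (symField_congr hI ?_ ?_ ?_ ?_) <;> intro t ht <;>
      simp [timeComm, spaceComm, phaseComm, phaseLin_zero, scaleRate_zero]
    have hk := h.k1_ne hc ht
    have hr := h.r10_ne hc ht
    have hq := hc.q1.2 t ht
    have he := Real.exp_ne_zero (k0 * Q t)
    rw [phaseLin, phaseLin, h.p2 t ht, Real.exp_neg]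
    field_simp
  all_goals
    simp only [genY_eq, genZ_eq, genW_eq]
    rw [← symField_zero (c := c)]
  · refine (bracket_symField hI hc s0 hg s0 s0 s0 s0 hk s0).trans
      (symField_congr hI ?_ ?_ ?_ ?_) <;> intro t ht <;>
      simp [timeComm, spaceComm, phaseComm, phaseLin_zero, scaleRate_zero]
  · refine (bracket_symField hI hc s0 hg s0 s0 s0 s0 s0 hm).trans
      (symField_congr hI ?_ ?_ ?_ ?_) <;> intro t ht <;>
      simp [timeComm, spaceComm, phaseComm, phaseLin_zero, scaleRate_zero]
  · refine (bracket_symField hI hc s0 s0 hk s0 s0 s0 s0 hm).trans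
      (symField_congr hI ?_ ?_ ?_ ?_) <;> intro t ht <;>
      simp [timeComm, spaceComm, phaseComm, phaseLin_zero, scaleRate_zero]
  · refine (bracket_symField hI hc s0 s0 s0 h₁ s0 s0 s0 h₂).trans
      (symField_congr hI ?_ ?_ ?_ ?_) <;> intro t ht <;>
      simp [timeComm, spaceComm, phaseComm, phaseLin_zero, scaleRate_zero]

theorem deriv_comb (hI : IsOpen I) {f f₁ f₂ : ℝ → ℝ} {a b : ℝ} (h₁ : Smooth I f₁)
    (h₂ : Smooth I f₂) (hf : ∀ t ∈ I, f t = a * f₁ t + b * f₂ t) (ht : t ∈ I) :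
    deriv f t = a * deriv f₁ t + b * deriv f₂ t :=
  (deriv_eq_of_eqOn hI hf ht).trans
    (((h₁.hasDerivAt hI ht).const_mul a).add ((h₂.hasDerivAt hI ht).const_mul b)).deriv

theorem symField_comb (hI : IsOpen I) (hc : c.Admissible I) (h₁ : Smooth I τ₁) (h₂ : Smooth I τ₂)
    (a b : ℝ) : EqVF I
      (symField c (a • τ₁ + b • τ₂) (fun _ => 0) (fun _ => 0) (fun _ => 0)).toVF
      (a • (symField c τ₁ (fun _ => 0) (fun _ => 0) (fun _ => 0)).toVF
        + b • (symField c τ₂ (fun _ => 0) (fun _ => 0) (fun _ => 0)).toVF) := by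
  have e1 : ∀ f, ∀ t ∈ I, scaleRate f (a • τ₁ + b • τ₂) t
      = a * scaleRate f τ₁ t + b * scaleRate f τ₂ t := fun f t ht => by
    rw [scaleRate, deriv_comb (f := a • τ₁ + b • τ₂) hI h₁ h₂ (fun _ _ => rfl) ht, scaleRate, scaleRate]
    simp only [Pi.add_apply, Pi.smul_apply, smul_eq_mul]
    ring
  have e2 : ∀ f, SmoothNZ I f → ∀ t ∈ I, phaseQuad f (a • τ₁ + b • τ₂) t
      = a * phaseQuad f τ₁ t + b * phaseQuad f τ₂ t := fun f hf t ht => by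
    rw [phaseQuad, deriv_comb hI (Smooth.scaleRate hI hf h₁) (Smooth.scaleRate hI hf h₂)
      (e1 f) ht, phaseQuad, phaseQuad]
    ring
  intro z (hz : z.1 0 ∈ I)
  have e3 := fun f (hf : SmoothNZ I f) => deriv_comb hI (Smooth.phaseQuad hI hf h₁)
    (Smooth.phaseQuad hI hf h₂) (e2 f hf) hz
  simp only [Pi.add_apply, Pi.smul_apply, Fld.toVF, symField, phaseLin_zero, deriv_const,
    e1 _ _ hz, e2 _ hc.p1 _ hz, e2 _ hc.p2 _ hz, e3 _ hc.p1, e3 _ hc.p2]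
  ext i <;> fin_cases i <;> simp <;> ring

theorem Table1.admitsVirasoro (hI : IsOpen I) (hc : c.Admissible I)
    (h : Table1 I c k0 k1 r10 r20 Q) : AdmitsVirasoro I c := by
  refine ⟨genX c k0, (h.isKMV hI hc).symX, fun a b τ₁ τ₂ h₁ h₂ => ?_, fun τ hτ => ⟨fun h0 => ?_,
    fun h0 => ?_⟩, fun τ₁ τ₂ h₁ h₂ => h.commXX hI hc h₁ h₂⟩
  · have sc : Smooth I (a • τ₁ + b • τ₂) :=
      ((Smooth.const a).mul h₁).add ((Smooth.const b).mul h₂)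
    refine ((h.genX_eqVF hI hc sc).trans (symField_comb hI hc h₁ h₂ a b)).trans fun z hz => ?_
    simp only [Pi.add_apply, Pi.smul_apply, h.genX_eqVF hI hc h₁ hz, h.genX_eqVF hI hc h₂ hz]
  · intro t ht
    have := h0 (probe_mem ht)
    have e : (genX c k0 τ (probe t)).1 0 = τ t := by simp [genX, probe]
    rw [← e, this]
    rfl
  · refine (h.genX_eqVF hI hc hτ).trans ?_
    rw [← symField_zero (c := c)]
    exact symField_congr hI h0 (fun _ _ => rfl) (fun _ _ => rfl) fun _ _ => rfl

theorem Table1.timeComponentFree (hI : IsOpen I) (hc : c.Admissible I)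
    (h : Table1 I c k0 k1 r10 r20 Q) : TimeComponentFree I c := fun τ hτ =>
  ⟨genX c k0 τ, (h.isKMV hI hc).symX τ hτ, fun z _ => by simp [genX]⟩

end

end VCDS

theorem theorem1 (I : Set ℝ) (hopen : IsOpen I) (hconn : IsConnected I)
    (c : VCDS.Coeffs) (hc : c.Admissible I) :
    List.TFAE
      [VCDS.AdmitsVirasoro I c,
       VCDS.AdmitsWitt I c,
       VCDS.TimeComponentFree I c,
       VCDS.Relations I c,
       ∃ (k0 k1 r10 r20 : ℝ) (Q : ℝ → ℝ), VCDS.Table1 I c k0 k1 r10 r20 Q,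
       ∃ (k0 k1 r10 r20 : ℝ) (P : ℝ → ℝ), VCDS.Table2 I c k0 k1 r10 r20 P] ∧
    ∀ (k0 k1 r10 r20 : ℝ) (Q : ℝ → ℝ),
      VCDS.Table1 I c k0 k1 r10 r20 Q → VCDS.IsKMV I c k0 k1 r10 Q := by
  refine ⟨?_, fun k0 k1 r10 r20 Q h => h.isKMV hopen hc⟩
  tfae_have 1 → 2 := VCDS.AdmitsVirasoro.admitsWitt hopen hconn
  tfae_have 2 → 4 := fun h =>
    (VCDS.AdmitsWitt.rateRelations hopen hconn hc h).relations hopen hconn hc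
  tfae_have 3 → 4 := fun h =>
    (VCDS.TimeComponentFree.rateRelations hopen hc h).relations hopen hconn hc
  tfae_have 4 → 5 := VCDS.Relations.exists_table1 hopen hconn hc
  tfae_have 5 → 1 := fun ⟨_, _, _, _, _, h⟩ => h.admitsVirasoro hopen hc
  tfae_have 5 → 3 := fun ⟨_, _, _, _, _, h⟩ => h.timeComponentFree hopen hc
  tfae_have 5 → 6 := fun ⟨_, _, _, _, _, h⟩ => h.exists_table2 hopen hconn hc
  tfae_have 6 → 4 := fun ⟨_, _, _, _, _, h⟩ => h.relations hopen hc
  tfae_finish
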